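/- Let $C$ be a compact connected Riemann surface of genus $\mathfrak g$ with a Torelli marking, i.e. loops $\mathcal A_i,\mathcal B_i$ ($1\le i\le\mathfrak g$) forming a symplectic basis of $H_1(C,\mathbb Z)$. Let $X=e^{-x}$ and $Y=e^{-y}$ be meromorphic functions on $C$ satisfying $H(e^{-x},e^{-y})=0$ for a nonzero polynomial $H$, so that $dx=-dX/X$ and $dy=-dY/Y$ are meromorphic 1-forms. Assume that $dx$ has finitely many zeroes $\alpha_\sigma$ (the branchpoints), that these are simple, and that $dy$ does not vanish there. Let $B$ be the fundamental bidifferential of the second kind on $C\times C$: symmetric, holomorphic off the diagonal, equal to $\frac{dz_1\otimes dz_2}{(z_1-z_2)^2}+\text{holomorphic}$ near the diagonal in any local coordinate, and normalized by $\oint_{\mathcal A_i}B(\cdot,z)=0$ for all $i$ and $z$. Assume that every pole of $dy$ is a pole of $dx$. For each $\sigma$ let $a_\sigma=x(\alpha_\sigma)$ and let $\gamma_\sigma$ be a steepest descent path: an injective continuous path $s\mapsto\gamma_\sigma(s)$, $s\in\mathbb R$, in $C$ with $\gamma_\sigma(0)=\alpha_\sigma$ and $x(\gamma_\sigma(s))=a_\sigma+s^2$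 (for the branch of $x$ continued along $\gamma_\sigma$). Near $\alpha_\sigma$ let $\sqrt{x-a_\sigma}$ be the local coordinate equal to $s$ at $\gamma_\sigma(s)$, and let $y$ be continued along $\gamma_\sigma$ as a continuous function. Define: * $d\xi_{\sigma,0}(z)=-\operatorname{Res}_{z'\to\alpha_\sigma}B(z,z')\,(x(z')-a_\sigma)^{-1/2}$, and $\xi_{\sigma',0}$ on $\gamma_\sigma$ as any branch, continued along $\gamma_\sigma$, of a local primitive of $d\xi_{\sigma',0}$ (meromorphic across $\alpha_{\sigma'}$ if the path meets it); * $f_{\sigma,\sigma'}(u)=\dfrac{\sqrt u}{2\sqrt\pi}\,e^{ua_\sigma}\displaystyle\int_{\gamma_\sigma}e^{-ux}\,\xi_{\sigma',0}\,dx$; * $\hat t_{\sigma,0}$ by $e^{-\hat t_{\sigma,0}}=\displaystyle\lim_{s\to0}\frac{y(\gamma_\sigma(s))-y(\gamma_\sigma(-s))}{s}$ (any choice of the logarithm); * $g_\sigma(u)$ by $e^{-\hat t_{\sigma,0}}\,e^{-g_\sigma(u)}=L_\sigma(u):=\dfrac{2u^{3/2}e^{ua_\sigma}}{\sqrt\pi}\displaystyle\int_{\gamma_\sigma}e^{-ux}\,y\,dx$.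 Then for all $\sigma$ and all complex $u$ with $\operatorname{Re}u>0$ these integrals converge absolutely and $$e^{\hat t_{\sigma,0}}L_\sigma(u)=\sum_{\sigma'}e^{\hat t_{\sigma,0}-\hat t_{\sigma',0}}\,f_{\sigma,\sigma'}(u),$$ that is, $$e^{-g_\sigma(u)}=\sum_{\sigma'}e^{\hat t_{\sigma,0}-\hat t_{\sigma',0}}\,f_{\sigma,\sigma'}(u)$$ for every number $g_\sigma(u)$ satisfying its defining relation. Moreover $g_\sigma(u)$ exists for all sufficiently large real $u$ and can be chosen so that $g_\sigma(u)\to0$ as $u\to+\infty$. -/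

import Mathlib

open scoped Manifold ContDiff Topology
open Filter Set

noncomputable section

namespace RSurf

variable {C : Type*} [TopologicalSpace C] [ChartedSpace ℂ C]

/-! ### Differential forms, path integrals and surface integrals -/

/-- Complex-valued (real-linear) differential 1-forms on the surface. -/
abbrev OneForm (C : Type*) [TopologicalSpace C] [ChartedSpace ℂ C] : Type _ :=
  (p : C) → TangentSpace 𝓘(ℝ, ℂ) p →L[ℝ] ℂ

/-- The expression of a 1-form in a chart: its pull-back under the inverse of the chart. -/
def OneForm.pull (θ : OneForm C) (e : OpenPartialHomeomorph C ℂ) (z : ℂ) : ℂ →L[ℝ] ℂ :=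
  (θ (e.symm z)).comp (mfderiv 𝓘(ℝ, ℂ) 𝓘(ℝ, ℂ) e.symm z)

/-- Smooth closed 1-forms: in every chart, the coefficients are smooth and the exterior
derivative vanishes. -/
def OneForm.IsClosedSmooth (θ : OneForm C) : Prop :=
  ∀ e ∈ atlas ℂ C, ContDiffOn ℝ ∞ (θ.pull e) e.target ∧
    ∀ z ∈ e.target, ∀ v w : ℂ, fderiv ℝ (θ.pull e) z v w = fderiv ℝ (θ.pull e) z w v

/-- The velocity vector of a path. -/
def velocity (c : ℝ → C) (t : ℝ) : TangentSpace 𝓘(ℝ, ℂ) (c t) :=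
  mfderiv 𝓘(ℝ, ℝ) 𝓘(ℝ, ℂ) c t (1 : ℝ)

/-- `c` restricted to `[0,1]` is a piecewise `C¹` loop. -/
def IsLoop (c : ℝ → C) : Prop :=
  c 0 = c 1 ∧ ∃ (n : ℕ) (t : Fin (n + 1) → ℝ), StrictMono t ∧ t 0 = 0 ∧ t (Fin.last n) = 1 ∧
    ∀ i : Fin n, ContMDiffOn 𝓘(ℝ, ℝ) 𝓘(ℝ, ℂ) 1 c (Icc (t i.castSucc) (t i.succ))

/-- The integral `∮_c θ` of a 1-form over a loop `c` parametrised by `[0,1]`. -/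
def loopIntegral (c : ℝ → C) (θ : (p : C) → TangentSpace 𝓘(ℝ, ℂ) p → ℂ) : ℂ :=
  ∫ t in (0 : ℝ)..1, θ (c t) (velocity c t)

/-- A continuous partition of unity subordinate to the domains of the preferred charts. -/
theorem exists_chartPartition (C : Type*) [TopologicalSpace C] [ChartedSpace ℂ C]
    [T2Space C] [CompactSpace C] :
    ∃ ρ : PartitionOfUnity C C univ, ρ.IsSubordinate fun p => (chartAt ℂ p).source :=
  PartitionOfUnity.exists_isSubordinate isClosed_univ _ (fun p => (chartAt ℂ p).open_source)
    fun p _ => mem_iUnion.2 ⟨p, mem_chart_source ℂ p⟩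

/-- The integral `∫_C θ ∧ η` over the compact surface, oriented by its complex structure:
in a coordinate `z = x + i y` one has `θ ∧ η = (θ_x η_y - θ_y η_x) dx dy`, and the contributions
of the charts are glued by a partition of unity. -/
def wedgeIntegral [T2Space C] [CompactSpace C] (θ η : OneForm C) : ℂ :=
  ∑ᶠ p : C, ∫ z in (chartAt ℂ p).target,
    (((exists_chartPartition C).choose p ((chartAt ℂ p).symm z) : ℝ) : ℂ) *
      (θ.pull (chartAt ℂ p) z 1 * η.pull (chartAt ℂ p) z Complex.I -
        θ.pull (chartAt ℂ p) z Complex.I * η.pull (chartAt ℂ p) z 1)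

/-- `η` is a closed form in the Poincaré dual class of the loop `c`. -/
def IsPoincareDual [T2Space C] [CompactSpace C] (c : ℝ → C) (η : OneForm C) : Prop :=
  η.IsClosedSmooth ∧ ∀ θ : OneForm C, θ.IsClosedSmooth →
    loopIntegral c (fun p => θ p) = wedgeIntegral θ η

/-- The homological intersection number of the loops `c` and `c'` is `n`: the integral over `c'`
of a closed form Poincaré dual to `c` is `n`. -/
def HasIntersectionNumber [T2Space C] [CompactSpace C] (c c' : ℝ → C) (n : ℤ) : Prop :=
  ∃ η : OneForm C, IsPoincareDual c η ∧ loopIntegral c' (fun p => η p) = n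

/-- A Torelli marking: loops `A_i`, `B_i` (`i = 1, …, g`) whose classes form a symplectic basis of
`H₁(C, ℤ)`, i.e. `A_i · B_j = δ_{ij}`, `A_i · A_j = B_i · B_j = 0`, and every loop is homologous to
an integral combination of the `A_i`, `B_i`. As `H₁(C, ℤ)` has no torsion, two cycles are
homologous if and only if all closed forms have the same integral over both. -/
structure TorelliMarking (C : Type*) [TopologicalSpace C] [ChartedSpace ℂ C]
    [T2Space C] [CompactSpace C] (g : ℕ) where
  A : Fin g → ℝ → C
  B : Fin g → ℝ → C
  loopA : ∀ i, IsLoop (A i)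
  loopB : ∀ i, IsLoop (B i)
  interAA : ∀ i j, HasIntersectionNumber (A i) (A j) 0
  interBB : ∀ i j, HasIntersectionNumber (B i) (B j) 0
  interAB : ∀ i j, HasIntersectionNumber (A i) (B j) (if i = j then 1 else 0)
  generate : ∀ c : ℝ → C, IsLoop c → ∃ m n : Fin g → ℤ,
    ∀ θ : OneForm C, θ.IsClosedSmooth →
      loopIntegral c (fun p => θ p) =
        ∑ i, ((m i : ℂ) * loopIntegral (A i) (fun p => θ p) +
          (n i : ℂ) * loopIntegral (B i) (fun p => θ p))

/-! ### Meromorphic functions and the Bergman kernel -/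

/-- The coordinate vector field `∂/∂z` of the chart `e`, at the point with coordinate `z`. -/
def coordVec (e : OpenPartialHomeomorph C ℂ) (z : ℂ) : TangentSpace 𝓘(ℂ, ℂ) (e.symm z) :=
  mfderiv 𝓘(ℂ, ℂ) 𝓘(ℂ, ℂ) e.symm z (1 : ℂ)

/-- Meromorphic functions on the surface, with the value `0` at the poles and the correct value
everywhere else. -/
def IsMeromorphic (f : C → ℂ) : Prop :=
  ∀ p : C, MeromorphicNFAt (f ∘ (chartAt ℂ p).symm) (chartAt ℂ p p)

/-- The order of the meromorphic function `f` at `p`. -/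
def ord (f : C → ℂ) (p : C) : WithTop ℤ :=
  meromorphicOrderAt (f ∘ (chartAt ℂ p).symm) (chartAt ℂ p p)

/-- The order at `p` of the meromorphic 1-form `df / f`: positive at its zeroes, negative at its
poles. -/
def ordDlog (f : C → ℂ) (p : C) : WithTop ℤ :=
  meromorphicOrderAt (logDeriv (f ∘ (chartAt ℂ p).symm)) (chartAt ℂ p p)

/-- Bidifferentials on the surface, as fields of bilinear forms; the values on the diagonal are
irrelevant. -/
abbrev BiDiff (C : Type*) [TopologicalSpace C] [ChartedSpace ℂ C] : Type _ :=
  (p q : C) → TangentSpace 𝓘(ℂ, ℂ) p →L[ℂ] TangentSpace 𝓘(ℂ, ℂ) q →L[ℂ] ℂ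

/-- The coefficient `b(z, w)` in `B = b(z, w) dz ⊗ dw`, for the coordinates `z` of `e` and `w` of
`e'`. -/
def BiDiff.coeff (B : BiDiff C) (e e' : OpenPartialHomeomorph C ℂ) (z w : ℂ) : ℂ :=
  B (e.symm z) (e'.symm w) (coordVec e z) (coordVec e' w)

/-- `B` is a symmetric bidifferential, holomorphic off the diagonal, and equal to
`dz ⊗ dw / (z - w)² + holomorphic` near the diagonal in any local coordinate. -/
structure BiDiff.IsBergman (B : BiDiff C) : Prop where
  symm : ∀ p q : C, p ≠ q → ∀ v w, B p q v w = B q p w v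
  holo : ∀ e ∈ atlas ℂ C, ∀ e' ∈ atlas ℂ C, ∀ z ∈ e.target, ∀ w ∈ e'.target,
    e.symm z ≠ e'.symm w → AnalyticAt ℂ (fun r : ℂ × ℂ => B.coeff e e' r.1 r.2) (z, w)
  diag : ∀ e ∈ atlas ℂ C, ∀ z ∈ e.target, ∃ h : ℂ × ℂ → ℂ, AnalyticAt ℂ h (z, z) ∧
    ∀ᶠ r : ℂ × ℂ in 𝓝 (z, z), r.1 ≠ r.2 →
      B.coeff e e r.1 r.2 = 1 / (r.1 - r.2) ^ 2 + h r

/-- `∮_{A_i} B(·, q) = 0` for all `i` and all `q`. -/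
def BiDiff.IsNormalized [T2Space C] [CompactSpace C] {g : ℕ} (B : BiDiff C)
    (M : TorelliMarking C g) : Prop :=
  ∀ (i : Fin g) (q : C), (∀ t ∈ Icc (0 : ℝ) 1, M.A i t ≠ q) →
    ∀ w : TangentSpace 𝓘(ℂ, ℂ) q, loopIntegral (M.A i) (fun p v => B p q v w) = 0

/-! ### Spectral curves -/

/-- A regular spectral curve on the Torelli marked compact Riemann surface `C`, with equation
`H(X, Y) = 0`, `X = e^{-x}`, `Y = e^{-y}`, so that `dx = -dX/X` and `dy = -dY/Y`. The branchpoints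
`α σ` are the zeroes of `dx`; they are simple, and `dy` does not vanish there. The kernel `B` is the
fundamental form of the second kind normalized on the `A`-cycles. -/
structure SpectralCurve (C : Type*) [TopologicalSpace C] [ChartedSpace ℂ C]
    [T2Space C] [CompactSpace C] (ι : Type*) (g : ℕ) where
  X : C → ℂ
  Y : C → ℂ
  meroX : IsMeromorphic X
  meroY : IsMeromorphic Y
  H : MvPolynomial (Fin 2) ℂ
  H_ne_zero : H ≠ 0
  equation : ∀ p : C, 0 ≤ ord X p → 0 ≤ ord Y p → MvPolynomial.eval ![X p, Y p] H = 0
  α : ι → C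
  α_injective : Function.Injective α
  range_α : range α = {p | 0 < ordDlog X p}
  simple_zero : ∀ σ, ordDlog X (α σ) = 1
  dy_ne_zero : ∀ σ, ¬ 0 < ordDlog Y (α σ)
  marking : TorelliMarking C g
  B : BiDiff C
  bergman : B.IsBergman
  normalized : B.IsNormalized marking

/-- The residue at `z₀` of `f(z) dz`, as an integral over small circles. -/
def residueAt (f : ℂ → ℂ) (z₀ : ℂ) : ℂ :=
  limUnder (𝓝[>] (0 : ℝ)) fun r => (2 * Real.pi * Complex.I)⁻¹ * ∮ z in C(z₀, r), f z

variable [T2Space C] [CompactSpace C] {ι : Type*} {g : ℕ}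

/-- The steepest descent paths of a spectral curve, together with the choices of branches.

`γ σ` is an arc through the branchpoint `α σ`, parametrised so that `x = a σ + s²` at the point
`γ σ s`; `ζ σ` is the local coordinate `√(x - a σ)` near `α σ`, with the sign for which it increases
along `γ σ`; `y σ s` is the value at `γ σ s` of a continuous branch of `y = -ln Y` along `γ σ`. -/
structure SteepestDescent (S : SpectralCurve C ι g) where
  a : ι → ℂ
  γ : ι → ℝ → C
  γ_continuous : ∀ σ, Continuous (γ σ)
  γ_injective : ∀ σ, Function.Injective (γ σ)
  γ_zero : ∀ σ, γ σ 0 = S.α σ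
  x_γ : ∀ σ s, S.X (γ σ s) = Complex.exp (-(a σ + (s : ℂ) ^ 2))
  ζ : ι → C → ℂ
  ζ_holo : ∀ σ, ∀ᶠ p in 𝓝 (S.α σ), MDifferentiableAt 𝓘(ℂ, ℂ) 𝓘(ℂ, ℂ) (ζ σ) p
  ζ_sq : ∀ σ, ∀ᶠ p in 𝓝 (S.α σ), S.X p = Complex.exp (-(a σ + ζ σ p ^ 2))
  ζ_γ : ∀ σ, ∀ᶠ s : ℝ in 𝓝 0, ζ σ (γ σ s) = s
  y : ι → ℝ → ℂ
  y_continuous : ∀ σ, Continuous (y σ)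
  y_γ : ∀ σ s, S.Y (γ σ s) = Complex.exp (-y σ s)

namespace SteepestDescent

variable {S : SpectralCurve C ι g} (D : SteepestDescent S)

/-- The 1-form `dξ_{σ,0}(p) = - Res_{q → α_σ} B(p, q) (x(q) - a_σ)^{-1/2}`. -/
def dξ (σ : ι) (p : C) (v : TangentSpace 𝓘(ℂ, ℂ) p) : ℂ :=
  -residueAt (fun z => S.B p ((chartAt ℂ (S.α σ)).symm z) v (coordVec (chartAt ℂ (S.α σ)) z) /
      D.ζ σ ((chartAt ℂ (S.α σ)).symm z)) (chartAt ℂ (S.α σ) (S.α σ))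

/-- `ξ : ℝ → ℂ` is a branch along `γ_σ` of the function `ξ_{σ',0}`: near each point of the arc it
is the restriction of a local primitive of `dξ_{σ',0}`, which is single-valued in a neighbourhood
of that point (with a pole at `α_{σ'}`). -/
def IsBranch (σ σ' : ι) (ξ : ℝ → ℂ) : Prop :=
  ∀ s₀ : ℝ, ∃ F : C → ℂ,
    (∀ᶠ p in 𝓝 (D.γ σ s₀), p ≠ S.α σ' → MDifferentiableAt 𝓘(ℂ, ℂ) 𝓘(ℂ, ℂ) F p ∧
      ∀ v : TangentSpace 𝓘(ℂ, ℂ) p, mfderiv 𝓘(ℂ, ℂ) 𝓘(ℂ, ℂ) F p v = D.dξ σ' p v) ∧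
    ∀ᶠ s in 𝓝 s₀, D.γ σ s ≠ S.α σ' → ξ s = F (D.γ σ s)

/-- The integrand of `∫_{γ_σ} e^{-u x} h dx`, where `x = a_σ + s²` and `dx = 2 s ds`. -/
def integrand (σ : ι) (h : ℝ → ℂ) (u : ℂ) (s : ℝ) : ℂ :=
  Complex.exp (-u * (D.a σ + (s : ℂ) ^ 2)) * h s * (2 * s)

/-- `∫_{γ_σ} e^{-u x} h dx`. -/
def laplace (σ : ι) (h : ℝ → ℂ) (u : ℂ) : ℂ := ∫ s : ℝ, D.integrand σ h u s

/-- `(2 u^{3/2} e^{u a_σ} / √π) ∫_{γ_σ} e^{-u x} y dx`, the Laplace transform of `y dx`. -/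
def laplaceY (σ : ι) (u : ℂ) : ℂ :=
  2 * u ^ (3 / 2 : ℂ) * Complex.exp (u * D.a σ) / (Real.sqrt Real.pi : ℂ) * D.laplace σ (D.y σ) u

/-- `f_{σ,σ'}(u) = (√u / (2 √π)) e^{u a_σ} ∫_{γ_σ} e^{-u x} ξ_{σ',0} dx`, for a branch `ξ` of
`ξ_{σ',0}` along `γ_σ`. -/
def f (σ : ι) (ξ : ℝ → ℂ) (u : ℂ) : ℂ :=
  u ^ (1 / 2 : ℂ) / (2 * (Real.sqrt Real.pi : ℂ)) * Complex.exp (u * D.a σ) * D.laplace σ ξ u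

/-- `t` is a value of the time `t̂_{σ,0}`:
`e^{-t} = lim_{z → α_σ} (y(z) - y(z̄)) / √(x(z) - a_σ)`, where `z = γ_σ(s)`, `z̄ = γ_σ(-s)`. -/
def IsTimeZero (σ : ι) (t : ℂ) : Prop :=
  Tendsto (fun s : ℝ => (D.y σ s - D.y σ (-s)) / (s : ℂ)) (𝓝[≠] 0) (𝓝 (Complex.exp (-t)))

end SteepestDescent

end RSurf

end

/-! Since `dX/X` and `dY/Y` have at most simple poles and every pole of `dy` is a pole of `dx`, the
function `dy/dx` extends holomorphically across every point except the branchpoints, where it has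
simple poles. For a generic point `p`, apply the residue theorem to the 1-form `q ↦ (dy/dx)(q)
B(p,q)`. The double pole of `B` at `q = p` contributes the differential of `dy/dx` at `p`. The
simple pole at `α_σ'` contributes a multiple of `B(p, α_σ')`, that is, of `dξ_{σ',0}(p)`. Keeping
track of the constants gives `4 d(dy/dx) = ∑ e^{-t̂_σ'} dξ_{σ',0}` (`diff_dydx`), hence `∑
e^{-t̂_σ'} ξ_{σ',0} = 4 dy/dx + c` along `γ_σ` (`exists_sum_branch_eq`).

Integration by parts gives `u ∫ e^{-ux} y dx = ∫ e^{-ux} (dy/dx) dx` (`mul_laplace_y`). The constant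
`c` drops out because `e^{-ux} dx` is odd in `s`, and the identity between the Laplace transforms
follows (`laplaceY_eq_sum`).

The analysis rests on four facts. The residue theorem (`sum_residue_eq_zero`) is Stokes' theorem
applied to a partition of unity. The ends of `γ_σ` approach points where `X` takes the value `0`;
there `dy/dx` and `dξ/dx` are bounded, so `y` and `ξ` are `O(s²)` and the Gaussian factor dominates
(`exists_y_growth`, `exists_branch_growth`). If `γ_σ` meets `α_σ'`, the integrand containing
`ξ_{σ',0}` is at worst of size `|s - s₀|^{-1/2}`, which is integrable (`exists_branch_bound`).
Finally, Watson's lemma at leading order gives `L_σ(u) → e^{-t̂_σ}` (`tendsto_laplaceY`), so `g_σ`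
can be taken as minus the principal logarithm of `e^{t̂_σ} L_σ`. -/

noncomputable section

namespace RSurf

set_option linter.unusedSectionVars false

/-! ### Functions and 1-forms in charts, and their behaviour under coordinate changes. -/

section Charts

variable {C : Type*} [TopologicalSpace C] [ChartedSpace ℂ C]

/-- The derivative at `z` of the coordinate change from `e` to the preferred chart at the point
with coordinate `z`; it is the coordinate of `∂/∂z` in the tangent space. -/
def chartJac (e : OpenPartialHomeomorph C ℂ) (z : ℂ) : ℂ :=
  deriv (chartAt ℂ (e.symm z) ∘ e.symm) z

/-- The coefficient of the 1-form `θ` (given by its coefficients in the preferred charts) in the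
chart `e`. -/
def formCoeff (θ : C → ℂ) (e : OpenPartialHomeomorph C ℂ) (z : ℂ) : ℂ :=
  θ (e.symm z) * chartJac e z

/-- The logarithmic derivative of `f`, as a 1-form given by its coefficients in the preferred
charts. -/
def dlog (f : C → ℂ) (p : C) : ℂ :=
  logDeriv (f ∘ (chartAt ℂ p).symm) (chartAt ℂ p p)

/-- The differential of `f`, as a 1-form given by its coefficients in the preferred charts. -/
def diff (f : C → ℂ) (p : C) : ℂ :=
  deriv (f ∘ (chartAt ℂ p).symm) (chartAt ℂ p p)

lemma chartJac_self (p : C) : chartJac (chartAt ℂ p) (chartAt ℂ p p) = 1 := by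
  have hp := mem_chart_source ℂ p
  have : (chartAt ℂ p ∘ (chartAt ℂ p).symm) =ᶠ[𝓝 (chartAt ℂ p p)] id := by
    filter_upwards [(chartAt ℂ p).open_target.mem_nhds (mem_chart_target ℂ p)] with z hz
    simp [hz]
  simp only [chartJac, (chartAt ℂ p).left_inv hp]
  rw [this.deriv_eq, deriv_id]

lemma formCoeff_self (θ : C → ℂ) (p : C) :
    formCoeff θ (chartAt ℂ p) (chartAt ℂ p p) = θ p := by
  simp [formCoeff, chartJac_self, mem_chart_source]

lemma eventually_nhds_chart {e : OpenPartialHomeomorph C ℂ} {p : C} (hp : p ∈ e.source)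
    {P : C → Prop} : (∀ᶠ q in 𝓝 p, P q) ↔ ∀ᶠ z in 𝓝 (e p), P (e.symm z) := by
  rw [← e.symm_map_nhds_eq hp, Filter.eventually_map]

lemma map_symm_nhdsNE {e : OpenPartialHomeomorph C ℂ} {p : C} (hp : p ∈ e.source) :
    map e.symm (𝓝[≠] (e p)) = 𝓝[≠] p := by
  have h := e.symm.map_nhdsWithin_preimage_eq (x := e p) (by simpa using e.map_source hp) {p}ᶜ
  rw [e.left_inv hp] at h
  rw [← h]
  congr 1
  refine nhdsWithin_eq_nhdsWithin (e.map_source hp) e.open_target ?_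
  ext z
  simp only [mem_inter_iff, mem_compl_iff, mem_singleton_iff, mem_preimage]
  refine ⟨fun ⟨h1, h2⟩ => ⟨fun h => h1 ?_, h2⟩, fun ⟨h1, h2⟩ => ⟨fun h => h1 ?_, h2⟩⟩
  · rw [← h, e.right_inv h2]
  · rw [h, e.left_inv hp]

lemma eventually_nhdsNE_chart {e : OpenPartialHomeomorph C ℂ} {p : C} (hp : p ∈ e.source)
    {P : C → Prop} : (∀ᶠ q in 𝓝[≠] p, P q) ↔ ∀ᶠ z in 𝓝[≠] (e p), P (e.symm z) := by
  rw [← map_symm_nhdsNE hp, Filter.eventually_map]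

variable [IsManifold 𝓘(ℂ, ℂ) ω C]

lemma analyticAt_transition {e e' : OpenPartialHomeomorph C ℂ} (he : e ∈ atlas ℂ C)
    (he' : e' ∈ atlas ℂ C) {z : ℂ} (hz : z ∈ e.target) (hz' : e.symm z ∈ e'.source) :
    AnalyticAt ℂ (e' ∘ e.symm) z := by
  have h := (contDiffGroupoid ω 𝓘(ℂ, ℂ)).compatible he he'
  rw [contDiffGroupoid, mem_groupoid_of_pregroupoid] at h
  have h1 : ContDiffOn ℂ ω (e.symm.trans e') (e.symm.trans e').source := by
    simpa [contDiffPregroupoid] using h.1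
  have hm : z ∈ (e.symm.trans e').source := by simp [hz, hz']
  have h2 := (h1.contDiffAt ((e.symm.trans e').open_source.mem_nhds hm)).analyticAt
  simpa using h2

lemma deriv_transition_ne_zero {e e' : OpenPartialHomeomorph C ℂ} (he : e ∈ atlas ℂ C)
    (he' : e' ∈ atlas ℂ C) {z : ℂ} (hz : z ∈ e.target) (hz' : e.symm z ∈ e'.source) :
    deriv (e' ∘ e.symm) z ≠ 0 := by
  have h1 := analyticAt_transition he he' hz hz'
  have h2 : AnalyticAt ℂ (e ∘ e'.symm) (e' (e.symm z)) :=
    analyticAt_transition he' he (e'.map_source hz') (by simpa [hz'] using e.map_target hz)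
  have h3 : (e ∘ e'.symm) ∘ (e' ∘ e.symm) =ᶠ[𝓝 z] id := by
    filter_upwards [e.open_target.mem_nhds hz,
      (e.continuousAt_symm hz).eventually_mem (e'.open_source.mem_nhds hz')] with w hw hw'
    simp [hw, hw']
  intro h0
  have h4 := deriv_comp z (h₂ := e ∘ e'.symm) (h := e' ∘ e.symm) h2.differentiableAt
    h1.differentiableAt
  rw [h3.deriv_eq, h0] at h4
  simp at h4

/-- The chain rule for coordinate changes, for arbitrary functions. -/
lemma deriv_comp_symm_eq (f : C → ℂ) {e e' : OpenPartialHomeomorph C ℂ} (he : e ∈ atlas ℂ C)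
    (he' : e' ∈ atlas ℂ C) {z : ℂ} (hz : z ∈ e.target) (hz' : e.symm z ∈ e'.source) :
    deriv (f ∘ e.symm) z = deriv (f ∘ e'.symm) (e' (e.symm z)) * deriv (e' ∘ e.symm) z := by
  have h1 := analyticAt_transition he he' hz hz'
  have key : ∀ {e e' : OpenPartialHomeomorph C ℂ} {z : ℂ}, z ∈ e.target → e.symm z ∈ e'.source →
      f ∘ e.symm =ᶠ[𝓝 z] (f ∘ e'.symm) ∘ (e' ∘ e.symm) := by
    intro e e' z hz hz'
    filter_upwards [(e.continuousAt_symm hz).eventually_mem (e'.open_source.mem_nhds hz')] with w hw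
    simp [hw]
  by_cases hd : DifferentiableAt ℂ (f ∘ e'.symm) (e' (e.symm z))
  · rw [(key hz hz').deriv_eq]
    exact deriv_comp z (h₂ := f ∘ e'.symm) (h := e' ∘ e.symm) hd h1.differentiableAt
  -- The coordinate change is invertible, so differentiability fails in both charts at once and both
  -- derivatives take the default value `0`. The chain rule therefore needs no regularity of `f`.
  · have hd' : ¬ DifferentiableAt ℂ (f ∘ e.symm) z := by
      intro h
      have hz2 : e'.symm (e' (e.symm z)) ∈ e.source := by simpa [hz'] using e.map_target hz
      have ht := e'.map_source hz'
      have h2 := analyticAt_transition he' he ht hz2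
      refine hd (((key ht hz2).differentiableAt_iff).2 (DifferentiableAt.comp _ ?_
        h2.differentiableAt))
      simpa [hz', hz] using h
    rw [deriv_zero_of_not_differentiableAt hd, deriv_zero_of_not_differentiableAt hd', zero_mul]

lemma chartJac_ne_zero {e : OpenPartialHomeomorph C ℂ} (he : e ∈ atlas ℂ C) {z : ℂ}
    (hz : z ∈ e.target) : chartJac e z ≠ 0 :=
  deriv_transition_ne_zero he (chart_mem_atlas ℂ _) hz (mem_chart_source ℂ _)

lemma chartJac_eq_mul {e e' : OpenPartialHomeomorph C ℂ} (he : e ∈ atlas ℂ C)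
    (he' : e' ∈ atlas ℂ C) {z : ℂ} (hz : z ∈ e.target) (hz' : e.symm z ∈ e'.source) :
    chartJac e z = chartJac e' (e' (e.symm z)) * deriv (e' ∘ e.symm) z := by
  have := deriv_comp_symm_eq (chartAt ℂ (e.symm z)) he he' hz hz'
  simpa [chartJac, hz'] using this

lemma formCoeff_eq_mul (θ : C → ℂ) {e e' : OpenPartialHomeomorph C ℂ} (he : e ∈ atlas ℂ C)
    (he' : e' ∈ atlas ℂ C) {z : ℂ} (hz : z ∈ e.target) (hz' : e.symm z ∈ e'.source) :
    formCoeff θ e z = formCoeff θ e' (e' (e.symm z)) * deriv (e' ∘ e.symm) z := by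
  rw [formCoeff, formCoeff, chartJac_eq_mul he he' hz hz', e'.left_inv hz', mul_assoc]

/-- `diff` uses the preferred chart at each point, which jumps from point to point, so `diff f` by
itself need not be continuous. Multiplication by the Jacobian turns it into the derivative in one
fixed chart. -/
lemma deriv_comp_symm (f : C → ℂ) {e : OpenPartialHomeomorph C ℂ} (he : e ∈ atlas ℂ C) {z : ℂ}
    (hz : z ∈ e.target) : deriv (f ∘ e.symm) z = formCoeff (diff f) e z :=
  deriv_comp_symm_eq f he (chart_mem_atlas ℂ _) hz (mem_chart_source ℂ _)

lemma logDeriv_comp_symm (f : C → ℂ) {e : OpenPartialHomeomorph C ℂ} (he : e ∈ atlas ℂ C) {z : ℂ}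
    (hz : z ∈ e.target) : logDeriv (f ∘ e.symm) z = formCoeff (dlog f) e z := by
  rw [logDeriv_apply, deriv_comp_symm f he hz, formCoeff, formCoeff, dlog, diff, logDeriv_apply]
  simp [mem_chart_source, div_mul_eq_mul_div]

/-- Tangent vectors at a point are represented in the preferred chart at that point, hence the
Jacobian. -/
lemma coordVec_eq {e : OpenPartialHomeomorph C ℂ} (he : e ∈ atlas ℂ C) {z : ℂ}
    (hz : z ∈ e.target) : coordVec e z = chartJac e z := by
  have h : MDifferentiableAt 𝓘(ℂ, ℂ) 𝓘(ℂ, ℂ) e.symm z := by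
    have : IsManifold 𝓘(ℂ, ℂ) 1 C := IsManifold.of_le (n := ω) le_top
    exact mdifferentiableAt_atlas_symm he hz
  refine (congrArg (fun L : ℂ →L[ℂ] ℂ => L 1) h.mfderiv).trans ?_
  simp only [writtenInExtChartAt, extChartAt, mfld_simps, fderivWithin_univ, chartJac]
  exact fderiv_apply_one_eq_deriv

lemma mdifferentiableAt_iff_chart {F : C → ℂ} {p : C} :
    MDifferentiableAt 𝓘(ℂ, ℂ) 𝓘(ℂ, ℂ) F p ↔
      DifferentiableAt ℂ (F ∘ (chartAt ℂ p).symm) (chartAt ℂ p p) := by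
  rw [mdifferentiableAt_iff]
  simp only [writtenInExtChartAt, extChartAt, mfld_simps, differentiableWithinAt_univ]
  refine ⟨fun h => h.2, fun h => ⟨?_, h⟩⟩
  have := h.continuousAt.comp ((chartAt ℂ p).continuousAt (mem_chart_source ℂ p))
  refine this.congr ?_
  filter_upwards [(chartAt ℂ p).open_source.mem_nhds (mem_chart_source ℂ p)] with q hq
  simp [hq]

lemma mfderiv_one_eq {F : C → ℂ} {p : C} (h : MDifferentiableAt 𝓘(ℂ, ℂ) 𝓘(ℂ, ℂ) F p) :
    mfderiv 𝓘(ℂ, ℂ) 𝓘(ℂ, ℂ) F p (1 : ℂ) = diff F p := by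
  refine (congrArg (fun L : ℂ →L[ℂ] ℂ => L 1) h.mfderiv).trans ?_
  simp only [writtenInExtChartAt, extChartAt, mfld_simps, fderivWithin_univ, diff]
  exact fderiv_apply_one_eq_deriv

lemma differentiableAt_comp_symm {F : C → ℂ} {e : OpenPartialHomeomorph C ℂ} (he : e ∈ atlas ℂ C)
    {z : ℂ} (hz : z ∈ e.target) (h : MDifferentiableAt 𝓘(ℂ, ℂ) 𝓘(ℂ, ℂ) F (e.symm z)) :
    DifferentiableAt ℂ (F ∘ e.symm) z := by
  have h1 := analyticAt_transition he (chart_mem_atlas ℂ (e.symm z)) hz (mem_chart_source ℂ _)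
  have h2 := DifferentiableAt.comp (g := F ∘ (chartAt ℂ (e.symm z)).symm) z
    (mdifferentiableAt_iff_chart.1 h) h1.differentiableAt
  refine h2.congr_of_eventuallyEq ?_
  filter_upwards [(e.continuousAt_symm hz).eventually_mem
    ((chartAt ℂ (e.symm z)).open_source.mem_nhds (mem_chart_source ℂ _))] with w hw
  simp [hw]

end Charts

/-! ### The operator `∂/∂z̄` in the plane and Stokes' theorem. -/

section Planar

open MeasureTheory

/-- Twice the operator `∂/∂z̄`. -/
def dbar (f : ℂ → ℂ) (z : ℂ) : ℂ :=
  fderiv ℝ f z 1 + Complex.I * fderiv ℝ f z Complex.I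

lemma dbar_congr {f g : ℂ → ℂ} {z : ℂ} (h : f =ᶠ[𝓝 z] g) : dbar f z = dbar g z := by
  rw [dbar, dbar, h.fderiv_eq]

lemma dbar_const (c : ℂ) (z : ℂ) : dbar (fun _ => c) z = 0 := by
  simp [dbar]

lemma dbar_mul {f h : ℂ → ℂ} {z : ℂ} (hf : DifferentiableAt ℝ f z) (hh : DifferentiableAt ℂ h z) :
    dbar (fun w => f w * h w) z = dbar f z * h z := by
  have h1 : HasFDerivAt h (ContinuousLinearMap.restrictScalars ℝ
      (ContinuousLinearMap.toSpanSingleton ℂ (deriv h z))) z :=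
    hh.hasDerivAt.hasFDerivAt.restrictScalars ℝ
  have h2 : fderiv ℝ (fun w => f w * h w) z = _ := (hf.hasFDerivAt.mul h1).fderiv
  rw [dbar, h2]
  simp [dbar]
  linear_combination f z * deriv h z * Complex.I_mul_I

/-- The conjugate derivative found here, times the derivative by which the coefficient of a 1-form
transforms, is `|τ'|²`, the real Jacobian. This makes `dbarForm` integrable over the surface
independently of charts. -/
lemma dbar_comp {f τ : ℂ → ℂ} {z : ℂ} (hf : DifferentiableAt ℝ f (τ z))
    (hτ : DifferentiableAt ℂ τ z) :
    dbar (f ∘ τ) z = dbar f (τ z) * (starRingEnd ℂ) (deriv τ z) := by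
  have h1 : HasFDerivAt τ (ContinuousLinearMap.restrictScalars ℝ
      (ContinuousLinearMap.toSpanSingleton ℂ (deriv τ z))) z :=
    hτ.hasDerivAt.hasFDerivAt.restrictScalars ℝ
  have h2 := (hf.hasFDerivAt.comp z h1).fderiv
  rw [dbar, h2]
  set L := fderiv ℝ f (τ z)
  set a := deriv τ z
  have hL : ∀ w : ℂ, L w = w.re * L 1 + w.im * L Complex.I := by
    intro w
    have : w = w.re • (1 : ℂ) + w.im • Complex.I := by
      simp [Complex.re_add_im]
    conv_lhs => rw [this]
    rw [map_add, map_smul, map_smul]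
    simp
  have e1 : L a = a.re * L 1 + a.im * L Complex.I := hL a
  have e2 : L (Complex.I * a) = -a.im * L 1 + a.re * L Complex.I := by
    rw [hL]; simp
  have e3 : (starRingEnd ℂ) a = a.re - a.im * Complex.I := by
    apply Complex.ext <;> simp
  simp only [ContinuousLinearMap.comp_apply, ContinuousLinearMap.coe_restrictScalars',
    ContinuousLinearMap.toSpanSingleton_apply, smul_eq_mul, one_mul, dbar]
  rw [e1, e2, e3]
  linear_combination (a.im * fderiv ℝ f (τ z) Complex.I) * Complex.I_mul_I

lemma dbar_sub {f g : ℂ → ℂ} {z : ℂ} (hf : DifferentiableAt ℝ f z) (hg : DifferentiableAt ℝ g z) :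
    dbar (fun w => f w - g w) z = dbar f z - dbar g z := by
  rw [dbar, fderiv_fun_sub hf hg]
  simp [dbar]
  ring

lemma dbar_sum {ι : Type*} (s : Finset ι) {f : ι → ℂ → ℂ} {z : ℂ}
    (hf : ∀ i ∈ s, DifferentiableAt ℝ (f i) z) :
    dbar (fun w => ∑ i ∈ s, f i w) z = ∑ i ∈ s, dbar (f i) z := by
  rw [dbar, fderiv_fun_sum hf]
  simp [dbar, Finset.sum_add_distrib, Finset.mul_sum]

lemma continuous_dbar {f : ℂ → ℂ} (hf : ContDiff ℝ 1 f) : Continuous (dbar f) := by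
  have := hf.continuous_fderiv one_ne_zero
  unfold dbar
  fun_prop

lemma tsupport_dbar_subset (f : ℂ → ℂ) : tsupport (dbar f) ⊆ tsupport f := by
  refine closure_minimal (fun z hz => ?_) (isClosed_tsupport f)
  by_contra h
  refine hz ?_
  rw [dbar_congr (notMem_tsupport_iff_eventuallyEq.1 h)]
  exact dbar_const 0 z

/-- Continuity of `h` is asked only on the support of `dbar f`, so `h` may be singular where `f` is
locally constant. -/
lemma integrable_dbar_mul {f h : ℂ → ℂ} (hf : ContDiff ℝ 1 f) (hc : HasCompactSupport f)
    (hh : ∀ z ∈ tsupport (dbar f), ContinuousAt h z) :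
    Integrable fun z => dbar f z * h z := by
  refine Continuous.integrable_of_hasCompactSupport ?_ ?_
  · refine continuous_iff_continuousAt.2 fun z => ?_
    by_cases hz : z ∈ tsupport (dbar f)
    · exact (continuous_dbar hf).continuousAt.mul (hh z hz)
    · have h0 := notMem_tsupport_iff_eventuallyEq.1 hz
      refine (continuousAt_const (y := (0 : ℂ))).congr ?_
      filter_upwards [h0] with w hw
      simp [hw]
  · exact HasCompactSupport.mul_right (hc.mono' (subset_closure.trans (tsupport_dbar_subset f)))

lemma integral_fderiv_apply_eq_zero {f : ℂ → ℂ} (hf : ContDiff ℝ 1 f) (hc : HasCompactSupport f)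
    (v : ℂ) : ∫ z, fderiv ℝ f z v = 0 := by
  have h1 : Integrable fun z => fderiv ℝ f z v := by
    refine Continuous.integrable_of_hasCompactSupport
      ((hf.continuous_fderiv one_ne_zero).clm_apply continuous_const) ?_
    exact (hc.fderiv (𝕜 := ℝ)).comp_left (g := fun L : ℂ →L[ℝ] ℂ => L v) rfl
  -- Integration by parts against the constant function `1`.
  have h := integral_mul_fderiv_eq_neg_fderiv_mul_of_integrable (𝕜 := ℂ) (μ := (volume : Measure ℂ))
    (f := fun _ => (1 : ℂ)) (g := f) (v := v) (by simp) (by simpa using h1)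
    (by simpa using hf.continuous.integrable_of_hasCompactSupport hc) (by simp)
    (fun x _ => (hf.differentiable one_ne_zero) x)
  simpa using h

lemma integral_dbar_eq_zero {f : ℂ → ℂ} (hf : ContDiff ℝ 1 f) (hc : HasCompactSupport f) :
    ∫ z, dbar f z = 0 := by
  have h1 : ∀ v, Integrable fun z => fderiv ℝ f z v := fun v => by
    refine Continuous.integrable_of_hasCompactSupport
      ((hf.continuous_fderiv one_ne_zero).clm_apply continuous_const) ?_
    exact (hc.fderiv (𝕜 := ℝ)).comp_left (g := fun L : ℂ →L[ℝ] ℂ => L v) rfl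
  unfold dbar
  rw [integral_add (h1 1) ((h1 Complex.I).const_mul _), integral_const_mul,
    integral_fderiv_apply_eq_zero hf hc, integral_fderiv_apply_eq_zero hf hc]
  simp

/-- **Stokes' theorem** for `f h dz`, with `f` compactly supported and `h` holomorphic. -/
lemma integral_dbar_mul_eq_zero {f h : ℂ → ℂ} (hf : ContDiff ℝ 1 f) (hc : HasCompactSupport f)
    (hh : ∀ z ∈ tsupport f, AnalyticAt ℂ h z) : ∫ z, dbar f z * h z = 0 := by
  have hcd : ContDiff ℝ 1 fun z => f z * h z := by
    refine contDiff_iff_contDiffAt.2 fun z => ?_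
    by_cases hz : z ∈ tsupport f
    · exact hf.contDiffAt.mul ((hh z hz).contDiffAt.restrict_scalars ℝ)
    · have h0 := notMem_tsupport_iff_eventuallyEq.1 hz
      refine (contDiffAt_const (c := (0 : ℂ))).congr_of_eventuallyEq ?_
      filter_upwards [h0] with w hw
      simp [hw]
  rw [← integral_dbar_eq_zero hcd (hc.mul_right)]
  congr 1
  ext z
  by_cases hz : z ∈ tsupport f
  · rw [dbar_mul ((hf.differentiable one_ne_zero) z) (hh z hz).differentiableAt]
  · have h0 := notMem_tsupport_iff_eventuallyEq.1 hz
    have h1 : (fun z => f z * h z) =ᶠ[𝓝 z] fun _ => 0 := by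
      filter_upwards [h0] with w hw
      simp [hw]
    rw [dbar_congr h0, dbar_congr h1]
    simp [dbar]

end Planar

/-! ### Residues computed with cutoff functions. -/

section Radial

open MeasureTheory

lemma exists_smooth_step {a b : ℝ} (hab : a < b) :
    ∃ φ : ℝ → ℝ, ContDiff ℝ ∞ φ ∧ (∀ t ≤ a, φ t = 1) ∧ ∀ t, b ≤ t → φ t = 0 := by
  refine ⟨fun t => Real.smoothTransition ((b - t) / (b - a)), ?_, fun t ht => ?_, fun t ht => ?_⟩
  · exact Real.smoothTransition.contDiff.comp (by fun_prop)
  · refine Real.smoothTransition.one_of_one_le ?_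
    rw [one_le_div (by linarith)]
    linarith
  · exact Real.smoothTransition.zero_of_nonpos (div_nonpos_of_nonpos_of_nonneg (by linarith)
      (by linarith))

/-- Cutoffs depend on the squared distance, which is smooth at the centre as well. -/
lemma contDiff_radial {φ : ℝ → ℝ} (hφ : ContDiff ℝ ∞ φ) (z₀ : ℂ) :
    ContDiff ℝ ∞ fun z : ℂ => ((φ (‖z - z₀‖ ^ 2) : ℝ) : ℂ) := by
  have h1 : ContDiff ℝ ∞ fun z : ℂ => ‖z - z₀‖ ^ 2 := (contDiff_id.sub contDiff_const).norm_sq ℝ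
  exact Complex.ofRealCLM.contDiff.comp (hφ.comp h1)

lemma dbar_radial {φ : ℝ → ℝ} (hφ : ContDiff ℝ ∞ φ) (z₀ z : ℂ) :
    dbar (fun z : ℂ => ((φ (‖z - z₀‖ ^ 2) : ℝ) : ℂ)) z =
      ((deriv φ (‖z - z₀‖ ^ 2) : ℝ) : ℂ) * (2 * (z - z₀)) := by
  have h1 : HasFDerivAt (fun z : ℂ => ‖z - z₀‖ ^ 2) (2 • innerSL ℝ (z - z₀)) z := by
    have := ((hasFDerivAt_id (𝕜 := ℝ) z).sub_const z₀).norm_sq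
    simpa using this
  have h2 : HasDerivAt φ (deriv φ (‖z - z₀‖ ^ 2)) (‖z - z₀‖ ^ 2) :=
    ((hφ.differentiable (by simp)) _).hasDerivAt
  have h3 := (Complex.ofRealCLM.hasFDerivAt.comp z (h2.comp_hasFDerivAt z h1)).fderiv
  have h4 : fderiv ℝ (fun z : ℂ => ((φ (‖z - z₀‖ ^ 2) : ℝ) : ℂ)) z = _ := h3
  rw [dbar, h4]
  simp [innerSL_apply_apply, Complex.inner]
  apply Complex.ext <;> simp

/-- On the circle `dz = i (z - z₀) dθ`. Polar coordinates use the angles `(-π, π)` and circle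
integrals use `[0, 2π]`; periodicity reconciles the two. -/
lemma integral_circle_shift (h : ℂ → ℂ) (z₀ : ℂ) (r : ℝ) :
    ∫ θ in Ioo (-Real.pi) Real.pi, (r * (Real.cos θ + Real.sin θ * Complex.I) : ℂ) *
      h (r * (Real.cos θ + Real.sin θ * Complex.I) + z₀) =
    -Complex.I * ∮ z in C(z₀, r), h z := by
  have hc : ∀ θ : ℝ, (Real.cos θ + Real.sin θ * Complex.I : ℂ) = Complex.exp (θ * Complex.I) := by
    intro θ
    rw [Complex.exp_mul_I]; simp
  have hper : Function.Periodic (fun θ : ℝ => (r * Complex.exp (θ * Complex.I) : ℂ) *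
      h (r * Complex.exp (θ * Complex.I) + z₀)) (2 * Real.pi) := by
    intro θ
    have : Complex.exp ((θ + 2 * Real.pi : ℝ) * Complex.I) = Complex.exp (θ * Complex.I) := by
      push_cast
      rw [add_mul, Complex.exp_add, Complex.exp_two_pi_mul_I, mul_one]
    simp only [this]
  simp only [hc]
  rw [← integral_Ioc_eq_integral_Ioo, ← intervalIntegral.integral_of_le (by linarith [Real.pi_pos]),
    circleIntegral, ← intervalIntegral.integral_const_mul]
  have h1 := hper.intervalIntegral_add_eq (-Real.pi) 0
  rw [show -Real.pi + 2 * Real.pi = Real.pi by ring, zero_add] at h1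
  rw [h1]
  refine intervalIntegral.integral_congr fun θ _ => ?_
  simp only [deriv_circleMap, circleMap, smul_eq_mul, zero_add]
  rw [add_comm (z₀)]
  linear_combination ((r * Complex.exp (θ * Complex.I)) *
    h (r * Complex.exp (θ * Complex.I) + z₀)) * Complex.I_mul_I

/-- In polar coordinates the integral separates. The angular part is `-i ∮ h = 2πR` for every radius
up to `ε`, and the radial part is `∫ φ'(r²) 2r dr = -φ(0) = -1`. -/
lemma integral_dbar_radial_mul {h : ℂ → ℂ} {z₀ R : ℂ} {ε : ℝ} (hε : 0 < ε)
    (hh : ∀ z, z ≠ z₀ → ‖z - z₀‖ ≤ ε → ContinuousAt h z)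
    (hR : ∀ r : ℝ, 0 < r → r ≤ ε → ∮ z in C(z₀, r), h z = 2 * Real.pi * Complex.I * R)
    {φ : ℝ → ℝ} (hφ : ContDiff ℝ ∞ φ) {a b : ℝ} (ha : 0 < a) (hb : b < ε ^ 2)
    (h1 : ∀ t ≤ a, φ t = 1) (h0 : ∀ t, b ≤ t → φ t = 0) :
    Integrable (fun z => dbar (fun z : ℂ => ((φ (‖z - z₀‖ ^ 2) : ℝ) : ℂ)) z * h z) ∧
    ∫ z, dbar (fun z : ℂ => ((φ (‖z - z₀‖ ^ 2) : ℝ) : ℂ)) z * h z = -2 * Real.pi * R := by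
  set χ : ℂ → ℂ := fun z => ((φ (‖z - z₀‖ ^ 2) : ℝ) : ℂ) with hχ
  have hd1 : ∀ t < a, deriv φ t = 0 := fun t ht => by
    have : φ =ᶠ[𝓝 t] fun _ => 1 := by
      filter_upwards [Iio_mem_nhds ht] with s hs using h1 s (le_of_lt hs)
    rw [this.deriv_eq, deriv_const]
  have hd0 : ∀ t, b < t → deriv φ t = 0 := fun t ht => by
    have : φ =ᶠ[𝓝 t] fun _ => 0 := by
      filter_upwards [Ioi_mem_nhds ht] with s hs using h0 s (le_of_lt hs)
    rw [this.deriv_eq, deriv_const]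
  have hcont : Continuous fun z => dbar χ z * h z := by
    refine continuous_iff_continuousAt.2 fun z => ?_
    by_cases hz : z ≠ z₀ ∧ ‖z - z₀‖ ≤ ε
    · exact (continuous_dbar ((contDiff_radial hφ z₀).of_le (by simp))).continuousAt.mul
        (hh z hz.1 hz.2)
    -- At the centre and beyond radius `ε`, where nothing is known about `h`, the cutoff is locally
    -- constant.
    · have hev : ∀ᶠ w in 𝓝 z, ‖w - z₀‖ ^ 2 < a ∨ b < ‖w - z₀‖ ^ 2 := by
        have hc : Continuous fun w : ℂ => ‖w - z₀‖ ^ 2 := by fun_prop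
        by_cases hz0 : z = z₀
        · filter_upwards [hc.continuousAt.eventually_lt (continuousAt_const (y := a))
            (by simpa [hz0] using ha)] with w hw using Or.inl hw
        · have : ε < ‖z - z₀‖ := by
            by_contra hcon
            exact hz ⟨hz0, not_lt.1 hcon⟩
          filter_upwards [(continuousAt_const (y := b)).eventually_lt hc.continuousAt
            (by nlinarith)] with w hw using Or.inr hw
      refine (continuousAt_const (y := (0 : ℂ))).congr ?_
      filter_upwards [hev] with w hw
      rw [hχ, dbar_radial hφ]
      rcases hw with hw | hw
      · simp [hd1 _ hw]
      · simp [hd0 _ hw]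
  have hzero : ∀ z, ε < ‖z - z₀‖ → dbar χ z * h z = 0 := fun z hz => by
    rw [hχ, dbar_radial hφ, hd0 _ (by nlinarith)]
    simp
  refine ⟨hcont.integrable_of_hasCompactSupport (HasCompactSupport.intro
    (isCompact_closedBall z₀ ε) fun z hz => hzero z (by simpa [dist_eq_norm] using hz)), ?_⟩
  rw [← integral_add_right_eq_self _ z₀, ← Complex.integral_comp_polarCoord_symm]
  set F : ℝ × ℝ → ℂ := fun p => p.1 • (dbar χ (Complex.polarCoord.symm p + z₀) *
    h (Complex.polarCoord.symm p + z₀)) with hF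
  have hFc : Continuous F := by
    have hp : Continuous fun p : ℝ × ℝ => Complex.polarCoord.symm p + z₀ := by
      simp only [Complex.polarCoord_symm_apply]
      fun_prop
    exact continuous_fst.smul (hcont.comp hp)
  have hnorm : ∀ r θ : ℝ, ‖(r * (Real.cos θ + Real.sin θ * Complex.I) : ℂ)‖ = |r| := by
    intro r θ
    have : (Real.cos θ + Real.sin θ * Complex.I : ℂ) = Complex.exp (θ * Complex.I) := by
      rw [Complex.exp_mul_I]; simp
    rw [this, norm_mul, Complex.norm_exp_ofReal_mul_I, mul_one, Complex.norm_real, Real.norm_eq_abs]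
  have hFi : IntegrableOn F polarCoord.target := by
    have hK : IntegrableOn F (Icc 0 ε ×ˢ Icc (-Real.pi) Real.pi) :=
      hFc.continuousOn.integrableOn_compact (isCompact_Icc.prod isCompact_Icc)
    refine hK.of_forall_sdiff_eq_zero polarCoord.open_target.measurableSet fun p hp => ?_
    have hp1 : 0 < p.1 ∧ p.2 ∈ Ioo (-Real.pi) Real.pi := by simpa [polarCoord] using hp.1
    have hlt : ε < p.1 := by
      by_contra hcon
      exact hp.2 ⟨⟨hp1.1.le, not_lt.1 hcon⟩, ⟨hp1.2.1.le, hp1.2.2.le⟩⟩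
    simp only [hF]
    rw [hzero, smul_zero]
    rw [add_sub_cancel_right, Complex.polarCoord_symm_apply, hnorm, abs_of_pos hp1.1]
    exact hlt
  have htar : polarCoord.target = Ioi (0 : ℝ) ×ˢ Ioo (-Real.pi) Real.pi := rfl
  rw [htar] at hFi ⊢
  have e1 : ∫ p in Ioi (0 : ℝ) ×ˢ Ioo (-Real.pi) Real.pi, F p =
      ∫ r in Ioi (0 : ℝ), ∫ θ in Ioo (-Real.pi) Real.pi, F (r, θ) := by
    rw [Measure.volume_eq_prod] at hFi ⊢
    exact setIntegral_prod F hFi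
  refine e1.trans ?_
  have e2 : ∀ r ∈ Ioi (0 : ℝ), ∫ θ in Ioo (-Real.pi) Real.pi, F (r, θ) =
      ((deriv φ (r ^ 2) * (2 * r) : ℝ) : ℂ) * (2 * Real.pi * R) := by
    intro r hr
    have hr0 : 0 < r := hr
    have e3 : ∀ θ : ℝ, F (r, θ) = ((deriv φ (r ^ 2) * (2 * r) : ℝ) : ℂ) *
        ((r * (Real.cos θ + Real.sin θ * Complex.I) : ℂ) *
          h (r * (Real.cos θ + Real.sin θ * Complex.I) + z₀)) := by
      intro θ
      simp only [hF, hχ]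
      rw [dbar_radial hφ, add_sub_cancel_right, Complex.polarCoord_symm_apply, hnorm]
      simp only [sq_abs, Complex.real_smul]
      push_cast
      ring
    simp only [e3]
    rw [integral_const_mul, integral_circle_shift]
    by_cases hle : r ≤ ε
    · rw [hR r hr0 hle]
      linear_combination (-((deriv φ (r ^ 2) * (2 * r) : ℝ) : ℂ) * (2 * Real.pi * R)) *
        Complex.I_mul_I
    · rw [hd0 _ (by nlinarith)]
      simp
  rw [setIntegral_congr_fun measurableSet_Ioi e2, integral_mul_const]
  have e4 : ∫ r in Ioi (0 : ℝ), ((deriv φ (r ^ 2) * (2 * r) : ℝ) : ℂ) = -1 := by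
    rw [show (∫ r in Ioi (0 : ℝ), ((deriv φ (r ^ 2) * (2 * r) : ℝ) : ℂ)) =
      ((∫ r in Ioi (0 : ℝ), deriv φ (r ^ 2) * (2 * r) : ℝ) : ℂ) from integral_ofReal]
    have hder : ∀ r ∈ Ioi (0 : ℝ), HasDerivAt (fun r => φ (r ^ 2)) (deriv φ (r ^ 2) * (2 * r)) r := by
      intro r _
      have h2 : HasDerivAt (fun r : ℝ => r ^ 2) (2 * r) r := by simpa using hasDerivAt_pow 2 r
      exact ((hφ.differentiable (by simp)) (r ^ 2)).hasDerivAt.comp r h2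
    have hcd : Continuous fun r : ℝ => deriv φ (r ^ 2) * (2 * r) := by
      have := hφ.continuous_deriv (by simp)
      fun_prop
    have hint : IntegrableOn (fun r : ℝ => deriv φ (r ^ 2) * (2 * r)) (Ioi 0) := by
      refine (hcd.continuousOn.integrableOn_compact (isCompact_Icc (a := 0) (b := ε))).of_forall_sdiff_eq_zero
        measurableSet_Ioi fun r hr => ?_
      have hr0 : 0 < r := hr.1
      have : ε < r := by
        by_contra hcon
        exact hr.2 ⟨hr0.le, not_lt.1 hcon⟩
      rw [hd0 _ (by nlinarith), zero_mul]
    have hlim : Tendsto (fun r : ℝ => φ (r ^ 2)) atTop (𝓝 0) := by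
      refine tendsto_const_nhds.congr' ?_
      filter_upwards [eventually_ge_atTop ε] with r hr
      rw [h0 _ (by nlinarith)]
    have := integral_Ioi_of_hasDerivAt_of_tendsto (f := fun r => φ (r ^ 2)) (a := (0 : ℝ))
      (hφ.continuous.comp (by fun_prop)).continuousWithinAt hder hint hlim
    rw [this, h1 _ (by nlinarith)]
    norm_num
  rw [e4]
  ring

/-- If `f` is compactly supported and equal to `1` near `z₀`, the only singularity of `h` in the
support of `f`, then `∫ ∂f/∂z̄ h` is given by the residue of `h` at `z₀`. -/
lemma integral_dbar_mul_eq_residue {f h : ℂ → ℂ} {z₀ R : ℂ} (hf : ContDiff ℝ 1 f)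
    (hc : HasCompactSupport f) (hf1 : f =ᶠ[𝓝 z₀] fun _ => 1)
    (hh : ∀ z ∈ tsupport f, z ≠ z₀ → AnalyticAt ℂ h z)
    (hR : ∀ᶠ r : ℝ in 𝓝[>] 0, ∮ z in C(z₀, r), h z = 2 * Real.pi * Complex.I * R) :
    ∫ z, dbar f z * h z = -2 * Real.pi * R := by
  obtain ⟨ε₁, hε₁, hball⟩ := Metric.eventually_nhds_iff.1 hf1
  obtain ⟨ε₂, hε₂, hcirc⟩ := mem_nhdsGT_iff_exists_Ioo_subset.1 hR
  have hε₂' : 0 < ε₂ := hε₂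
  set ε := min ε₁ ε₂ / 2 with hεdef
  have hε : 0 < ε := by positivity
  have hεlt1 : ε < ε₁ := by
    have := min_le_left ε₁ ε₂
    linarith
  have hεlt2 : ε < ε₂ := by
    have := min_le_right ε₁ ε₂
    linarith
  obtain ⟨φ, hφ, h1, h0⟩ := exists_smooth_step (a := ε ^ 2 / 4) (b := ε ^ 2 / 2) (by nlinarith)
  have hfball : ∀ z, ‖z - z₀‖ ≤ ε → f z = 1 := fun z hz =>
    hball (by rw [dist_eq_norm]; linarith)
  have hsub : ∀ z, ‖z - z₀‖ ≤ ε → z ∈ tsupport f := fun z hz =>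
    subset_tsupport f (by simp [hfball z hz])
  obtain ⟨hint, hval⟩ := integral_dbar_radial_mul (h := h) (R := R) hε
    (fun z hz hz' => (hh z (hsub z hz') hz).continuousAt)
    (fun r hr hr' => hcirc ⟨hr, by linarith⟩) hφ (a := ε ^ 2 / 4) (b := ε ^ 2 / 2)
    (by positivity) (by nlinarith) h1 h0
  set χ : ℂ → ℂ := fun z => ((φ (‖z - z₀‖ ^ 2) : ℝ) : ℂ) with hχ
  have hχd : ContDiff ℝ 1 χ := (contDiff_radial hφ z₀).of_le (by simp)
  have hχ0 : ∀ z, ε < ‖z - z₀‖ → χ z = 0 := fun z hz => by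
    simp only [hχ]
    rw [h0 _ (by nlinarith)]
    simp
  -- `f` is exchanged for the radial cutoff `χ`: the difference vanishes near `z₀` and is supported
  -- in `tsupport f`, so it contributes nothing by Stokes' theorem.
  have hg : ContDiff ℝ 1 fun z => f z - χ z := hf.sub hχd
  have hgsub : tsupport (fun z => f z - χ z) ⊆ tsupport f := by
    refine closure_minimal (fun z hz => ?_) (isClosed_tsupport f)
    by_contra hcon
    refine hz ?_
    have h2 : f z = 0 := image_eq_zero_of_notMem_tsupport hcon
    have h3 : ε < ‖z - z₀‖ := by
      by_contra hle
      exact hcon (hsub z (not_lt.1 hle))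
    simp [h2, hχ0 z h3]
  have hz₀ : z₀ ∉ tsupport (fun z => f z - χ z) := by
    rw [notMem_tsupport_iff_eventuallyEq]
    filter_upwards [hf1, Metric.ball_mem_nhds z₀ (half_pos hε)] with z hz hz'
    have : ‖z - z₀‖ ^ 2 ≤ ε ^ 2 / 4 := by
      have h4 : ‖z - z₀‖ < ε / 2 := by simpa [dist_eq_norm] using hz'
      nlinarith [norm_nonneg (z - z₀)]
    simp [hz, hχ, h1 _ this]
  have hhg : ∀ z ∈ tsupport (fun z => f z - χ z), AnalyticAt ℂ h z := fun z hz =>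
    hh z (hgsub hz) (fun hcon => hz₀ (hcon ▸ hz))
  have hgc : HasCompactSupport fun z => f z - χ z := hc.isCompact.of_isClosed_subset (isClosed_tsupport _) hgsub
  have hstokes := integral_dbar_mul_eq_zero hg hgc hhg
  have hgi := integrable_dbar_mul hg hgc fun z hz =>
    (hhg z (tsupport_dbar_subset _ hz)).continuousAt
  rw [← hval, ← zero_add (∫ z, dbar χ z * h z), ← hstokes, ← integral_add hgi hint]
  congr 1
  ext z
  rw [dbar_sub ((hf.differentiable one_ne_zero) z) ((hχd.differentiable one_ne_zero) z)]
  ring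

end Radial

/-! ### The residue theorem on a compact Riemann surface. -/

section Residue

open MeasureTheory

variable {C : Type*} [TopologicalSpace C] [ChartedSpace ℂ C] [IsManifold 𝓘(ℂ, ℂ) ω C]

lemma isManifold_real (C : Type*) [TopologicalSpace C] [ChartedSpace ℂ C]
    [IsManifold 𝓘(ℂ, ℂ) ω C] : IsManifold 𝓘(ℝ, ℂ) ∞ C := by
  refine isManifold_of_contDiffOn 𝓘(ℝ, ℂ) ∞ C fun e e' he he' => ?_
  simp only [mfld_simps]
  intro z hz
  exact ((analyticAt_transition he he' hz.1 hz.2).contDiffAt.restrict_scalars ℝ).contDiffWithinAt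

lemma contDiffAt_comp_symm {φ : C → ℝ} (hφ : ContMDiff 𝓘(ℝ, ℂ) 𝓘(ℝ, ℝ) ∞ φ)
    {e : OpenPartialHomeomorph C ℂ} (he : e ∈ atlas ℂ C) {z : ℂ} (hz : z ∈ e.target) :
    ContDiffAt ℝ ∞ (fun w => ((φ (e.symm w) : ℝ) : ℂ)) z := by
  have := isManifold_real C
  have h1 : ContMDiffAt 𝓘(ℝ, ℂ) 𝓘(ℝ, ℂ) ∞ e.symm z :=
    (contMDiffOn_symm_of_mem_maximalAtlas (IsManifold.subset_maximalAtlas he)).contMDiffAt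
      (e.open_target.mem_nhds hz)
  have h2 : ContMDiffAt 𝓘(ℝ, ℂ) 𝓘(ℝ, ℝ) ∞ (φ ∘ e.symm) z := hφ.contMDiffAt.comp z h1
  exact Complex.ofRealCLM.contDiff.contDiffAt.comp z h2.contDiffAt

/-- The coefficient in the chart `e` of the 2-form `dφ ∧ θ`, up to normalization. -/
def dbarForm (φ : C → ℝ) (θ : C → ℂ) (e : OpenPartialHomeomorph C ℂ) (z : ℂ) : ℂ :=
  dbar (fun w => ((φ (e.symm w) : ℝ) : ℂ)) z * formCoeff θ e z

/-- The function contributes the conjugate of `τ'` and the 1-form contributes `τ'`. -/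
lemma dbarForm_transition {φ : C → ℝ} (hφ : ContMDiff 𝓘(ℝ, ℂ) 𝓘(ℝ, ℝ) ∞ φ) (θ : C → ℂ)
    {e e' : OpenPartialHomeomorph C ℂ} (he : e ∈ atlas ℂ C) (he' : e' ∈ atlas ℂ C) {z : ℂ}
    (hz : z ∈ e.target) (hz' : e.symm z ∈ e'.source) :
    dbarForm φ θ e z = (‖deriv (e' ∘ e.symm) z‖ ^ 2 : ℝ) * dbarForm φ θ e' (e' (e.symm z)) := by
  have hτ := analyticAt_transition he he' hz hz'
  have h1 : (fun w => ((φ (e.symm w) : ℝ) : ℂ)) =ᶠ[𝓝 z]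
      (fun w => ((φ (e'.symm w) : ℝ) : ℂ)) ∘ (e' ∘ e.symm) := by
    filter_upwards [(e.continuousAt_symm hz).eventually_mem (e'.open_source.mem_nhds hz')] with w hw
    simp [hw]
  have h2 := dbar_comp (f := fun w => ((φ (e'.symm w) : ℝ) : ℂ)) (τ := e' ∘ e.symm) (z := z)
    ((contDiffAt_comp_symm hφ he' (e'.map_source hz')).differentiableAt (by simp))
    hτ.differentiableAt
  rw [dbarForm, dbarForm, dbar_congr h1, h2, formCoeff_eq_mul θ he he' hz hz']
  have h3 := Complex.mul_conj (deriv (e' ∘ e.symm) z)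
  rw [Complex.normSq_eq_norm_sq] at h3
  rw [← h3]
  simp only [Function.comp_apply]
  ring

lemma abs_det_restrictScalars_toSpanSingleton (a : ℂ) :
    |(ContinuousLinearMap.restrictScalars ℝ
      (ContinuousLinearMap.toSpanSingleton ℂ a) : ℂ →L[ℝ] ℂ).det| = ‖a‖ ^ 2 := by
  have : (ContinuousLinearMap.restrictScalars ℝ
      (ContinuousLinearMap.toSpanSingleton ℂ a) : ℂ →L[ℝ] ℂ).det = ‖a‖ ^ 2 := by
    rw [← Complex.normSq_eq_norm_sq, ← Algebra.norm_complex_apply, Algebra.norm_apply]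
    rw [ContinuousLinearMap.det]
    congr 1
    ext <;> simp [mul_comm]
  rw [this, abs_of_nonneg (by positivity)]

section ChangeOfVariables

variable {φ : C → ℝ} (hφ : ContMDiff 𝓘(ℝ, ℂ) 𝓘(ℝ, ℝ) ∞ φ) (θ : C → ℂ) (η : C → ℝ)
  {e e' : OpenPartialHomeomorph C ℂ} (he : e ∈ atlas ℂ C) (he' : e' ∈ atlas ℂ C)
include hφ he he'

lemma hasFDerivAt_transition {z : ℂ} (hz : z ∈ (e.symm.trans e').source) :
    HasFDerivAt (e.symm.trans e') (ContinuousLinearMap.restrictScalars ℝ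
      (ContinuousLinearMap.toSpanSingleton ℂ (deriv (e' ∘ e.symm) z)) : ℂ →L[ℝ] ℂ) z := by
  have hz2 : z ∈ e.target ∧ e.symm z ∈ e'.source := by simpa using hz
  exact (analyticAt_transition he he' hz2.1 hz2.2).differentiableAt.hasDerivAt.hasFDerivAt.restrictScalars ℝ

lemma setIntegral_transition :
    ∫ w in (e'.symm.trans e).source, (η (e'.symm w) : ℂ) * dbarForm φ θ e' w =
      ∫ z in (e.symm.trans e').source, (η (e.symm z) : ℂ) * dbarForm φ θ e z := by
  have h1 : (e'.symm.trans e).source = (e.symm.trans e').target := by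
    rw [← OpenPartialHomeomorph.symm_source, OpenPartialHomeomorph.trans_symm_eq_symm_trans_symm,
      OpenPartialHomeomorph.symm_symm]
  rw [h1, integral_target_eq_integral_abs_det_fderiv_smul volume
    (fun z hz => hasFDerivAt_transition hφ he he' hz)]
  refine setIntegral_congr_fun (e.symm.trans e').open_source.measurableSet fun z hz => ?_
  have hz2 : z ∈ e.target ∧ e.symm z ∈ e'.source := by simpa using hz
  simp only [abs_det_restrictScalars_toSpanSingleton, OpenPartialHomeomorph.coe_trans,
    Function.comp_apply, e'.left_inv hz2.2, dbarForm_transition hφ θ he he' hz2.1 hz2.2,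
    Complex.real_smul]
  ring

lemma integrableOn_transition
    (h : IntegrableOn (fun z => (η (e.symm z) : ℂ) * dbarForm φ θ e z) (e.symm.trans e').source) :
    IntegrableOn (fun w => (η (e'.symm w) : ℂ) * dbarForm φ θ e' w) (e'.symm.trans e).source := by
  have h1 : (e'.symm.trans e).source = (e.symm.trans e') '' (e.symm.trans e').source := by
    rw [OpenPartialHomeomorph.image_source_eq_target, ← OpenPartialHomeomorph.symm_source,
      OpenPartialHomeomorph.trans_symm_eq_symm_trans_symm, OpenPartialHomeomorph.symm_symm]
  rw [h1, integrableOn_image_iff_integrableOn_abs_det_fderiv_smul volume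
    (e.symm.trans e').open_source.measurableSet
    (fun z hz => (hasFDerivAt_transition hφ he he' hz).hasFDerivWithinAt)
    (e.symm.trans e').injOn]
  refine h.congr_fun (fun z hz => ?_) (e.symm.trans e').open_source.measurableSet
  have hz2 : z ∈ e.target ∧ e.symm z ∈ e'.source := by simpa using hz
  simp only [abs_det_restrictScalars_toSpanSingleton, OpenPartialHomeomorph.coe_trans,
    Function.comp_apply, e'.left_inv hz2.2, dbarForm_transition hφ θ he he' hz2.1 hz2.2,
    Complex.real_smul]
  ring

end ChangeOfVariables

/-- Insert `1 = ∑ⱼ ρⱼ` in the `i`-th integral, move the `(i, j)` term from chart `e i` to chart `e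
j`, and sum over `i` first: `∑ᵢ ∂̄ρᵢ = ∂̄1 = 0`. -/
lemma sum_integral_dbarForm_eq_zero {ι : Type*} [Fintype ι] (e : ι → OpenPartialHomeomorph C ℂ)
    (he : ∀ i, e i ∈ atlas ℂ C) (ρ : ι → C → ℝ)
    (hρ : ∀ i, ContMDiff 𝓘(ℝ, ℂ) 𝓘(ℝ, ℝ) ∞ (ρ i)) (hsub : ∀ i, tsupport (ρ i) ⊆ (e i).source)
    (hsum : ∀ p, ∑ i, ρ i p = 1) (hle : ∀ i p, |ρ i p| ≤ 1) (θ : C → ℂ)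
    (hint : ∀ i, IntegrableOn (dbarForm (ρ i) θ (e i)) (e i).target) :
    ∑ i, ∫ z in (e i).target, dbarForm (ρ i) θ (e i) z = 0 := by
  have hcont : ∀ i j, ContinuousOn (fun z => ρ j ((e i).symm z)) (e i).target := fun i j =>
    (hρ j).continuous.comp_continuousOn (e i).continuousOn_symm
  have hI : ∀ i j, IntegrableOn (fun z => (ρ j ((e i).symm z) : ℂ) * dbarForm (ρ i) θ (e i) z)
      (e i).target := by
    intro i j
    refine Integrable.bdd_mul (c := 1) (hint i) ?_ ?_
    · exact (Complex.continuous_ofReal.comp_continuousOn (hcont i j)).aestronglyMeasurable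
        (e i).open_target.measurableSet
    · refine Eventually.of_forall fun z => ?_
      simpa using hle j ((e i).symm z)
  have hsrc : ∀ i j, ((e i).symm.trans (e j)).source ⊆ (e i).target := by
    intro i j z hz
    exact (show z ∈ (e i).target ∧ (e i).symm z ∈ (e j).source by simpa using hz).1
  have hz1 : ∀ i j, ∀ z ∈ (e i).target \ ((e i).symm.trans (e j)).source,
      (ρ j ((e i).symm z) : ℂ) * dbarForm (ρ i) θ (e i) z = 0 := by
    intro i j z hz
    have : (e i).symm z ∉ tsupport (ρ j) := fun hcon => hz.2 (by simpa [hz.1] using hsub j hcon)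
    rw [image_eq_zero_of_notMem_tsupport this]
    simp
  have hz2 : ∀ i j, ∀ z ∈ (e j).target \ ((e j).symm.trans (e i)).source,
      (ρ j ((e j).symm z) : ℂ) * dbarForm (ρ i) θ (e j) z = 0 := by
    intro i j z hz
    have h0 : (e j).symm z ∉ tsupport (ρ i) := fun hcon => hz.2 (by simpa [hz.1] using hsub i hcon)
    have h1 : (fun w => ((ρ i ((e j).symm w) : ℝ) : ℂ)) =ᶠ[𝓝 z] fun _ => 0 := by
      filter_upwards [((e j).continuousAt_symm hz.1).eventually
        (notMem_tsupport_iff_eventuallyEq.1 h0)] with w hw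
      simp [hw]
    rw [dbarForm, dbar_congr h1, dbar_const]
    simp
  have hJ : ∀ i j, IntegrableOn (fun z => (ρ j ((e j).symm z) : ℂ) * dbarForm (ρ i) θ (e j) z)
      (e j).target := by
    intro i j
    refine IntegrableOn.of_forall_sdiff_eq_zero (integrableOn_transition (hρ i) θ (ρ j) (he i) (he j)
      ((hI i j).mono_set (hsrc i j))) (e j).open_target.measurableSet (hz2 i j)
  have hIJ : ∀ i j, ∫ z in (e i).target, (ρ j ((e i).symm z) : ℂ) * dbarForm (ρ i) θ (e i) z =
      ∫ z in (e j).target, (ρ j ((e j).symm z) : ℂ) * dbarForm (ρ i) θ (e j) z := by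
    intro i j
    rw [setIntegral_eq_of_subset_of_forall_sdiff_eq_zero (e i).open_target.measurableSet (hsrc i j)
      (hz1 i j), setIntegral_eq_of_subset_of_forall_sdiff_eq_zero (e j).open_target.measurableSet
      (hsrc j i) (hz2 i j), setIntegral_transition (hρ i) θ (ρ j) (he i) (he j)]
  have e1 : ∀ i, ∫ z in (e i).target, dbarForm (ρ i) θ (e i) z =
      ∑ j, ∫ z in (e j).target, (ρ j ((e j).symm z) : ℂ) * dbarForm (ρ i) θ (e j) z := by
    intro i
    rw [← Finset.sum_congr rfl fun j _ => hIJ i j, ← integral_finsetSum _ fun j _ => hI i j]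
    congr 1
    ext z
    rw [← Finset.sum_mul, ← Complex.ofReal_sum, hsum]
    simp
  rw [Finset.sum_congr rfl fun i _ => e1 i, Finset.sum_comm]
  refine Finset.sum_eq_zero fun j _ => ?_
  rw [← integral_finsetSum _ fun i _ => hJ i j]
  rw [setIntegral_congr_fun (e j).open_target.measurableSet (g := fun _ => 0), integral_zero]
  intro z hz
  have h3 : ∑ i, dbar (fun w => ((ρ i ((e j).symm w) : ℝ) : ℂ)) z = 0 := by
    rw [← dbar_sum Finset.univ fun i _ =>
      (contDiffAt_comp_symm (hρ i) (he j) hz).differentiableAt (by simp)]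
    rw [show (fun w => ∑ i, ((ρ i ((e j).symm w) : ℝ) : ℂ)) = fun _ => 1 by
      ext w; rw [← Complex.ofReal_sum, hsum]; simp]
    exact dbar_const 1 z
  simp only [dbarForm]
  rw [← Finset.mul_sum, ← Finset.sum_mul, h3]
  simp

variable [T2Space C] [CompactSpace C]

/-- Deleting from each chart domain all points of `P` but its centre keeps every `p ∈ P` away from
the supports of the functions with index other than `p`. So the function indexed by `p` equals `1`
near `p`. -/
lemma exists_partition (P : Finset C) :
    ∃ (T : Finset C) (ρ : T → C → ℝ), P ⊆ T ∧
      (∀ i, ContMDiff 𝓘(ℝ, ℂ) 𝓘(ℝ, ℝ) ∞ (ρ i)) ∧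
      (∀ i, tsupport (ρ i) ⊆ (chartAt ℂ (i : C)).source \ ((P : Set C) \ {(i : C)})) ∧
      (∀ p, ∑ i, ρ i p = 1) ∧ ∀ i p, |ρ i p| ≤ 1 := by
  have := isManifold_real C
  set U : C → Set C := fun q => (chartAt ℂ q).source \ ((P : Set C) \ {q}) with hU
  have hUo : ∀ q, IsOpen (U q) := fun q =>
    (chartAt ℂ q).open_source.sdiff (P.finite_toSet.subset sdiff_subset).isClosed
  obtain ⟨T₀, hT₀⟩ := CompactSpace.elim_nhds_subcover U fun q =>
    (hUo q).mem_nhds ⟨mem_chart_source ℂ q, by simp⟩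
  classical
  set T := T₀ ∪ P
  have hcov : (univ : Set C) ⊆ ⋃ i : T, U i := by
    intro p _
    have hp : p ∈ ⋃ x ∈ T₀, U x := by rw [hT₀]; trivial
    simp only [mem_iUnion] at hp ⊢
    obtain ⟨q, hq, hpq⟩ := hp
    exact ⟨⟨q, Finset.mem_union_left _ hq⟩, hpq⟩
  obtain ⟨f, hf⟩ := SmoothPartitionOfUnity.exists_isSubordinate 𝓘(ℝ, ℂ) isClosed_univ
    (fun i : T => U i) (fun i => hUo i) hcov
  refine ⟨T, fun i => f i, Finset.subset_union_right, fun i => (f i).contMDiff, fun i => hf i,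
    fun p => ?_, fun i p => ?_⟩
  · rw [← finsum_eq_sum_of_fintype]
    exact f.sum_eq_one (mem_univ p)
  · rw [abs_of_nonneg (f.nonneg i p)]
    exact f.le_one i p

/-- The function `φ` in the chart `e`, extended by zero. -/
def chartExt (φ : C → ℝ) (e : OpenPartialHomeomorph C ℂ) : ℂ → ℂ :=
  e.target.indicator fun w => ((φ (e.symm w) : ℝ) : ℂ)

lemma tsupport_chartExt_subset {φ : C → ℝ} {e : OpenPartialHomeomorph C ℂ}
    (hsub : tsupport φ ⊆ e.source) : tsupport (chartExt φ e) ⊆ e '' tsupport φ ∧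
      IsCompact (e '' tsupport φ) := by
  have hK : IsCompact (e '' tsupport φ) :=
    (isClosed_tsupport φ).isCompact.image_of_continuousOn (e.continuousOn.mono hsub)
  refine ⟨closure_minimal (fun z hz => ?_) hK.isClosed, hK⟩
  have hzt : z ∈ e.target := by
    by_contra hcon
    exact hz (indicator_of_notMem hcon _)
  refine ⟨e.symm z, subset_tsupport φ fun hcon => hz ?_, e.right_inv hzt⟩
  simp [chartExt, hzt, hcon]

lemma chartExt_eventuallyEq (φ : C → ℝ) {e : OpenPartialHomeomorph C ℂ} {z : ℂ}
    (hz : z ∈ e.target) :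
    chartExt φ e =ᶠ[𝓝 z] fun w => ((φ (e.symm w) : ℝ) : ℂ) := by
  filter_upwards [e.open_target.mem_nhds hz] with w hw
  simp [chartExt, hw]

lemma contDiff_chartExt {φ : C → ℝ} (hφ : ContMDiff 𝓘(ℝ, ℂ) 𝓘(ℝ, ℝ) ∞ φ)
    {e : OpenPartialHomeomorph C ℂ} (he : e ∈ atlas ℂ C) (hsub : tsupport φ ⊆ e.source) :
    ContDiff ℝ 1 (chartExt φ e) := by
  refine contDiff_iff_contDiffAt.2 fun z => ?_
  by_cases hz : z ∈ e.target
  · exact ((contDiffAt_comp_symm hφ he hz).of_le (by simp)).congr_of_eventuallyEq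
      (chartExt_eventuallyEq φ hz)
  · have : z ∉ tsupport (chartExt φ e) := fun hcon => by
      obtain ⟨p, hp, rfl⟩ := (tsupport_chartExt_subset hsub).1 hcon
      exact hz (e.map_source (hsub hp))
    exact (contDiffAt_const (c := (0 : ℂ))).congr_of_eventuallyEq
      (notMem_tsupport_iff_eventuallyEq.1 this)

lemma analyticAt_formCoeff {θ : C → ℂ} {e : OpenPartialHomeomorph C ℂ} (he : e ∈ atlas ℂ C)
    {z : ℂ} (hz : z ∈ e.target) 
    (h : AnalyticAt ℂ (formCoeff θ (chartAt ℂ (e.symm z))) (chartAt ℂ (e.symm z) (e.symm z))) :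
    AnalyticAt ℂ (formCoeff θ e) z := by
  set e' := chartAt ℂ (e.symm z)
  have he' : e' ∈ atlas ℂ C := chart_mem_atlas ℂ _
  have hz' : e.symm z ∈ e'.source := mem_chart_source ℂ _
  have hτ := analyticAt_transition he he' hz hz'
  have h1 : AnalyticAt ℂ (fun w => formCoeff θ e' ((e' ∘ e.symm) w) * deriv (e' ∘ e.symm) w) z :=
    (AnalyticAt.comp (g := formCoeff θ e') (f := e' ∘ e.symm) (x := z) h hτ).mul hτ.deriv
  refine h1.congr ?_
  filter_upwards [(e.continuousAt_symm hz).eventually_mem (e'.open_source.mem_nhds hz'),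
    e.open_target.mem_nhds hz] with w hw hw'
  rw [formCoeff_eq_mul θ he he' hw' hw]
  rfl

/-- **The residue theorem** on a compact Riemann surface: the sum of the residues of a
meromorphic 1-form vanishes. -/
theorem sum_residue_eq_zero (θ R : C → ℂ) (P : Finset C)
    (hθ : ∀ p ∉ P, AnalyticAt ℂ (formCoeff θ (chartAt ℂ p)) (chartAt ℂ p p))
    (hR : ∀ p ∈ P, ∀ᶠ r : ℝ in 𝓝[>] 0,
      ∮ z in C(chartAt ℂ p p, r), formCoeff θ (chartAt ℂ p) z = 2 * Real.pi * Complex.I * R p) :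
    ∑ p ∈ P, R p = 0 := by
  classical
  obtain ⟨T, ρ, hPT, hρ, hsub, hsum, hle⟩ := exists_partition P
  have hsub' : ∀ i, tsupport (ρ i) ⊆ (chartAt ℂ (i : C)).source := fun i =>
    (hsub i).trans sdiff_subset
  have hat : ∀ i : T, chartAt ℂ (i : C) ∈ atlas ℂ C := fun i => chart_mem_atlas ℂ _
  have hcc : ∀ i : T, HasCompactSupport (chartExt (ρ i) (chartAt ℂ (i : C))) := fun i =>
    (tsupport_chartExt_subset (hsub' i)).2.of_isClosed_subset (isClosed_tsupport _)
      (tsupport_chartExt_subset (hsub' i)).1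
  have hcd : ∀ i : T, ContDiff ℝ 1 (chartExt (ρ i) (chartAt ℂ (i : C))) := fun i =>
    contDiff_chartExt (hρ i) (hat i) (hsub' i)
  have hform : ∀ (i : T), ∀ z ∈ (chartAt ℂ (i : C)).target,
      dbar (chartExt (ρ i) (chartAt ℂ (i : C))) z * formCoeff θ (chartAt ℂ (i : C)) z =
        dbarForm (ρ i) θ (chartAt ℂ (i : C)) z := fun i z hz => by
    rw [dbarForm, dbar_congr (chartExt_eventuallyEq (ρ i) hz)]
  have hanal : ∀ (i : T), ∀ z ∈ tsupport (chartExt (ρ i) (chartAt ℂ (i : C))),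
      z ∈ (chartAt ℂ (i : C)).target ∧
      (z ≠ chartAt ℂ (i : C) i ∨ (i : C) ∉ P → 
        AnalyticAt ℂ (formCoeff θ (chartAt ℂ (i : C))) z) := by
    intro i z hz
    obtain ⟨p, hp, rfl⟩ := (tsupport_chartExt_subset (hsub' i)).1 hz
    have hps := hsub' i hp
    refine ⟨(chartAt ℂ (i : C)).map_source hps, fun hne => analyticAt_formCoeff (hat i)
      ((chartAt ℂ (i : C)).map_source hps) ?_⟩
    rw [(chartAt ℂ (i : C)).left_inv hps]
    refine hθ p fun hpP => (hsub i hp).2 ⟨hpP, ?_⟩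
    rintro rfl
    rcases hne with hne | hne
    · exact hne rfl
    · exact hne hpP
  have hone : ∀ i : T, (i : C) ∈ P →
      chartExt (ρ i) (chartAt ℂ (i : C)) =ᶠ[𝓝 (chartAt ℂ (i : C) i)] fun _ => 1 := by
    intro i hi
    have h1 : ∀ᶠ p in 𝓝 (i : C), ∀ j, j ≠ i → ρ j p = 0 := by
      refine eventually_all.2 fun j => ?_
      by_cases hj : j = i
      · simp [hj]
      · have : (i : C) ∉ tsupport (ρ j) := fun hcon =>
          (hsub j hcon).2 ⟨hi, fun h => hj (Subtype.ext h.symm)⟩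
        filter_upwards [notMem_tsupport_iff_eventuallyEq.1 this] with p hp _ using hp
    rw [eventually_nhds_chart (mem_chart_source ℂ (i : C))] at h1
    filter_upwards [h1, (chartAt ℂ (i : C)).open_target.mem_nhds (mem_chart_target ℂ (i : C))]
      with z hz hzt
    have h2 := hsum ((chartAt ℂ (i : C)).symm z)
    rw [Finset.sum_eq_single i (fun j _ hj => hz j hj) (by simp)] at h2
    simp [chartExt, hzt, h2]
  -- The only possible singularity of `θ` in the support of `ρ i` is the centre `i`, when `i ∈ P`;
  -- there `ρ i` is locally `1`, so `dbar` vanishes around it.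
  have hcont : ∀ (i : T), ∀ z ∈ tsupport (dbar (chartExt (ρ i) (chartAt ℂ (i : C)))),
      ContinuousAt (formCoeff θ (chartAt ℂ (i : C))) z := by
    intro i z hz
    refine ((hanal i z (tsupport_dbar_subset _ hz)).2 ?_).continuousAt
    by_contra hcon
    push Not at hcon
    obtain ⟨rfl, hiP⟩ := hcon
    refine (notMem_tsupport_iff_eventuallyEq.2 ?_) hz
    filter_upwards [(hone i hiP).eventuallyEq_nhds] with w hw
    rw [dbar_congr hw, dbar_const]
    rfl
  have hint : ∀ i : T, Integrable fun z => dbar (chartExt (ρ i) (chartAt ℂ (i : C))) z *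
      formCoeff θ (chartAt ℂ (i : C)) z := fun i =>
    integrable_dbar_mul (hcd i) (hcc i) (hcont i)
  have hstokes := sum_integral_dbarForm_eq_zero (fun i : T => chartAt ℂ (i : C)) hat ρ hρ hsub'
    hsum hle θ fun i => (hint i).integrableOn.congr_fun (hform i)
      (chartAt ℂ (i : C)).open_target.measurableSet
  have hval : ∀ i : T, ∫ z in (chartAt ℂ (i : C)).target, dbarForm (ρ i) θ (chartAt ℂ (i : C)) z =
      -2 * Real.pi * (if (i : C) ∈ P then R i else 0) := by
    intro i
    rw [← setIntegral_congr_fun (chartAt ℂ (i : C)).open_target.measurableSet (hform i),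
      setIntegral_eq_integral_of_forall_compl_eq_zero]
    · by_cases hiP : (i : C) ∈ P
      · rw [if_pos hiP]
        exact integral_dbar_mul_eq_residue (hcd i) (hcc i) (hone i hiP)
          (fun z hz hne => (hanal i z hz).2 (Or.inl hne)) (hR i hiP)
      · rw [if_neg hiP, mul_zero]
        exact integral_dbar_mul_eq_zero (hcd i) (hcc i) fun z hz => (hanal i z hz).2 (Or.inr hiP)
    · intro z hz
      have : z ∉ tsupport (dbar (chartExt (ρ i) (chartAt ℂ (i : C)))) := fun hcon =>
        hz (hanal i z (tsupport_dbar_subset _ hcon)).1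
      rw [image_eq_zero_of_notMem_tsupport this, zero_mul]
  rw [Finset.sum_congr rfl fun i _ => hval i, ← Finset.mul_sum] at hstokes
  have h1 : ∑ i : T, (if (i : C) ∈ P then R i else 0) = ∑ p ∈ P, R p := by
    rw [Finset.sum_coe_sort T fun p => if p ∈ P then R p else 0, ← Finset.sum_filter]
    congr 1
    ext p
    simp only [Finset.mem_filter]
    exact ⟨fun h => h.2, fun h => ⟨hPT h, h⟩⟩
  rw [h1] at hstokes
  have hpi : (-2 * Real.pi : ℂ) ≠ 0 := by
    simp [Real.pi_ne_zero]
  exact (mul_eq_zero.1 hstokes).resolve_left hpi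

end Residue

/-! ### Residues at double and simple poles as circle integrals. -/

section CircleIntegral

lemma eventually_circleIntegral_double {g A : ℂ → ℂ} {z₀ : ℂ} (hA : AnalyticAt ℂ A z₀)
    (hg : ∀ᶠ z in 𝓝[≠] z₀, g z = A z / (z - z₀) ^ 2) :
    ∀ᶠ r : ℝ in 𝓝[>] 0, ∮ z in C(z₀, r), g z = 2 * Real.pi * Complex.I * deriv A z₀ := by
  obtain ⟨ε, hε, hball⟩ := Metric.eventually_nhds_iff.1
    ((eventually_nhdsWithin_iff.1 hg).and hA.eventually_analyticAt)
  filter_upwards [Ioo_mem_nhdsGT hε] with r hr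
  have hd : DifferentiableOn ℂ A (Metric.closedBall z₀ r) := fun z hz =>
    (hball (lt_of_le_of_lt hz hr.2)).2.differentiableAt.differentiableWithinAt
  have h1 := hd.deriv_eq_smul_circleIntegral hr.1
  have h2 : ∮ z in C(z₀, r), g z = ∮ z in C(z₀, r), (1 / (z - z₀) ^ 2) • A z := by
    refine circleIntegral.integral_congr hr.1.le fun z hz => ?_
    have hne : z ≠ z₀ := Metric.ne_of_mem_sphere hz hr.1.ne'
    rw [(hball (lt_of_le_of_lt (Metric.sphere_subset_closedBall hz) hr.2)).1 hne, smul_eq_mul]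
    ring
  rw [h2, h1, smul_eq_mul]

/-- Treated as a double pole with numerator `A z * (z - z₀)`, whose derivative at `z₀` is `A z₀`. -/
lemma eventually_circleIntegral_simple {g A : ℂ → ℂ} {z₀ : ℂ} (hA : AnalyticAt ℂ A z₀)
    (hg : ∀ᶠ z in 𝓝[≠] z₀, g z = A z / (z - z₀)) :
    ∀ᶠ r : ℝ in 𝓝[>] 0, ∮ z in C(z₀, r), g z = 2 * Real.pi * Complex.I * A z₀ := by
  have hB : AnalyticAt ℂ (fun z => A z * (z - z₀)) z₀ := by fun_prop
  have h := eventually_circleIntegral_double (g := g) hB ?_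
  · have : deriv (fun z => A z * (z - z₀)) z₀ = A z₀ := by
      have h1 : deriv (fun z => A z * (z - z₀)) z₀ = _ :=
        (hA.differentiableAt.hasDerivAt.mul ((hasDerivAt_id z₀).sub_const z₀)).deriv
      simpa using h1
    simpa [this] using h
  · filter_upwards [hg, self_mem_nhdsWithin] with z hz hne
    have : z - z₀ ≠ 0 := sub_ne_zero.2 hne
    rw [hz]
    field_simp

end CircleIntegral

/-! ### Logarithmic derivatives of meromorphic functions. -/

section Meromorphic

variable {C : Type*} [TopologicalSpace C] [ChartedSpace ℂ C] [IsManifold 𝓘(ℂ, ℂ) ω C]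

lemma eventuallyEq_logDeriv (f : C → ℂ) (p : C) :
    logDeriv (f ∘ (chartAt ℂ p).symm) =ᶠ[𝓝 (chartAt ℂ p p)] formCoeff (dlog f) (chartAt ℂ p) := by
  filter_upwards [(chartAt ℂ p).open_target.mem_nhds (mem_chart_target ℂ p)] with z hz
  exact logDeriv_comp_symm f (chart_mem_atlas ℂ p) hz

lemma eventually_chartJac_ne_zero (p : C) :
    ∀ᶠ z in 𝓝 (chartAt ℂ p p), chartJac (chartAt ℂ p) z ≠ 0 := by
  filter_upwards [(chartAt ℂ p).open_target.mem_nhds (mem_chart_target ℂ p)] with z hz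
  exact chartJac_ne_zero (chart_mem_atlas ℂ p) hz

lemma ordDlog_eq_top_iff (f : C → ℂ) (p : C) :
    ordDlog f p = ⊤ ↔ ∀ᶠ q in 𝓝[≠] p, dlog f q = 0 := by
  rw [ordDlog, meromorphicOrderAt_eq_top_iff, eventually_nhdsNE_chart (mem_chart_source ℂ p)]
  refine eventually_congr ?_
  filter_upwards [(eventuallyEq_logDeriv f p).filter_mono nhdsWithin_le_nhds,
    (eventually_chartJac_ne_zero p).filter_mono nhdsWithin_le_nhds] with z hz hz'
  rw [hz, formCoeff]
  simp [hz']

lemma ordDlog_ne_top_iff {f : C → ℂ} (hf : IsMeromorphic f) (p : C) :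
    ordDlog f p ≠ ⊤ ↔ ∀ᶠ q in 𝓝[≠] p, dlog f q ≠ 0 := by
  rw [ordDlog, meromorphicOrderAt_ne_top_iff_eventually_ne_zero (hf p).meromorphicAt.logDeriv,
    eventually_nhdsNE_chart (mem_chart_source ℂ p)]
  refine eventually_congr ?_
  filter_upwards [(eventuallyEq_logDeriv f p).filter_mono nhdsWithin_le_nhds,
    (eventually_chartJac_ne_zero p).filter_mono nhdsWithin_le_nhds] with z hz hz'
  rw [hz, formCoeff]
  simp [hz']

lemma isOpen_setOf_eventually_nhdsNE [T1Space C] (P : C → Prop) :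
    IsOpen {p : C | ∀ᶠ q in 𝓝[≠] p, P q} := by
  rw [isOpen_iff_mem_nhds]
  intro p hp
  have h1 : ∀ᶠ q in 𝓝 p, ∀ᶠ r in 𝓝 q, r ≠ p → P r :=
    (eventually_nhdsWithin_iff.1 hp).eventually_nhds
  filter_upwards [h1] with q hq
  by_cases hqp : q = p
  · rw [hqp]; exact hp
  · have h2 : ∀ᶠ r in 𝓝 q, P r := by
      filter_upwards [hq, isOpen_ne.mem_nhds hqp] with r hr hr' using hr hr'
    exact h2.filter_mono nhdsWithin_le_nhds

/-- The identity theorem: finite order and infinite order of `df/f` are both conditions on punctured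
neighbourhoods, hence both open, and the surface is connected. -/
lemma ordDlog_ne_top [T1Space C] [ConnectedSpace C] {f : C → ℂ} (hf : IsMeromorphic f) {p₀ : C}
    (h₀ : ordDlog f p₀ ≠ ⊤) (p : C) : ordDlog f p ≠ ⊤ := by
  have h1 : {p : C | ordDlog f p ≠ ⊤} = {p : C | ∀ᶠ q in 𝓝[≠] p, dlog f q ≠ 0} := by
    ext q; exact ordDlog_ne_top_iff hf q
  have h2 : {p : C | ordDlog f p ≠ ⊤}ᶜ = {p : C | ∀ᶠ q in 𝓝[≠] p, dlog f q = 0} := by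
    ext q; simpa using ordDlog_eq_top_iff f q
  have hc : IsClopen {p : C | ordDlog f p ≠ ⊤} := by
    refine ⟨⟨?_⟩, ?_⟩
    · rw [h2]; exact isOpen_setOf_eventually_nhdsNE _
    · rw [h1]; exact isOpen_setOf_eventually_nhdsNE _
  exact (Set.ext_iff.1 (hc.eq_univ ⟨p₀, h₀⟩) p).2 (mem_univ p)

/-- `f` is holomorphic and does not vanish at `p`. -/
def IsUnitAt (f : C → ℂ) (p : C) : Prop :=
  AnalyticAt ℂ (f ∘ (chartAt ℂ p).symm) (chartAt ℂ p p) ∧ f p ≠ 0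

lemma analyticAt_comp_symm {f : C → ℂ} {e e' : OpenPartialHomeomorph C ℂ} (he : e ∈ atlas ℂ C)
    (he' : e' ∈ atlas ℂ C) {z : ℂ} (hz : z ∈ e.target) (hz' : e.symm z ∈ e'.source)
    (h : AnalyticAt ℂ (f ∘ e'.symm) (e' (e.symm z))) : AnalyticAt ℂ (f ∘ e.symm) z := by
  have hτ := analyticAt_transition he he' hz hz'
  refine (AnalyticAt.comp (g := f ∘ e'.symm) (f := e' ∘ e.symm) (x := z) h hτ).congr ?_
  filter_upwards [(e.continuousAt_symm hz).eventually_mem (e'.open_source.mem_nhds hz')] with w hw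
  simp [hw]

/-- A function in normal form takes the value `0` at its poles, so a nonzero value rules out a pole.
-/
lemma IsMeromorphic.isUnitAt_of_ne_zero {f : C → ℂ} (hf : IsMeromorphic f) {p : C} (h : f p ≠ 0) :
    IsUnitAt f p := by
  refine ⟨?_, h⟩
  rcases meromorphicNFAt_iff_analyticAt_or.1 (hf p) with h1 | ⟨-, -, h1⟩
  · exact h1
  · simp [mem_chart_source] at h1
    exact absurd h1 h

/-- Division by zero gives `0`, so `dlog f` takes the value `0` wherever `f` does. -/
lemma dlog_ne_zero_imp {f : C → ℂ} {p : C} (h : dlog f p ≠ 0) : f p ≠ 0 := by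
  intro hcon
  apply h
  simp [dlog, logDeriv_apply, mem_chart_source, hcon]

lemma IsMeromorphic.eventually_isUnitAt {f : C → ℂ} (hf : IsMeromorphic f) {p : C}
    (h : ordDlog f p ≠ ⊤) : ∀ᶠ q in 𝓝[≠] p, IsUnitAt f q ∧ dlog f q ≠ 0 := by
  filter_upwards [(ordDlog_ne_top_iff hf p).1 h] with q hq
  exact ⟨hf.isUnitAt_of_ne_zero (dlog_ne_zero_imp hq), hq⟩

lemma ord_ne_top_of_ordDlog_ne_top {f : C → ℂ} {p : C} (h : ordDlog f p ≠ ⊤) : ord f p ≠ ⊤ := by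
  intro hcon
  apply h
  rw [ord, meromorphicOrderAt_eq_top_iff] at hcon
  rw [ordDlog, meromorphicOrderAt_eq_top_iff]
  filter_upwards [hcon] with z hz
  rw [logDeriv_apply, hz, div_zero]

lemma neg_one_le_ordDlog {f : C → ℂ} (hf : IsMeromorphic f) {p : C} (h : ordDlog f p ≠ ⊤) :
    ((-1 : ℤ) : WithTop ℤ) ≤ ordDlog f p := by
  by_cases h0 : ord f p = 0
  · exact le_trans (by decide) (meromorphicOrderAt_logDeriv_nonneg (hf p).meromorphicAt h0)
  · exact (meromorphicOrderAt_logDeriv_eq_neg_one (hf p).meromorphicAt h0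
      (ord_ne_top_of_ordDlog_ne_top h)).ge

/-- The value `0` marks zeroes and poles of `f` alike, and `df/f` has a simple pole at both. -/
lemma ordDlog_eq_neg_one_of_eq_zero {f : C → ℂ} (hf : IsMeromorphic f) {p : C}
    (h : ordDlog f p ≠ ⊤) (h0 : f p = 0) : ordDlog f p = -1 := by
  refine meromorphicOrderAt_logDeriv_eq_neg_one (hf p).meromorphicAt (fun hcon => ?_)
    (ord_ne_top_of_ordDlog_ne_top h)
  have := (hf p).meromorphicOrderAt_eq_zero_iff.1 hcon
  simp [mem_chart_source, h0] at this

lemma isUnitAt_of_ordDlog_nonneg {f : C → ℂ} (hf : IsMeromorphic f) {p : C}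
    (h : ordDlog f p ≠ ⊤) (h0 : 0 ≤ ordDlog f p) : IsUnitAt f p := by
  refine hf.isUnitAt_of_ne_zero fun hcon => ?_
  rw [ordDlog_eq_neg_one_of_eq_zero hf h hcon] at h0
  exact absurd h0 (by decide)

lemma finite_of_eventually_nhdsNE [CompactSpace C] {P : C → Prop}
    (h : ∀ p, ∀ᶠ q in 𝓝[≠] p, P q) : {p | ¬ P p}.Finite := by
  by_contra hinf
  obtain ⟨p, -, hp⟩ := Set.Infinite.exists_accPt_of_subset_isCompact hinf isCompact_univ
    (subset_univ _)
  rw [accPt_iff_frequently_nhdsNE] at hp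
  exact hp ((h p).mono fun q hq => not_not.2 hq)

end Meromorphic

/-! ### The poles of `dy/dx`. -/

section DyDx

variable {C : Type*} [TopologicalSpace C] [ChartedSpace ℂ C] [T2Space C] [CompactSpace C]
  {ι : Type*} {g : ℕ}

/-- The meromorphic function `dy/dx` of a spectral curve. -/
def SpectralCurve.dydx (S : SpectralCurve C ι g) (p : C) : ℂ :=
  dlog S.Y p / dlog S.X p

variable [IsManifold 𝓘(ℂ, ℂ) ω C] [ConnectedSpace C] (S : SpectralCurve C ι g)
  (hpoles : ∀ p : C, ordDlog S.Y p < 0 → ordDlog S.X p < 0)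

/-- The index `σ` supplies one point where the order is known to be finite. -/
lemma SpectralCurve.ordDlogX_ne_top (σ : ι) (p : C) : ordDlog S.X p ≠ ⊤ :=
  ordDlog_ne_top S.meroX (p₀ := S.α σ) (by rw [S.simple_zero σ]; decide) p

lemma SpectralCurve.ordDlogY_ne_top (σ : ι) (p : C) : ordDlog S.Y p ≠ ⊤ :=
  ordDlog_ne_top S.meroY (p₀ := S.α σ)
    (fun h => S.dy_ne_zero σ (by rw [h]; exact WithTop.coe_lt_top 0)) p

lemma SpectralCurve.eventuallyEq_dydx (p : C) :
    S.dydx ∘ (chartAt ℂ p).symm =ᶠ[𝓝 (chartAt ℂ p p)] fun z =>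
      logDeriv (S.Y ∘ (chartAt ℂ p).symm) z / logDeriv (S.X ∘ (chartAt ℂ p).symm) z := by
  filter_upwards [eventuallyEq_logDeriv S.X p, eventuallyEq_logDeriv S.Y p,
    eventually_chartJac_ne_zero p] with z h1 h2 h3
  rw [h1, h2, formCoeff, formCoeff, mul_div_mul_right _ _ h3]
  rfl

include hpoles in
lemma SpectralCurve.ordDlogY_alpha (σ : ι) : ordDlog S.Y (S.α σ) = 0 := by
  refine le_antisymm (not_lt.1 (S.dy_ne_zero σ)) (not_lt.1 fun h => ?_)
  have := hpoles _ h
  rw [S.simple_zero σ] at this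
  exact absurd this (by decide)

-- Off the branchpoints `dx` has order `0` or `-1`, `dy` has order at least `-1`, and order `-1` for
-- `dy` forces order `-1` for `dx`; so the quotient has nonnegative order. The extension is asserted
-- on a punctured neighbourhood because the value of `dydx` at the centre may be a default one.
include hpoles in
lemma SpectralCurve.exists_dydx_extension {p : C} (σ : ι) (hp : p ∉ range S.α) :
    ∃ A : ℂ → ℂ, AnalyticAt ℂ A (chartAt ℂ p p) ∧
      ∀ᶠ z in 𝓝[≠] (chartAt ℂ p p), S.dydx ((chartAt ℂ p).symm z) = A z := by
  have hmX := (S.meroX p).meromorphicAt.logDeriv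
  have hmY := (S.meroY p).meromorphicAt.logDeriv
  have hord : 0 ≤ meromorphicOrderAt (fun z =>
      logDeriv (S.Y ∘ (chartAt ℂ p).symm) z / logDeriv (S.X ∘ (chartAt ℂ p).symm) z)
      (chartAt ℂ p p) := by
    have h0 := fun_meromorphicOrderAt_div hmY hmX
    rw [h0]
    change 0 ≤ ordDlog S.Y p - ordDlog S.X p
    have hX : ¬ 0 < ordDlog S.X p := fun h => hp (S.range_α ▸ h)
    have hX' := S.ordDlogX_ne_top σ p
    have hY' := S.ordDlogY_ne_top σ p
    have hXm := neg_one_le_ordDlog S.meroX hX'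
    have hYm := neg_one_le_ordDlog S.meroY hY'
    have hpol := hpoles p
    lift ordDlog S.X p to ℤ using hX' with m
    lift ordDlog S.Y p to ℤ using hY' with n
    norm_cast at *
    lia
  obtain ⟨A, hA, hAe⟩ := (hmY.fun_div hmX).meromorphicOrderAt_nonneg_iff.1 hord
  refine ⟨A, hA, ?_⟩
  filter_upwards [hAe, (S.eventuallyEq_dydx p).filter_mono nhdsWithin_le_nhds] with z h1 h2
  rw [← h1, ← h2]
  rfl

/-- The points where `X` and `Y` are holomorphic and nonzero, and `dx` does not vanish. -/
def SpectralCurve.IsGood (p : C) : Prop :=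
  IsUnitAt S.X p ∧ IsUnitAt S.Y p ∧ dlog S.X p ≠ 0

lemma SpectralCurve.eventually_isGood (σ : ι) (p : C) : ∀ᶠ q in 𝓝[≠] p, S.IsGood q := by
  filter_upwards [S.meroX.eventually_isUnitAt (S.ordDlogX_ne_top σ p),
    S.meroY.eventually_isUnitAt (S.ordDlogY_ne_top σ p)] with q h1 h2
  exact ⟨h1.1, h2.1, h1.2⟩

lemma SpectralCurve.dlogX_alpha (σ : ι) : dlog S.X (S.α σ) = 0 := by
  have hu : IsUnitAt S.X (S.α σ) := isUnitAt_of_ordDlog_nonneg S.meroX (S.ordDlogX_ne_top σ _)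
    (by rw [S.simple_zero σ]; decide)
  have han : AnalyticAt ℂ (logDeriv (S.X ∘ (chartAt ℂ (S.α σ)).symm))
      (chartAt ℂ (S.α σ) (S.α σ)) := by
    refine hu.1.deriv.div hu.1 ?_
    simpa [mem_chart_source] using hu.2
  have hlim := tendsto_zero_of_meromorphicOrderAt_pos
    (f := logDeriv (S.X ∘ (chartAt ℂ (S.α σ)).symm)) (x := chartAt ℂ (S.α σ) (S.α σ))
    (by change 0 < ordDlog S.X (S.α σ); rw [S.simple_zero σ]; decide)
  exact tendsto_nhds_unique (han.continuousAt.tendsto.mono_left nhdsWithin_le_nhds) hlim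

variable {S} in
lemma SpectralCurve.IsGood.notMem_range {p : C} (h : S.IsGood p) : p ∉ range S.α := by
  rintro ⟨σ, rfl⟩
  exact h.2.2 (S.dlogX_alpha σ)

lemma SpectralCurve.isGood_of_notMem_range {p : C} (hX : S.X p ≠ 0) (hY : S.Y p ≠ 0)
    (hp : p ∉ range S.α) : S.IsGood p := by
  have hu := S.meroX.isUnitAt_of_ne_zero hX
  refine ⟨hu, S.meroY.isUnitAt_of_ne_zero hY, fun hcon => hp ?_⟩
  rw [S.range_α]
  have han : AnalyticAt ℂ (logDeriv (S.X ∘ (chartAt ℂ p).symm)) (chartAt ℂ p p) := by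
    refine hu.1.deriv.div hu.1 ?_
    simpa [mem_chart_source] using hu.2
  refine (tendsto_zero_iff_meromorphicOrderAt_pos han.meromorphicAt).1 ?_
  have : logDeriv (S.X ∘ (chartAt ℂ p).symm) (chartAt ℂ p p) = 0 := hcon
  rw [← this]
  exact han.continuousAt.tendsto.mono_left nhdsWithin_le_nhds

variable {S} in
lemma SpectralCurve.IsGood.analyticAt_dydx {p : C} (h : S.IsGood p) :
    AnalyticAt ℂ (S.dydx ∘ (chartAt ℂ p).symm) (chartAt ℂ p p) := by
  have hX : AnalyticAt ℂ (logDeriv (S.X ∘ (chartAt ℂ p).symm)) (chartAt ℂ p p) :=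
    h.1.1.deriv.div h.1.1 (by simpa [mem_chart_source] using h.1.2)
  have hY : AnalyticAt ℂ (logDeriv (S.Y ∘ (chartAt ℂ p).symm)) (chartAt ℂ p p) :=
    h.2.1.1.deriv.div h.2.1.1 (by simpa [mem_chart_source] using h.2.1.2)
  exact (hY.div hX h.2.2).congr (S.eventuallyEq_dydx p).symm

lemma SpectralCurve.finite_not_isGood (σ : ι) : {p | ¬ S.IsGood p}.Finite :=
  finite_of_eventually_nhdsNE (S.eventually_isGood σ)

end DyDx

/-! ### Derivatives of lifted curves, and residues. -/

section Calculus

/-- A continuous curve whose image under a local diffeomorphism is differentiable is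
differentiable. -/
lemma hasDerivAt_of_comp {Φ : ℂ → ℂ} {Φ' E' : ℂ} {c E : ℝ → ℂ} {s₀ : ℝ}
    (hΦ : HasStrictDerivAt Φ Φ' (c s₀)) (hΦ' : Φ' ≠ 0) (hc : ContinuousAt c s₀)
    (hE : HasDerivAt E E' s₀) (h : ∀ᶠ s in 𝓝 s₀, Φ (c s) = E s) :
    HasDerivAt c (E' * Φ'⁻¹) s₀ := by
  have h1 : HasDerivAt (hΦ.localInverse Φ Φ' (c s₀) hΦ') Φ'⁻¹ (E s₀) := by
    rw [← h.self_of_nhds]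
    exact (hΦ.to_localInverse hΦ').hasDerivAt
  have h2 := h1.scomp s₀ hE
  rw [smul_eq_mul] at h2
  refine h2.congr_of_eventuallyEq ?_
  filter_upwards [h, hc.eventually (hΦ.eventually_left_inverse hΦ')] with s hs hs'
  rw [Function.comp_apply, ← hs, hs']

lemma analyticAt_dslope {f : ℂ → ℂ} {z₀ : ℂ} (hf : AnalyticAt ℂ f z₀) :
    AnalyticAt ℂ (dslope f z₀) z₀ := by
  obtain ⟨p, hp⟩ := hf
  exact ⟨_, hp.has_fpower_series_dslope_fslope⟩

lemma residueAt_eq {g A : ℂ → ℂ} {z₀ : ℂ} (hA : AnalyticAt ℂ A z₀)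
    (hg : ∀ᶠ z in 𝓝[≠] z₀, g z = A z / (z - z₀)) : residueAt g z₀ = A z₀ := by
  refine Tendsto.limUnder_eq (tendsto_const_nhds.congr' ?_)
  filter_upwards [eventually_circleIntegral_simple hA hg] with r hr
  rw [hr]
  have := Complex.two_pi_I_ne_zero
  field_simp

end Calculus

/-! ### The Bergman kernel in charts, one variable at a time. -/

section Kernel

variable {C : Type*} [TopologicalSpace C] [ChartedSpace ℂ C] [IsManifold 𝓘(ℂ, ℂ) ω C]

/-- The coefficient of `B(p, q)` in the preferred charts at `p` and `q`. -/
def BiDiff.val (B : BiDiff C) (p q : C) : ℂ :=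
  B p q (1 : ℂ) (1 : ℂ)

lemma BiDiff.apply_eq (B : BiDiff C) (p q : C) (v w : ℂ) : B p q v w = v * w * B.val p q := by
  have h1 : B p q v w = (v • B p q (1 : ℂ)) w := by
    have := (B p q).map_smul v (1 : ℂ)
    rw [← this]
    congr 2
    exact (mul_one v).symm
  have h2 : B p q (1 : ℂ) w = w * B.val p q := by
    have := (B p q (1 : ℂ)).map_smul w (1 : ℂ)
    rw [BiDiff.val]
    rw [← smul_eq_mul, ← this]
    congr 1
    exact (mul_one w).symm
  rw [h1, mul_assoc, ← h2]
  rfl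

lemma BiDiff.coeff_eq (B : BiDiff C) {e e' : OpenPartialHomeomorph C ℂ} (he : e ∈ atlas ℂ C)
    (he' : e' ∈ atlas ℂ C) {z w : ℂ} (hz : z ∈ e.target) (hw : w ∈ e'.target) :
    B.coeff e e' z w = chartJac e z * formCoeff (B.val (e.symm z)) e' w := by
  rw [BiDiff.coeff, coordVec_eq he hz, coordVec_eq he' hw]
  rw [B.apply_eq, formCoeff]
  ring

variable {B : BiDiff C}

lemma BiDiff.eventuallyEq_coeff_right (B : BiDiff C) (p q : C) :
    formCoeff (B.val p) (chartAt ℂ q) =ᶠ[𝓝 (chartAt ℂ q q)]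
      fun w => B.coeff (chartAt ℂ p) (chartAt ℂ q) (chartAt ℂ p p) w := by
  filter_upwards [(chartAt ℂ q).open_target.mem_nhds (mem_chart_target ℂ q)] with w hw
  rw [B.coeff_eq (chart_mem_atlas ℂ p) (chart_mem_atlas ℂ q) (mem_chart_target ℂ p) hw,
    chartJac_self, one_mul, (chartAt ℂ p).left_inv (mem_chart_source ℂ p)]

lemma BiDiff.IsBergman.analyticAt_right (hB : B.IsBergman) {p q : C} (hpq : p ≠ q) :
    AnalyticAt ℂ (formCoeff (B.val p) (chartAt ℂ q)) (chartAt ℂ q q) := by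
  have h := hB.holo _ (chart_mem_atlas ℂ p) _ (chart_mem_atlas ℂ q) _ (mem_chart_target ℂ p) _
    (mem_chart_target ℂ q) (by simpa [mem_chart_source] using hpq)
  have h2 : AnalyticAt ℂ (fun w : ℂ => (chartAt ℂ p p, w)) (chartAt ℂ q q) := by fun_prop
  exact (h.comp_of_eq h2 rfl).congr (B.eventuallyEq_coeff_right p q).symm

lemma BiDiff.IsBergman.analyticAt_left (hB : B.IsBergman) {p q : C} (hpq : p ≠ q) :
    AnalyticAt ℂ (formCoeff (fun r => B.val r q) (chartAt ℂ p)) (chartAt ℂ p p) := by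
  have h := hB.holo _ (chart_mem_atlas ℂ p) _ (chart_mem_atlas ℂ q) _ (mem_chart_target ℂ p) _
    (mem_chart_target ℂ q) (by simpa [mem_chart_source] using hpq)
  have h2 : AnalyticAt ℂ (fun z : ℂ => (z, chartAt ℂ q q)) (chartAt ℂ p p) := by fun_prop
  refine (h.comp_of_eq h2 rfl).congr ?_
  filter_upwards [(chartAt ℂ p).open_target.mem_nhds (mem_chart_target ℂ p)] with z hz
  simp only [Function.comp_apply]
  rw [B.coeff_eq (chart_mem_atlas ℂ p) (chart_mem_atlas ℂ q) hz (mem_chart_target ℂ q),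
    formCoeff_self, formCoeff, mul_comm]

lemma BiDiff.IsBergman.diag_right (hB : B.IsBergman) (p : C) :
    ∃ h : ℂ → ℂ, AnalyticAt ℂ h (chartAt ℂ p p) ∧ ∀ᶠ w in 𝓝[≠] (chartAt ℂ p p),
      formCoeff (B.val p) (chartAt ℂ p) w = 1 / (w - chartAt ℂ p p) ^ 2 + h w := by
  obtain ⟨h, hh, hev⟩ := hB.diag _ (chart_mem_atlas ℂ p) _ (mem_chart_target ℂ p)
  have h2 : AnalyticAt ℂ (fun w : ℂ => (chartAt ℂ p p, w)) (chartAt ℂ p p) := by fun_prop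
  refine ⟨fun w => h (chartAt ℂ p p, w), hh.comp_of_eq h2 rfl, ?_⟩
  have h3 := h2.continuousAt.eventually hev
  filter_upwards [h3.filter_mono nhdsWithin_le_nhds,
    (B.eventuallyEq_coeff_right p p).filter_mono nhdsWithin_le_nhds, self_mem_nhdsWithin]
    with w h4 h5 h6
  have h6' : w ≠ chartAt ℂ p p := h6
  rw [h5, h4 h6'.symm]
  congr 2
  ring

lemma BiDiff.IsBergman.diag_left (hB : B.IsBergman) (p : C) :
    ∃ h : ℂ → ℂ, AnalyticAt ℂ h (chartAt ℂ p p) ∧ ∀ᶠ z in 𝓝[≠] (chartAt ℂ p p),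
      formCoeff (fun r => B.val r p) (chartAt ℂ p) z = 1 / (z - chartAt ℂ p p) ^ 2 + h z := by
  obtain ⟨h, hh, hev⟩ := hB.diag _ (chart_mem_atlas ℂ p) _ (mem_chart_target ℂ p)
  have h2 : AnalyticAt ℂ (fun z : ℂ => (z, chartAt ℂ p p)) (chartAt ℂ p p) := by fun_prop
  refine ⟨fun z => h (z, chartAt ℂ p p), hh.comp_of_eq h2 rfl, ?_⟩
  have h3 := h2.continuousAt.eventually hev
  filter_upwards [h3.filter_mono nhdsWithin_le_nhds,
    ((chartAt ℂ p).open_target.eventually_mem (mem_chart_target ℂ p)).filter_mono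
      nhdsWithin_le_nhds, self_mem_nhdsWithin] with z h4 h5 h6
  rw [← h4 h6, B.coeff_eq (chart_mem_atlas ℂ p) (chart_mem_atlas ℂ p) h5 (mem_chart_target ℂ p),
    formCoeff_self, formCoeff, mul_comm]

end Kernel

/-! ### Local expansions at the branchpoints and the differential of `dy/dx`. -/

section LocalAnalysis

variable {C : Type*} [TopologicalSpace C] [ChartedSpace ℂ C] [T2Space C] [CompactSpace C]
  {ι : Type*} {g : ℕ} [IsManifold 𝓘(ℂ, ℂ) ω C] [ConnectedSpace C] {S : SpectralCurve C ι g}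
  (D : SteepestDescent S)

namespace SteepestDescent

/-- The derivative of the local coordinate `ζ` at the branchpoint. -/
def dζ (σ : ι) : ℂ := diff (D.ζ σ) (S.α σ)

lemma analyticAt_ζ (σ : ι) :
    AnalyticAt ℂ (D.ζ σ ∘ (chartAt ℂ (S.α σ)).symm) (chartAt ℂ (S.α σ) (S.α σ)) := by
  rw [Complex.analyticAt_iff_eventually_differentiableAt]
  filter_upwards [(eventually_nhds_chart (mem_chart_source ℂ (S.α σ))).1 (D.ζ_holo σ),
    (chartAt ℂ (S.α σ)).open_target.mem_nhds (mem_chart_target ℂ (S.α σ))] with z hz hz'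
  exact differentiableAt_comp_symm (chart_mem_atlas ℂ _) hz' hz

lemma ζ_alpha (σ : ι) : D.ζ σ (S.α σ) = 0 := by
  have := (D.ζ_γ σ).self_of_nhds
  simpa [D.γ_zero] using this

lemma eventually_logDerivX (σ : ι) :
    ∀ᶠ z in 𝓝 (chartAt ℂ (S.α σ) (S.α σ)), logDeriv (S.X ∘ (chartAt ℂ (S.α σ)).symm) z =
      -2 * (D.ζ σ ∘ (chartAt ℂ (S.α σ)).symm) z *
        deriv (D.ζ σ ∘ (chartAt ℂ (S.α σ)).symm) z := by
  have h1 := (eventually_nhds_chart (mem_chart_source ℂ (S.α σ))).1 (D.ζ_sq σ)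
  filter_upwards [h1.eventually_nhds, (D.analyticAt_ζ σ).eventually_analyticAt] with z hz hz'
  set f := D.ζ σ ∘ (chartAt ℂ (S.α σ)).symm
  have h2 : S.X ∘ (chartAt ℂ (S.α σ)).symm =ᶠ[𝓝 z] fun w => Complex.exp (-(D.a σ + f w ^ 2)) := hz
  have h3 := ((((hz'.differentiableAt.hasDerivAt).pow 2).const_add (D.a σ)).neg.cexp).deriv
  have h4 : deriv (fun w => Complex.exp (-(D.a σ + f w ^ 2))) z = _ := h3
  rw [logDeriv_apply, h2.deriv_eq, h2.eq_of_nhds, h4, mul_div_assoc, mul_comm]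
  simp

/-- `dX/X = -2 ζ dζ` has order exactly one at the branchpoint and `ζ` already vanishes there; a zero
of `dζ` would raise the order to at least two. -/
lemma dζ_ne_zero (σ : ι) : D.dζ σ ≠ 0 := by
  intro h0
  set z₀ := chartAt ℂ (S.α σ) (S.α σ)
  set f := D.ζ σ ∘ (chartAt ℂ (S.α σ)).symm
  have hf : AnalyticAt ℂ f z₀ := D.analyticAt_ζ σ
  have hf0 : f z₀ = 0 := by
    simp [f, z₀, mem_chart_source, D.ζ_alpha]
  have hord : ordDlog S.X (S.α σ) = 1 := S.simple_zero σ
  have e1 : meromorphicOrderAt f z₀ + meromorphicOrderAt (deriv f) z₀ = 1 := by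
    rw [← hord, ordDlog, ← meromorphicOrderAt_mul hf.meromorphicAt hf.deriv.meromorphicAt]
    have e2 : meromorphicOrderAt (logDeriv (S.X ∘ (chartAt ℂ (S.α σ)).symm)) z₀ =
        meromorphicOrderAt ((fun _ => (-2 : ℂ)) * (f * deriv f)) z₀ := by
      refine meromorphicOrderAt_congr ?_
      filter_upwards [(D.eventually_logDerivX σ).filter_mono nhdsWithin_le_nhds] with z hz
      rw [hz]
      simp [f, mul_assoc]
    rw [e2, meromorphicOrderAt_mul_of_ne_zero analyticAt_const (by norm_num)]
  have h1 : 0 < meromorphicOrderAt f z₀ := by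
    refine (tendsto_zero_iff_meromorphicOrderAt_pos hf.meromorphicAt).1 ?_
    rw [← hf0]
    exact hf.continuousAt.tendsto.mono_left nhdsWithin_le_nhds
  have h2 : 0 < meromorphicOrderAt (deriv f) z₀ := by
    refine (tendsto_zero_iff_meromorphicOrderAt_pos hf.deriv.meromorphicAt).1 ?_
    rw [← show deriv f z₀ = 0 from h0]
    exact hf.deriv.continuousAt.tendsto.mono_left nhdsWithin_le_nhds
  have h3 : meromorphicOrderAt f z₀ ≠ ⊤ := by
    intro h; rw [h] at e1; simp at e1
  have h4 : meromorphicOrderAt (deriv f) z₀ ≠ ⊤ := by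
    intro h; rw [h] at e1; simp at e1
  lift meromorphicOrderAt f z₀ to ℤ using h3 with m
  lift meromorphicOrderAt (deriv f) z₀ to ℤ using h4 with n
  norm_cast at *
  lia

/-- The value of `d ξ_{σ,0}` away from the branchpoint `α_σ`. -/
lemma dξ_one (σ : ι) {p : C} (hp : p ≠ S.α σ) :
    D.dξ σ p (1 : ℂ) = -(S.B.val p (S.α σ) / D.dζ σ) := by
  set e := chartAt ℂ (S.α σ)
  set z₀ := e (S.α σ)
  set f := D.ζ σ ∘ e.symm
  have hf : AnalyticAt ℂ f z₀ := D.analyticAt_ζ σ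
  have hf0 : f z₀ = 0 := by
    simp [f, z₀, e, mem_chart_source, D.ζ_alpha]
  -- `dslope f z₀` is the analytic function `ζ / (z - z₀)`, with value `dζ` at `z₀`. Thus `1/ζ` has
  -- a simple pole with residue `1/dζ`.
  have hk : AnalyticAt ℂ (dslope f z₀) z₀ := analyticAt_dslope hf
  have hk0 : dslope f z₀ z₀ = D.dζ σ := dslope_same f z₀
  have hA : AnalyticAt ℂ (fun z => formCoeff (S.B.val p) e z / dslope f z₀ z) z₀ :=
    (S.bergman.analyticAt_right hp).fun_div hk (by rw [hk0]; exact D.dζ_ne_zero σ)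
  have h := residueAt_eq (g := fun z => S.B p (e.symm z) (1 : ℂ) (coordVec e z) /
      D.ζ σ (e.symm z)) hA ?_
  · rw [show D.dξ σ p (1 : ℂ) = -residueAt (fun z => S.B p (e.symm z) (1 : ℂ) (coordVec e z) /
      D.ζ σ (e.symm z)) z₀ from rfl, h, hk0, formCoeff_self]
  · filter_upwards [self_mem_nhdsWithin, (e.open_target.eventually_mem
      (mem_chart_target ℂ (S.α σ))).filter_mono nhdsWithin_le_nhds] with z hz hzt
    have hne : z - z₀ ≠ 0 := sub_ne_zero.2 hz
    have h1 : D.ζ σ (e.symm z) = dslope f z₀ z * (z - z₀) := by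
      rw [dslope_of_ne f hz, slope_def_field, hf0, sub_zero, div_mul_cancel₀ _ hne]
      rfl
    rw [coordVec_eq (chart_mem_atlas ℂ _) hzt, S.B.apply_eq, h1, formCoeff]
    rw [div_div, one_mul, mul_comm (chartJac _ _)]

lemma X_γ_ne_zero (σ : ι) (s : ℝ) : S.X (D.γ σ s) ≠ 0 := by
  rw [D.x_γ]; exact Complex.exp_ne_zero _

lemma Y_γ_ne_zero (σ : ι) (s : ℝ) : S.Y (D.γ σ s) ≠ 0 := by
  rw [D.y_γ]; exact Complex.exp_ne_zero _

lemma continuousAt_chart_γ (σ : ι) (s : ℝ) :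
    ContinuousAt (fun t => chartAt ℂ (D.γ σ s) (D.γ σ t)) s :=
  ContinuousAt.comp (f := D.γ σ) (x := s)
    ((chartAt ℂ (D.γ σ s)).continuousAt (mem_chart_source ℂ _)) (D.γ_continuous σ).continuousAt

lemma eventually_mem_source (σ : ι) (s : ℝ) :
    ∀ᶠ t in 𝓝 s, D.γ σ t ∈ (chartAt ℂ (D.γ σ s)).source :=
  (D.γ_continuous σ).continuousAt.eventually_mem
    ((chartAt ℂ (D.γ σ s)).open_source.mem_nhds (mem_chart_source ℂ _))

/-- The branch `y` is only assumed continuous; it is differentiable because `exp` is locally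
invertible and `e^{-y}` is `Y` along the path. -/
lemma hasDerivAt_y (σ : ι) (s : ℝ) {c' : ℂ}
    (hc : HasDerivAt (fun t => chartAt ℂ (D.γ σ s) (D.γ σ t)) c' s) :
    HasDerivAt (D.y σ) (-(dlog S.Y (D.γ σ s) * c')) s := by
  have hY := (S.meroY.isUnitAt_of_ne_zero (D.Y_γ_ne_zero σ s)).1
  have h1 : HasStrictDerivAt (fun w : ℂ => Complex.exp (-w)) (-Complex.exp (-D.y σ s)) (D.y σ s) := by
    simpa using (hasStrictDerivAt_id (D.y σ s)).neg.cexp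
  have h2 := (hY.differentiableAt.hasDerivAt).scomp s hc
  have h3 := hasDerivAt_of_comp h1 (neg_ne_zero.2 (Complex.exp_ne_zero _))
    (D.y_continuous σ).continuousAt h2 ?_
  · convert h3 using 1
    rw [dlog, logDeriv_apply]
    simp only [Function.comp_apply, (chartAt ℂ (D.γ σ s)).left_inv (mem_chart_source ℂ _),
      smul_eq_mul, D.y_γ]
    have := Complex.exp_ne_zero (-D.y σ s)
    field_simp
  · filter_upwards [D.eventually_mem_source σ s] with t ht
    simp [ht, D.y_γ]

/-- The path is only assumed continuous, but near the branchpoint the local coordinate `ζ` takes it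
to `s`. -/
lemma hasDerivAt_γ_zero (σ : ι) :
    HasDerivAt (fun t => chartAt ℂ (D.γ σ 0) (D.γ σ t)) (D.dζ σ)⁻¹ 0 := by
  have h0 : D.γ σ 0 = S.α σ := D.γ_zero σ
  have hf := (D.analyticAt_ζ σ).hasStrictDerivAt
  have hc := D.continuousAt_chart_γ σ 0
  have hs := D.eventually_mem_source σ 0
  rw [h0] at hc hs ⊢
  have h1 : HasStrictDerivAt (D.ζ σ ∘ (chartAt ℂ (S.α σ)).symm) (D.dζ σ)
      ((fun t => chartAt ℂ (S.α σ) (D.γ σ t)) 0) := by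
    simp only [h0]
    exact hf
  have h2 := hasDerivAt_of_comp h1 (D.dζ_ne_zero σ) hc
    (Complex.ofRealCLM.hasDerivAt (x := (0 : ℝ))) ?_
  · simpa using h2
  · filter_upwards [hs, D.ζ_γ σ] with s hs hs'
    simp [hs, hs']

/-- The limit defining the time is twice the derivative of `y` along the path at `s = 0`. -/
lemma exp_neg_time {σ : ι} {t : ℂ} (ht : D.IsTimeZero σ t) :
    Complex.exp (-t) = -2 * dlog S.Y (S.α σ) / D.dζ σ := by
  have h1 := D.hasDerivAt_y σ 0 (D.hasDerivAt_γ_zero σ)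
  set y' := -(dlog S.Y (D.γ σ 0) * (D.dζ σ)⁻¹)
  have h2 : HasDerivAt (fun s : ℝ => D.y σ s - D.y σ (-s)) (y' + y') 0 := by
    have h3 : HasDerivAt (fun s : ℝ => D.y σ (-s)) (-y') 0 := by
      have h4 : HasDerivAt (D.y σ) y' (-0) := by simpa using h1
      have h5 := h4.scomp (0 : ℝ) (hasDerivAt_neg (0 : ℝ))
      rw [neg_one_smul] at h5
      exact h5
    rw [← sub_neg_eq_add]
    exact h1.sub h3
  have h3 := h2.tendsto_slope
  have h4 := tendsto_nhds_unique ht (h3.congr fun s => by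
    simp [slope, div_eq_inv_mul])
  rw [h4, show y' = -(dlog S.Y (S.α σ) * (D.dζ σ)⁻¹) by simp only [y', D.γ_zero]]
  ring

/-- The polar part of `dy/dx` at a branchpoint. -/
lemma exists_dydx_polar {σ : ι} {t : ℂ} (ht : D.IsTimeZero σ t)
    (hpoles : ∀ p : C, ordDlog S.Y p < 0 → ordDlog S.X p < 0) :
    ∃ A : ℂ → ℂ, AnalyticAt ℂ A (chartAt ℂ (S.α σ) (S.α σ)) ∧
      A (chartAt ℂ (S.α σ) (S.α σ)) = Complex.exp (-t) / (4 * D.dζ σ) ∧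
      ∀ᶠ z in 𝓝[≠] (chartAt ℂ (S.α σ) (S.α σ)), S.dydx ((chartAt ℂ (S.α σ)).symm z) =
        A z / (z - chartAt ℂ (S.α σ) (S.α σ)) := by
  set e := chartAt ℂ (S.α σ)
  set z₀ := e (S.α σ)
  set f := D.ζ σ ∘ e.symm
  have hf : AnalyticAt ℂ f z₀ := D.analyticAt_ζ σ
  have hf0 : f z₀ = 0 := by
    simp [f, z₀, e, mem_chart_source, D.ζ_alpha]
  have hk : AnalyticAt ℂ (dslope f z₀) z₀ := analyticAt_dslope hf
  have hk0 : dslope f z₀ z₀ = D.dζ σ := dslope_same f z₀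
  have hf' : deriv f z₀ = D.dζ σ := rfl
  have hdζ := D.dζ_ne_zero σ
  have hYu : IsUnitAt S.Y (S.α σ) := isUnitAt_of_ordDlog_nonneg S.meroY (S.ordDlogY_ne_top σ _)
    (S.ordDlogY_alpha hpoles σ).ge
  have hY : AnalyticAt ℂ (logDeriv (S.Y ∘ e.symm)) z₀ :=
    hYu.1.deriv.div hYu.1 (by simpa [mem_chart_source, e] using hYu.2)
  -- Divide `dY/Y` by `dX/X = -2 ζ dζ`, with one factor `z - z₀` taken out of `ζ`. At `z₀` this is
  -- `dlog Y / (-2 dζ²)`, and `e^{-t} = -2 dlog Y / dζ` turns it into `e^{-t} / (4 dζ)`: this is the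
  -- source of the factor `4`.
  refine ⟨fun z => logDeriv (S.Y ∘ e.symm) z / (-2 * dslope f z₀ z * deriv f z), ?_, ?_, ?_⟩
  · refine hY.fun_div ((analyticAt_const.mul hk).mul hf.deriv) ?_
    simp [hf', hdζ]
  · rw [D.exp_neg_time ht]
    simp only [hk0, hf']
    change dlog S.Y (S.α σ) / _ = _
    field_simp
    norm_num
  · filter_upwards [self_mem_nhdsWithin, (D.eventually_logDerivX σ).filter_mono nhdsWithin_le_nhds,
      (S.eventuallyEq_dydx (S.α σ)).filter_mono nhdsWithin_le_nhds] with z hz hX hdy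
    have hne : z - z₀ ≠ 0 := sub_ne_zero.2 hz
    have h1 : f z = dslope f z₀ z * (z - z₀) := by
      rw [dslope_of_ne f hz, slope_def_field, hf0, sub_zero, div_mul_cancel₀ _ hne]
    have hdy' : S.dydx (e.symm z) = logDeriv (S.Y ∘ e.symm) z / logDeriv (S.X ∘ e.symm) z := hdy
    have hX' : logDeriv (S.X ∘ e.symm) z = -2 * f z * deriv f z := hX
    rw [hdy', hX', h1, div_div]
    congr 1
    ring

/-- The differential of `dy/dx` in terms of the forms `dξ_{σ,0}`. -/
theorem diff_dydx [Fintype ι] {t : ι → ℂ} (ht : ∀ σ, D.IsTimeZero σ (t σ))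
    (hpoles : ∀ p : C, ordDlog S.Y p < 0 → ordDlog S.X p < 0) (σ : ι) {p : C} (hp : S.IsGood p) :
    4 * diff S.dydx p = ∑ σ', Complex.exp (-t σ') * D.dξ σ' p (1 : ℂ) := by
  classical
  have hpα : ∀ σ', p ≠ S.α σ' := fun σ' h => hp.notMem_range ⟨σ', h.symm⟩
  choose A hA hA0 hAev using fun σ' => D.exists_dydx_polar (ht σ') hpoles
  -- `P` contains all branchpoints and all zeroes and poles of `X` and `Y`. The good point `p`,
  -- where `B(p, ·)` has its double pole, is adjoined separately.
  set P := (S.finite_not_isGood σ).toFinset with hPdef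
  have hmemP : ∀ q, q ∈ P ↔ ¬ S.IsGood q := fun q => by simp [hPdef]
  have hpP : p ∉ P := by simp [hmemP, hp]
  set θ : C → ℂ := fun q => S.dydx q * S.B.val p q with hθ
  have hform : ∀ (q : C) (w : ℂ), formCoeff θ (chartAt ℂ q) w =
      S.dydx ((chartAt ℂ q).symm w) * formCoeff (S.B.val p) (chartAt ℂ q) w := fun q w => by
    simp only [hθ, formCoeff]
    ring
  -- By injectivity of `α` the sum has at most one nonzero term. It is `0` at the points of `P` that
  -- are not branchpoints, where `dy/dx` extends holomorphically.
  set R : C → ℂ := fun q => if q = p then diff S.dydx p else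
    ∑ σ', if S.α σ' = q then Complex.exp (-t σ') / (4 * D.dζ σ') * S.B.val p (S.α σ') else 0
    with hR
  have hres := sum_residue_eq_zero θ R (insert p P) ?_ ?_
  · rw [Finset.sum_insert hpP] at hres
    have h1 : R p = diff S.dydx p := by simp [hR]
    have h2 : ∑ q ∈ P, R q =
        ∑ σ', Complex.exp (-t σ') / (4 * D.dζ σ') * S.B.val p (S.α σ') := by
      have : ∀ q ∈ P, R q = ∑ σ', if S.α σ' = q then
          Complex.exp (-t σ') / (4 * D.dζ σ') * S.B.val p (S.α σ') else 0 := fun q hq => by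
        have hqp : q ≠ p := fun h => hpP (h ▸ hq)
        simp only [hR, if_neg hqp]
      rw [Finset.sum_congr rfl this, Finset.sum_comm]
      refine Finset.sum_congr rfl fun σ' _ => ?_
      rw [Finset.sum_ite_eq, if_pos]
      exact (hmemP _).2 fun hg => hg.notMem_range ⟨σ', rfl⟩
    rw [h1, h2] at hres
    rw [eq_neg_of_add_eq_zero_left hres, mul_neg, Finset.mul_sum, ← Finset.sum_neg_distrib]
    refine Finset.sum_congr rfl fun σ' _ => ?_
    rw [D.dξ_one σ' (hpα σ')]
    have := D.dζ_ne_zero σ'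
    field_simp
  · intro q hq
    simp only [Finset.mem_insert, hmemP, not_or, not_not] at hq
    exact (hq.2.analyticAt_dydx.mul (S.bergman.analyticAt_right (Ne.symm hq.1))).congr
      (Eventually.of_forall fun w => (hform q w).symm)
  · intro q hq
    by_cases hqp : q = p
    · subst hqp
      obtain ⟨h, hh, hev⟩ := S.bergman.diag_right q
      set z₀ := chartAt ℂ q q
      have hF := hp.analyticAt_dydx
      -- `1/(w - z₀)² + h = (1 + h (w - z₀)²)/(w - z₀)²`, and the correction does not affect the
      -- first derivative at `z₀`.
      have hA' : AnalyticAt ℂ (fun w => (S.dydx ∘ (chartAt ℂ q).symm) w *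
          (1 + h w * (w - z₀) ^ 2)) z₀ := by fun_prop
      have hcirc := eventually_circleIntegral_double (g := formCoeff θ (chartAt ℂ q)) hA' ?_
      · have hd : deriv (fun w => (S.dydx ∘ (chartAt ℂ q).symm) w * (1 + h w * (w - z₀) ^ 2)) z₀ =
            R q := by
          have h1 : HasDerivAt (fun w => h w * (w - z₀) ^ 2) 0 z₀ := by
            have := hh.differentiableAt.hasDerivAt.fun_mul
              (((hasDerivAt_id z₀).sub_const z₀).fun_pow 2)
            simpa using this
          have h2 := (hF.differentiableAt.hasDerivAt.fun_mul (h1.const_add 1)).deriv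
          rw [h2]
          simp [hR, diff, z₀]
        simpa only [hd] using hcirc
      · filter_upwards [hev, self_mem_nhdsWithin] with w hw hne
        have : w - z₀ ≠ 0 := sub_ne_zero.2 hne
        rw [hform, hw]
        simp only [Function.comp_apply]
        field_simp
    · have hqP : q ∈ P := (Finset.mem_insert.1 hq).resolve_left hqp
      have hBan := S.bergman.analyticAt_right (Ne.symm hqp)
      by_cases hqα : q ∈ range S.α
      · obtain ⟨σ', rfl⟩ := hqα
        have hcirc := eventually_circleIntegral_simple
          (g := formCoeff θ (chartAt ℂ (S.α σ'))) ((hA σ').fun_mul hBan) ?_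
        · have hRq : R (S.α σ') = Complex.exp (-t σ') / (4 * D.dζ σ') * S.B.val p (S.α σ') := by
            simp only [hR, if_neg hqp]
            rw [Finset.sum_eq_single σ' (fun τ _ hτ => if_neg fun h => hτ (S.α_injective h))
              (by simp), if_pos rfl]
          rw [hA0, formCoeff_self, ← hRq] at hcirc
          exact hcirc
        · filter_upwards [hAev σ'] with w hw
          rw [hform, hw, div_mul_eq_mul_div]
      · obtain ⟨A', hA', hev⟩ := S.exists_dydx_extension hpoles σ hqα
        set z₀ := chartAt ℂ q q
        -- A removable singularity, written as a simple pole whose numerator vanishes at `z₀`.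
        have hAB : AnalyticAt ℂ (fun w => A' w * formCoeff (S.B.val p) (chartAt ℂ q) w * (w - z₀))
            z₀ := by fun_prop
        have hcirc := eventually_circleIntegral_simple (g := formCoeff θ (chartAt ℂ q)) hAB ?_
        · have hRq : R q = 0 := by
            simp only [hR, if_neg hqp]
            exact Finset.sum_eq_zero fun τ _ => if_neg fun h => hqα ⟨τ, h⟩
          rw [hRq]
          simpa using hcirc
        · filter_upwards [hev, self_mem_nhdsWithin] with w hw hne
          have : w - z₀ ≠ 0 := sub_ne_zero.2 hne
          rw [hform, hw]
          field_simp

end SteepestDescent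

end LocalAnalysis

/-! ### Functions that are constant on punctured neighbourhoods. -/

section Punctured

/-- The exponential maps a half-plane, which is convex, onto the punctured ball. -/
lemma isPreconnected_punctured_ball (z₀ : ℂ) (r : ℝ) :
    IsPreconnected (Metric.ball z₀ r \ {z₀}) := by
  rcases le_or_gt r 0 with hr | hr
  · rw [Metric.ball_eq_empty.2 hr, empty_sdiff]
    exact isPreconnected_empty
  have h : Metric.ball z₀ r \ {z₀} = (fun w => z₀ + Complex.exp w) '' {w | w.re < Real.log r} := by
    ext z
    simp only [Set.mem_sdiff, Metric.mem_ball, mem_singleton_iff, mem_image, mem_ofPred_eq,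
      dist_eq_norm]
    constructor
    · rintro ⟨h1, h2⟩
      have h3 : z - z₀ ≠ 0 := sub_ne_zero.2 h2
      refine ⟨Complex.log (z - z₀), ?_, by rw [Complex.exp_log h3]; ring⟩
      rw [Complex.log_re]
      exact Real.log_lt_log (norm_pos_iff.2 h3) h1
    · rintro ⟨w, hw, rfl⟩
      refine ⟨?_, by simp⟩
      rw [add_sub_cancel_left, Complex.norm_exp]
      exact (Real.lt_log_iff_exp_lt hr).1 hw
  rw [h]
  refine (convex_halfSpace_re_lt _).isPreconnected.image _ ?_
  fun_prop

/-- A function on a punctured neighbourhood whose derivative vanishes is constant. -/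
lemma exists_eventually_eq_const {G : ℂ → ℂ} {z₀ : ℂ}
    (h : ∀ᶠ z in 𝓝[≠] z₀, DifferentiableAt ℂ G z ∧ deriv G z = 0) :
    ∃ c, ∀ᶠ z in 𝓝[≠] z₀, G z = c := by
  obtain ⟨ε, hε, hball⟩ := Metric.eventually_nhds_iff.1 (eventually_nhdsWithin_iff.1 h)
  have hsub : ∀ z ∈ Metric.ball z₀ ε \ {z₀}, DifferentiableAt ℂ G z ∧ deriv G z = 0 :=
    fun z hz => hball hz.1 hz.2
  obtain ⟨c, hc⟩ := IsOpen.exists_is_const_of_deriv_eq_zero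
    (Metric.isOpen_ball.sdiff isClosed_singleton) (isPreconnected_punctured_ball z₀ ε)
    (fun z hz => (hsub z hz).1.differentiableWithinAt) (fun z hz => (hsub z hz).2)
  refine ⟨c, ?_⟩
  rw [eventually_nhdsWithin_iff]
  filter_upwards [Metric.ball_mem_nhds z₀ hε] with z hz hne using hc z ⟨hz, hne⟩

/-- A function on the line that is constant on a punctured neighbourhood of each point takes
the same constant value there. -/
lemma exists_eventually_eq_const_of_forall {k : ℝ → ℂ}
    (h : ∀ s₀, ∃ c, ∀ᶠ s in 𝓝[≠] s₀, k s = c) : ∃ c, ∀ s₀, ∀ᶠ s in 𝓝[≠] s₀, k s = c := by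
  choose c hc using h
  have hloc : IsLocallyConstant c := by
    rw [IsLocallyConstant.iff_eventually_eq]
    intro s₀
    have h1 := (eventually_nhdsWithin_iff.1 (hc s₀)).eventually_nhds
    filter_upwards [h1] with s₁ hs₁
    by_cases hne : s₁ = s₀
    · rw [hne]
    · have h2 : ∀ᶠ s in 𝓝 s₁, k s = c s₀ := by
        filter_upwards [hs₁, isOpen_ne.mem_nhds hne] with s hs hs' using hs hs'
      obtain ⟨s, hs, hs'⟩ := ((h2.filter_mono nhdsWithin_le_nhds).and (hc s₁)).exists
      rw [← hs', hs]
  refine ⟨c 0, fun s₀ => ?_⟩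
  rw [hloc.apply_eq_of_preconnectedSpace 0 s₀]
  exact hc s₀

end Punctured

/-! ### Derivatives along a steepest descent path. -/

section AlongPath

variable {C : Type*} [TopologicalSpace C] [ChartedSpace ℂ C] [T2Space C] [CompactSpace C]
  {ι : Type*} {g : ℕ} [IsManifold 𝓘(ℂ, ℂ) ω C] [ConnectedSpace C] {S : SpectralCurve C ι g}
  (D : SteepestDescent S)

namespace SteepestDescent

/-- `X` and `Y` are exponentials along the path, so it avoids their zeroes and poles. -/
lemma isGood_γ {σ : ι} {s : ℝ} (h : D.γ σ s ∉ range S.α) : S.IsGood (D.γ σ s) :=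
  S.isGood_of_notMem_range (D.X_γ_ne_zero σ s) (D.Y_γ_ne_zero σ s) h

lemma finite_γ_mem_range [Finite ι] (σ : ι) : {s | D.γ σ s ∈ range S.α}.Finite :=
  (finite_range S.α).preimage (D.γ_injective σ).injOn

/-- Off the branchpoints `X` is a local coordinate, in which the path is the smooth curve `e^{-(a +
s²)}`; continuity of the path then implies differentiability. -/
lemma hasDerivAt_chart_γ {σ : ι} {s : ℝ} (h : D.γ σ s ∉ range S.α) :
    HasDerivAt (fun t => chartAt ℂ (D.γ σ s) (D.γ σ t)) (-(2 * s) / dlog S.X (D.γ σ s)) s := by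
  have hg := D.isGood_γ h
  have hX := hg.1.1
  have hne := hg.2.2
  have hX0 := D.X_γ_ne_zero σ s
  have hd : deriv (S.X ∘ (chartAt ℂ (D.γ σ s)).symm) (chartAt ℂ (D.γ σ s) (D.γ σ s)) =
      dlog S.X (D.γ σ s) * S.X (D.γ σ s) := by
    rw [dlog, logDeriv_apply]
    simp only [Function.comp_apply, (chartAt ℂ (D.γ σ s)).left_inv (mem_chart_source ℂ _)]
    field_simp
  have hE : HasDerivAt (fun t : ℝ => Complex.exp (-(D.a σ + (t : ℂ) ^ 2)))
      (S.X (D.γ σ s) * -(2 * s)) s := by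
    have h1 : HasDerivAt (fun t : ℝ => (t : ℂ)) 1 s := Complex.ofRealCLM.hasDerivAt
    have h2 := (((h1.fun_pow 2).const_add (D.a σ)).fun_neg).cexp
    rw [D.x_γ]
    simpa using h2
  have h3 := hasDerivAt_of_comp hX.hasStrictDerivAt (by rw [hd]; exact mul_ne_zero hne hX0)
    (D.continuousAt_chart_γ σ s) hE ?_
  · convert h3 using 1
    rw [hd]
    field_simp
  · filter_upwards [D.eventually_mem_source σ s] with t ht
    simp [ht, D.x_γ]

lemma hasDerivAt_comp_γ {σ : ι} {s : ℝ} (h : D.γ σ s ∉ range S.α) {F : C → ℂ}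
    (hF : DifferentiableAt ℂ (F ∘ (chartAt ℂ (D.γ σ s)).symm) (chartAt ℂ (D.γ σ s) (D.γ σ s))) :
    HasDerivAt (fun t => F (D.γ σ t)) (-(2 * s) * (diff F (D.γ σ s) / dlog S.X (D.γ σ s))) s := by
  have h1 := hF.hasDerivAt.scomp s (D.hasDerivAt_chart_γ h)
  have h2 : HasDerivAt (fun t => F (D.γ σ t)) _ s := h1.congr_of_eventuallyEq (by
    filter_upwards [D.eventually_mem_source σ s] with t ht
    simp [ht])
  convert h2 using 1
  rw [diff, smul_eq_mul]
  ring

lemma hasDerivAt_y_of_notMem {σ : ι} {s : ℝ} (h : D.γ σ s ∉ range S.α) :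
    HasDerivAt (D.y σ) (2 * s * S.dydx (D.γ σ s)) s := by
  convert D.hasDerivAt_y σ s (D.hasDerivAt_chart_γ h) using 1
  rw [SpectralCurve.dydx]
  ring

lemma continuousAt_dydx_γ {σ : ι} {s : ℝ} (h : D.γ σ s ∉ range S.α) :
    ContinuousAt (fun t => S.dydx (D.γ σ t)) s :=
  (D.hasDerivAt_comp_γ h (D.isGood_γ h).analyticAt_dydx.differentiableAt).continuousAt

lemma hasDerivAt_branch {σ σ' : ι} {ξ : ℝ → ℂ} (hξ : D.IsBranch σ σ' ξ) {s : ℝ}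
    (h : D.γ σ s ∉ range S.α) :
    HasDerivAt ξ (-(2 * s) * (D.dξ σ' (D.γ σ s) (1 : ℂ) / dlog S.X (D.γ σ s))) s := by
  obtain ⟨F, hF, hξF⟩ := hξ s
  have hne : D.γ σ s ≠ S.α σ' := fun hc => h ⟨σ', hc.symm⟩
  obtain ⟨hF1, hF2⟩ := hF.self_of_nhds hne
  have h1 := D.hasDerivAt_comp_γ h (mdifferentiableAt_iff_chart.1 hF1)
  rw [show diff F (D.γ σ s) = D.dξ σ' (D.γ σ s) (1 : ℂ) from
    (mfderiv_one_eq hF1).symm.trans (hF2 (1 : ℂ))] at h1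
  refine h1.congr_of_eventuallyEq ?_
  filter_upwards [hξF, (D.γ_continuous σ).continuousAt.eventually_ne hne] with t ht ht'
  exact ht ht'

/-- Along a steepest descent path, `4 dy/dx` agrees with `∑ e^{-t̂} ξ` up to a constant. -/
lemma exists_sum_branch_eq [Fintype ι] {t : ι → ℂ} (ht : ∀ σ, D.IsTimeZero σ (t σ))
    (hpoles : ∀ p : C, ordDlog S.Y p < 0 → ordDlog S.X p < 0) (σ : ι) {ξ : ι → ℝ → ℂ}
    (hξ : ∀ σ', D.IsBranch σ σ' (ξ σ')) :
    ∃ c : ℂ, ∀ s, D.γ σ s ∉ range S.α →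
      ∑ σ', Complex.exp (-t σ') * ξ σ' s = 4 * S.dydx (D.γ σ s) + c := by
  set k : ℝ → ℂ := fun s => ∑ σ', Complex.exp (-t σ') * ξ σ' s - 4 * S.dydx (D.γ σ s) with hk
  -- Near each parameter `k` is the restriction of a single-valued function `G` with zero
  -- differential on a punctured neighbourhood in the surface. Such a neighbourhood is connected, so
  -- the constant is the same before and after the path crosses a branchpoint.
  have hloc : ∀ s₀, ∃ c, ∀ᶠ s in 𝓝[≠] s₀, k s = c := by
    intro s₀
    choose F hF hξF using fun σ' => hξ σ' s₀
    set e := chartAt ℂ (D.γ σ s₀) with he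
    have hea : e ∈ atlas ℂ C := chart_mem_atlas ℂ _
    have hps : D.γ σ s₀ ∈ e.source := mem_chart_source ℂ _
    set G : C → ℂ := fun p => ∑ σ', Complex.exp (-t σ') * F σ' p - 4 * S.dydx p with hG
    have hgood : ∀ᶠ p in 𝓝[≠] (D.γ σ s₀), S.IsGood p ∧ ∀ σ',
        MDifferentiableAt 𝓘(ℂ, ℂ) 𝓘(ℂ, ℂ) (F σ') p ∧ diff (F σ') p = D.dξ σ' p (1 : ℂ) := by
      filter_upwards [S.eventually_isGood σ (D.γ σ s₀),
        (eventually_all.2 hF).filter_mono nhdsWithin_le_nhds] with p hp hp'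
      refine ⟨hp, fun σ' => ?_⟩
      obtain ⟨h1, h2⟩ := hp' σ' fun h => hp.notMem_range ⟨σ', h.symm⟩
      exact ⟨h1, (mfderiv_one_eq h1).symm.trans (h2 (1 : ℂ))⟩
    have hconst := exists_eventually_eq_const (G := G ∘ e.symm) (z₀ := e (D.γ σ s₀)) ?_
    · obtain ⟨c, hc⟩ := hconst
      refine ⟨c, ?_⟩
      have hc' : ∀ᶠ p in 𝓝[≠] (D.γ σ s₀), G p = c := (eventually_nhdsNE_chart hps).2 hc
      -- Injectivity of the path keeps it inside the punctured neighbourhood.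
      have htend : Tendsto (D.γ σ) (𝓝[≠] s₀) (𝓝[≠] (D.γ σ s₀)) :=
        tendsto_nhdsWithin_iff.2 ⟨(D.γ_continuous σ).continuousAt.tendsto.mono_left nhdsWithin_le_nhds,
          eventually_nhdsWithin_of_forall fun s hs h => hs (D.γ_injective σ h)⟩
      filter_upwards [htend.eventually hc', htend.eventually hgood,
        (eventually_all.2 hξF).filter_mono nhdsWithin_le_nhds] with s h1 h2 h3
      rw [← h1]
      simp only [hk, hG]
      congr 1
      refine Finset.sum_congr rfl fun σ' _ => ?_
      rw [h3 σ' fun h => h2.1.notMem_range ⟨σ', h.symm⟩]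
    · rw [eventually_nhdsNE_chart hps] at hgood
      filter_upwards [hgood, (e.open_target.eventually_mem (e.map_source hps)).filter_mono
        nhdsWithin_le_nhds] with z hz hzt
      have hd1 : ∀ σ', DifferentiableAt ℂ (F σ' ∘ e.symm) z := fun σ' =>
        differentiableAt_comp_symm hea hzt (hz.2 σ').1
      have hd2 : DifferentiableAt ℂ (S.dydx ∘ e.symm) z :=
        (analyticAt_comp_symm hea (chart_mem_atlas ℂ (e.symm z)) hzt (mem_chart_source ℂ _)
          hz.1.analyticAt_dydx).differentiableAt
      have hder : HasDerivAt (G ∘ e.symm) (∑ σ', Complex.exp (-t σ') * deriv (F σ' ∘ e.symm) z -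
          4 * deriv (S.dydx ∘ e.symm) z) z :=
        (HasDerivAt.fun_sum fun σ' _ => ((hd1 σ').hasDerivAt.const_mul _)).sub
          (hd2.hasDerivAt.const_mul 4)
      refine ⟨hder.differentiableAt, ?_⟩
      rw [hder.deriv, deriv_comp_symm S.dydx hea hzt, formCoeff, ← mul_assoc,
        D.diff_dydx ht hpoles σ hz.1, Finset.sum_mul, ← Finset.sum_sub_distrib]
      refine Finset.sum_eq_zero fun σ' _ => ?_
      rw [deriv_comp_symm (F σ') hea hzt, formCoeff, (hz.2 σ').2]
      ring
  obtain ⟨c, hc⟩ := exists_eventually_eq_const_of_forall hloc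
  refine ⟨c, fun s hs => ?_⟩
  have hcont : ContinuousAt k s := by
    refine ContinuousAt.sub ?_ ((D.continuousAt_dydx_γ hs).const_mul 4)
    exact tendsto_finsetSum _ fun σ' _ =>
      ((D.hasDerivAt_branch (hξ σ') hs).continuousAt.const_mul (Complex.exp (-t σ')))
  have h1 : k s = c := tendsto_nhds_unique (hcont.tendsto.mono_left nhdsWithin_le_nhds)
    (tendsto_const_nhds.congr' ((hc s).mono fun _ h => h.symm))
  rw [← h1, hk]
  ring

end SteepestDescent

end AlongPath

/-! ### Elementary estimates near a singularity and at infinity. -/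

section Estimates

lemma le_mul_rpow_neg_half {x d M : ℝ} (hd : 0 < d) (hM : 0 ≤ M) (h : x ^ 2 * d ≤ M ^ 2) :
    x ≤ M * d ^ (-(1 / 2) : ℝ) := by
  rw [Real.rpow_neg hd.le, ← Real.sqrt_eq_rpow, ← div_eq_mul_inv, le_div_iff₀ (Real.sqrt_pos.2 hd)]
  refine abs_le_of_sq_le_sq' ?_ hM |>.2
  rwa [mul_pow, Real.sq_sqrt hd.le]

/-- A function vanishing to second order. -/
lemma exists_norm_sub_le_sq {f : ℂ → ℂ} {z₀ : ℂ} (hf : AnalyticAt ℂ f z₀) (h0 : deriv f z₀ = 0) :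
    ∃ M, 0 ≤ M ∧ ∀ᶠ z in 𝓝 z₀, ‖f z - f z₀‖ ≤ M * ‖z - z₀‖ ^ 2 := by
  set d := dslope f z₀ with hd
  have hdan : AnalyticAt ℂ d z₀ := analyticAt_dslope hf
  have hd0 : d z₀ = 0 := by rw [hd, dslope_same, h0]
  set dd := dslope d z₀
  have hddan : AnalyticAt ℂ dd z₀ := analyticAt_dslope hdan
  refine ⟨‖dd z₀‖ + 1, by positivity, ?_⟩
  filter_upwards [hddan.continuousAt.norm.eventually_le_const (lt_add_one ‖dd z₀‖)] with z hz
  have h1 : f z - f z₀ = (z - z₀) ^ 2 * dd z := by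
    have e1 := sub_smul_dslope f z₀ z
    have e2 := sub_smul_dslope d z₀ z
    rw [hd0, sub_zero] at e2
    rw [← e1, ← hd, ← e2]
    simp only [smul_eq_mul]
    ring
  rw [h1, norm_mul, norm_pow, mul_comm]
  gcongr

/-- For `‖u‖ < 1/2` one has `‖e^u - 1‖ ≥ ‖u‖ - ‖u‖² ≥ ‖u‖/2`. This bounds from below how far `X`
moves along the path. -/
lemma exists_le_norm_exp_sub (a : ℂ) (s₀ : ℝ) :
    ∃ m, 0 < m ∧ ∀ᶠ s : ℝ in 𝓝 s₀, m * |s ^ 2 - s₀ ^ 2| ≤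
      ‖Complex.exp (-(a + (s : ℂ) ^ 2)) - Complex.exp (-(a + (s₀ : ℂ) ^ 2))‖ := by
  refine ⟨‖Complex.exp (-(a + (s₀ : ℂ) ^ 2))‖ / 2, by
    have := norm_pos_iff.2 (Complex.exp_ne_zero (-(a + (s₀ : ℂ) ^ 2)))
    positivity, ?_⟩
  have hc : ContinuousAt (fun s : ℝ => |s ^ 2 - s₀ ^ 2|) s₀ := by fun_prop
  filter_upwards [hc.eventually_lt (continuousAt_const (y := (1 / 2 : ℝ))) (by simp)] with s hs
  set u : ℂ := -((s : ℂ) ^ 2 - (s₀ : ℂ) ^ 2) with hu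
  have hun : ‖u‖ = |s ^ 2 - s₀ ^ 2| := by
    rw [hu, norm_neg, ← Complex.ofReal_pow, ← Complex.ofReal_pow, ← Complex.ofReal_sub,
      Complex.norm_real, Real.norm_eq_abs]
  have h1 : Complex.exp (-(a + (s : ℂ) ^ 2)) - Complex.exp (-(a + (s₀ : ℂ) ^ 2)) =
      Complex.exp (-(a + (s₀ : ℂ) ^ 2)) * (Complex.exp u - 1) := by
    rw [mul_sub, ← Complex.exp_add, mul_one]
    congr 2
    rw [hu]; ring
  have h2 := Complex.norm_exp_sub_one_sub_id_le (x := u) (by rw [hun]; linarith)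
  have h3 : ‖u‖ ≤ ‖Complex.exp u - 1‖ + ‖Complex.exp u - 1 - u‖ := by
    have := norm_sub_le (Complex.exp u - 1) (Complex.exp u - 1 - u)
    rwa [sub_sub_cancel] at this
  rw [h1, norm_mul, ← hun, div_mul_eq_mul_div, mul_div_assoc]
  refine mul_le_mul_of_nonneg_left ?_ (norm_nonneg _)
  rw [← hun] at hs
  nlinarith [norm_nonneg u]

/-- This treats `s₀ = 0` and `s₀ ≠ 0` uniformly: the factor `2s` of `dx` compensates the vanishing
of `s + s₀` when `s₀ = 0`. -/
lemma exists_sq_le_mul_abs_add (s₀ : ℝ) : ∃ K, 0 ≤ K ∧ ∀ᶠ s : ℝ in 𝓝 s₀, s ^ 2 ≤ K * |s + s₀| := by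
  rcases eq_or_ne s₀ 0 with rfl | h0
  · refine ⟨1, zero_le_one, ?_⟩
    filter_upwards [Metric.ball_mem_nhds (0 : ℝ) one_pos] with s hs
    have : |s| < 1 := by simpa [dist_eq_norm] using hs
    rw [add_zero, one_mul, ← sq_abs]
    nlinarith [abs_nonneg s]
  · have hpos := abs_pos.2 h0
    refine ⟨4 * |s₀|, by positivity, ?_⟩
    filter_upwards [Metric.ball_mem_nhds s₀ hpos] with s hs
    have h1 : |s - s₀| < |s₀| := by simpa [dist_eq_norm] using hs
    have h2 : |s| ≤ |s - s₀| + |s₀| := by simpa using abs_add_le (s - s₀) s₀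
    have h3 : |2 * s₀| ≤ |s + s₀| + |s - s₀| := by
      have := abs_sub (s + s₀) (s - s₀)
      rwa [show s + s₀ - (s - s₀) = 2 * s₀ by ring] at this
    rw [abs_mul, abs_two] at h3
    rw [← sq_abs]
    nlinarith [abs_nonneg s]

/-- A function whose derivative has a double pole without residue has a simple pole. -/
lemma exists_norm_mul_le_of_deriv {G h : ℂ → ℂ} {z₀ b : ℂ} (hh : AnalyticAt ℂ h z₀)
    (hG : ∀ᶠ z in 𝓝[≠] z₀, DifferentiableAt ℂ G z ∧ deriv G z = b * (1 / (z - z₀) ^ 2 + h z)) :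
    ∃ M, 0 ≤ M ∧ ∀ᶠ z in 𝓝[≠] z₀, ‖G z‖ * ‖z - z₀‖ ≤ M := by
  obtain ⟨ε, hε, hball⟩ := Metric.eventually_nhds_iff_ball.1 hh.eventually_analyticAt
  -- With a primitive `H` of `h`, the function `b (-(z - z₀)⁻¹ + H)` has the same derivative as `G`,
  -- so it differs from `G` by a constant.
  obtain ⟨H, hH⟩ := DifferentiableOn.isExactOn_ball (f := h) (c := z₀) (r := ε)
    fun z hz => (hball z hz).differentiableAt.differentiableWithinAt
  obtain ⟨k, hk⟩ := exists_eventually_eq_const (z₀ := z₀)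
    (G := fun z => G z - b * (-(z - z₀)⁻¹ + H z)) (by
    filter_upwards [hG, self_mem_nhdsWithin, nhdsWithin_le_nhds (Metric.ball_mem_nhds z₀ hε)]
      with z hz hne hzb
    have hne' : z - z₀ ≠ 0 := sub_ne_zero.2 hne
    have h1 : HasDerivAt (fun z => (z - z₀)⁻¹) (-1 / (z - z₀) ^ 2) z :=
      ((hasDerivAt_id z).sub_const z₀).fun_inv hne'
    have h2 := hz.1.hasDerivAt.fun_sub ((h1.fun_neg.fun_add (hH z hzb)).const_mul b)
    refine ⟨h2.differentiableAt, ?_⟩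
    rw [h2.deriv, hz.2]
    ring)
  have hcont : ContinuousAt (fun z => k * (z - z₀) + b * (-1 + H z * (z - z₀))) z₀ := by
    have : ContinuousAt H z₀ := (hH z₀ (Metric.mem_ball_self hε)).continuousAt
    fun_prop
  refine ⟨‖k * (z₀ - z₀) + b * (-1 + H z₀ * (z₀ - z₀))‖ + 1, by positivity, ?_⟩
  filter_upwards [hk, self_mem_nhdsWithin, (hcont.norm.eventually_le_const
    (lt_add_one _)).filter_mono nhdsWithin_le_nhds] with z h1 h2 h3
  have hne' : z - z₀ ≠ 0 := sub_ne_zero.2 h2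
  refine le_trans (le_of_eq ?_) h3
  rw [← norm_mul, sub_eq_iff_eq_add.1 h1]
  congr 1
  field_simp

lemma exists_growth_of_deriv {h h' : ℝ → ℂ} {R M : ℝ}
    (hd : ∀ s, R ≤ |s| → HasDerivAt h (h' s) s ∧ ‖h' s‖ ≤ M * |s|) :
    ∃ K R', ∀ s, R' ≤ |s| → ‖h s‖ ≤ K * (1 + s ^ 2) := by
  set R₁ := max R 1
  have hR1 : 0 < R₁ := lt_of_lt_of_le one_pos (le_max_right _ _)
  have hR : R ≤ R₁ := le_max_left _ _
  have hM : 0 ≤ M := by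
    have := (hd R₁ (by rwa [abs_of_pos hR1])).2
    rw [abs_of_pos hR1] at this
    by_contra hcon
    nlinarith [norm_nonneg (h' R₁)]
  have key : ∀ {h h' : ℝ → ℂ}, (∀ s, R ≤ |s| → HasDerivAt h (h' s) s ∧ ‖h' s‖ ≤ M * |s|) →
      ∀ s, R₁ ≤ s → ‖h s‖ ≤ (‖h R₁‖ + M) * (1 + s ^ 2) := by
    intro h h' hd s hs
    have hs0 : 0 < s := hR1.trans_le hs
    have h1 := norm_image_sub_le_of_norm_deriv_le_segment' (f := h) (f' := h') (a := R₁) (b := s)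
      (C := M * s)
      (fun x hx => ((hd x (by
        rw [abs_of_pos (hR1.trans_le hx.1)]; exact hR.trans hx.1)).1).hasDerivWithinAt)
      (fun x hx => by
        have hx0 : 0 < x := hR1.trans_le hx.1
        refine ((hd x (by rw [abs_of_pos hx0]; exact hR.trans hx.1)).2).trans ?_
        rw [abs_of_pos hx0]
        exact mul_le_mul_of_nonneg_left hx.2.le hM) s ⟨hs, le_rfl⟩
    have h2 : ‖h s‖ ≤ ‖h R₁‖ + ‖h s - h R₁‖ := by
      have := norm_add_le (h R₁) (h s - h R₁)
      rwa [add_sub_cancel] at this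
    have h3 : M * s * (s - R₁) ≤ M * s ^ 2 := by
      nlinarith [mul_nonneg (mul_nonneg hM hs0.le) hR1.le]
    nlinarith [norm_nonneg (h R₁), sq_nonneg s, mul_nonneg (norm_nonneg (h R₁)) (sq_nonneg s)]
  have hneg : ∀ s, R ≤ |s| → HasDerivAt (fun s => h (-s)) (-h' (-s)) s ∧ ‖-h' (-s)‖ ≤ M * |s| := by
    intro s hs
    obtain ⟨h1, h2⟩ := hd (-s) (by rwa [abs_neg])
    refine ⟨?_, by rwa [norm_neg, ← abs_neg]⟩
    have h3 := h1.scomp s (hasDerivAt_neg s)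
    rw [neg_one_smul] at h3
    exact h3
  refine ⟨‖h R₁‖ + ‖h (-R₁)‖ + M, R₁, fun s hs => ?_⟩
  have hsq := sq_nonneg s
  rcases abs_cases s with ⟨h1, -⟩ | ⟨h1, -⟩
  · have := key hd s (h1 ▸ hs)
    nlinarith [norm_nonneg (h (-R₁))]
  · have := key hneg (-s) (h1 ▸ hs)
    simp only [neg_neg, neg_sq] at this
    nlinarith [norm_nonneg (h R₁)]

end Estimates

/-! ### Singularities and growth of `ξ` and `y` along the path. -/

section AlongPath

variable {C : Type*} [TopologicalSpace C] [ChartedSpace ℂ C] [T2Space C] [CompactSpace C]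
  {ι : Type*} {g : ℕ} [IsManifold 𝓘(ℂ, ℂ) ω C] [ConnectedSpace C] {S : SpectralCurve C ι g}
  (D : SteepestDescent S)

namespace SteepestDescent

lemma continuousAt_branch {σ σ' : ι} {ξ : ℝ → ℂ} (hξ : D.IsBranch σ σ' ξ) {s₀ : ℝ}
    (h : D.γ σ s₀ ≠ S.α σ') : ContinuousAt ξ s₀ := by
  obtain ⟨F, hF, hξF⟩ := hξ s₀
  have h1 : ContinuousAt (fun s => F (D.γ σ s)) s₀ :=
    ContinuousAt.comp (hF.self_of_nhds h).1.continuousAt (D.γ_continuous σ).continuousAt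
  refine h1.congr ?_
  filter_upwards [hξF, (D.γ_continuous σ).continuousAt.eventually_ne h] with t ht ht'
  exact (ht ht').symm

/-- A branch of `ξ` has at most an inverse square root singularity, up to the factor of `dx`. -/
lemma exists_branch_bound {σ σ' : ι} {ξ : ℝ → ℂ} (hξ : D.IsBranch σ σ' ξ) (s₀ : ℝ) :
    ∃ M, ∀ᶠ s : ℝ in 𝓝[≠] s₀, ‖ξ s * (2 * s)‖ ≤ M * |s - s₀| ^ (-(1 / 2) : ℝ) := by
  by_cases hs₀ : D.γ σ s₀ = S.α σ'
  swap
  · have h1 : ContinuousAt (fun s : ℝ => ‖ξ s * (2 * s)‖) s₀ :=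
      ((D.continuousAt_branch hξ hs₀).mul (by fun_prop)).norm
    refine ⟨‖ξ s₀ * (2 * s₀)‖ + 1, ?_⟩
    filter_upwards [(h1.eventually_le_const (lt_add_one _)).filter_mono nhdsWithin_le_nhds,
      self_mem_nhdsWithin, (nhdsWithin_le_nhds (Metric.ball_mem_nhds s₀ one_pos))] with s h2 h3 h4
    refine h2.trans (le_mul_of_one_le_right (by positivity) ?_)
    have h5 : |s - s₀| < 1 := by simpa [dist_eq_norm] using h4
    have h6 : 0 < |s - s₀| := abs_pos.2 (sub_ne_zero.2 h3)
    exact Real.one_le_rpow_of_pos_of_le_one_of_nonpos h6 h5.le (by norm_num)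
  -- With `δ = ‖z - z₀‖`: `‖F‖ δ` is bounded since `F` has at most a simple pole, `‖X - X(α)‖ ≤ M₂
  -- δ²` since `dX` vanishes at `α`, and `m |s² - s₀²| ≤ ‖X - X(α)‖` along the path. Eliminating `δ`
  -- bounds `‖ξ‖² |s² - s₀²|`, and `s² ≤ K |s + s₀|` turns this into a bound of `‖2sξ‖² |s - s₀|`.
  · obtain ⟨F, hF, hξF⟩ := hξ s₀
    rw [hs₀] at hF
    set e := chartAt ℂ (S.α σ') with he
    have hea : e ∈ atlas ℂ C := chart_mem_atlas ℂ _
    have hps : S.α σ' ∈ e.source := mem_chart_source ℂ _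
    set z₀ := e (S.α σ')
    obtain ⟨h, hh, hdiag⟩ := S.bergman.diag_left (S.α σ')
    have hF' : ∀ᶠ p in 𝓝[≠] (S.α σ'), p ≠ S.α σ' ∧ MDifferentiableAt 𝓘(ℂ, ℂ) 𝓘(ℂ, ℂ) F p ∧
        diff F p = D.dξ σ' p (1 : ℂ) := by
      filter_upwards [hF.filter_mono nhdsWithin_le_nhds, self_mem_nhdsWithin] with p hp hne
      exact ⟨hne, (hp hne).1, (mfderiv_one_eq (hp hne).1).symm.trans ((hp hne).2 (1 : ℂ))⟩
    obtain ⟨M₁, hM₁, hb₁⟩ := exists_norm_mul_le_of_deriv (G := F ∘ e.symm) (z₀ := z₀)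
      (b := -(D.dζ σ')⁻¹) hh (by
      filter_upwards [(eventually_nhdsNE_chart hps).1 hF', hdiag,
        (e.open_target.eventually_mem (e.map_source hps)).filter_mono nhdsWithin_le_nhds]
        with z hz hz' hzt
      refine ⟨differentiableAt_comp_symm hea hzt hz.2.1, ?_⟩
      rw [deriv_comp_symm F hea hzt, ← hz', formCoeff, formCoeff, hz.2.2, D.dξ_one σ' hz.1]
      ring)
    have hXu : IsUnitAt S.X (S.α σ') := S.meroX.isUnitAt_of_ne_zero
      (by rw [← hs₀]; exact D.X_γ_ne_zero σ s₀)
    obtain ⟨M₂, hM₂, hb₂⟩ := exists_norm_sub_le_sq hXu.1 (by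
      have h1 : dlog S.X (S.α σ') = 0 := S.dlogX_alpha σ'
      rw [dlog, logDeriv_apply, div_eq_zero_iff] at h1
      exact h1.resolve_right (by simpa [mem_chart_source] using hXu.2))
    obtain ⟨m, hm, hb₃⟩ := exists_le_norm_exp_sub (D.a σ) s₀
    obtain ⟨K, hK, hb₄⟩ := exists_sq_le_mul_abs_add s₀
    have htend : Tendsto (D.γ σ) (𝓝[≠] s₀) (𝓝[≠] (S.α σ')) := by
      rw [← hs₀]
      exact tendsto_nhdsWithin_iff.2 ⟨(D.γ_continuous σ).continuousAt.tendsto.mono_left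
        nhdsWithin_le_nhds, eventually_nhdsWithin_of_forall fun s hs h => hs (D.γ_injective σ h)⟩
    have hb₁' : ∀ᶠ p in 𝓝[≠] (S.α σ'), ‖F p‖ * ‖e p - z₀‖ ≤ M₁ := by
      rw [eventually_nhdsNE_chart hps]
      filter_upwards [hb₁, (e.open_target.eventually_mem (e.map_source hps)).filter_mono
        nhdsWithin_le_nhds] with z hz hzt
      rwa [e.right_inv hzt]
    have hb₂' : ∀ᶠ p in 𝓝[≠] (S.α σ'), ‖S.X p - S.X (S.α σ')‖ ≤ M₂ * ‖e p - z₀‖ ^ 2 := by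
      rw [eventually_nhdsNE_chart hps]
      filter_upwards [hb₂.filter_mono nhdsWithin_le_nhds,
        (e.open_target.eventually_mem (e.map_source hps)).filter_mono nhdsWithin_le_nhds]
        with z hz hzt
      rw [e.right_inv hzt]
      simpa [e, mem_chart_source] using hz
    refine ⟨Real.sqrt (4 * K * (M₂ * M₁ ^ 2) / m), ?_⟩
    filter_upwards [htend.eventually hb₁', htend.eventually hb₂', htend.eventually hF',
      hb₃.filter_mono nhdsWithin_le_nhds, hb₄.filter_mono nhdsWithin_le_nhds,
      hξF.filter_mono nhdsWithin_le_nhds, self_mem_nhdsWithin] with s h1 h2 h3 h4 h5 h6 h7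
    have hd : 0 < |s - s₀| := abs_pos.2 (sub_ne_zero.2 h7)
    refine le_mul_rpow_neg_half hd (Real.sqrt_nonneg _) ?_
    rw [Real.sq_sqrt (by positivity), h6 h3.1, norm_mul, mul_pow]
    rw [← hs₀, D.x_γ, D.x_γ] at h2
    have h8 : ‖(2 * s : ℂ)‖ ^ 2 = 4 * s ^ 2 := by
      rw [← Complex.ofReal_ofNat, ← Complex.ofReal_mul, Complex.norm_real, Real.norm_eq_abs, sq_abs]
      ring
    have h9 : |s ^ 2 - s₀ ^ 2| = |s + s₀| * |s - s₀| := by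
      rw [← abs_mul]; congr 1; ring
    rw [h8, le_div_iff₀ hm]
    set N := ‖F (D.γ σ s)‖
    set δ := ‖e (D.γ σ s) - z₀‖
    have h10 : N ^ 2 * (m * (|s + s₀| * |s - s₀|)) ≤ N ^ 2 * (M₂ * δ ^ 2) := by
      rw [← h9]
      exact mul_le_mul_of_nonneg_left (h4.trans h2) (sq_nonneg _)
    have h11 : (N * δ) ^ 2 ≤ M₁ ^ 2 := pow_le_pow_left₀ (by positivity) h1 2
    calc N ^ 2 * (4 * s ^ 2) * |s - s₀| * m = 4 * (N ^ 2 * (m * |s - s₀|)) * s ^ 2 := by ring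
      _ ≤ 4 * (N ^ 2 * (m * |s - s₀|)) * (K * |s + s₀|) := by gcongr
      _ = 4 * K * (N ^ 2 * (m * (|s + s₀| * |s - s₀|))) := by ring
      _ ≤ 4 * K * (N ^ 2 * (M₂ * δ ^ 2)) := by gcongr
      _ = 4 * K * (M₂ * (N * δ) ^ 2) := by ring
      _ ≤ 4 * K * (M₂ * M₁ ^ 2) := by gcongr

lemma tendsto_X_γ (σ : ι) {ε : ℝ} (hε : 0 < ε) : ∃ R, ∀ s, R ≤ |s| → ‖S.X (D.γ σ s)‖ < ε := by
  have h1 : Tendsto (fun r : ℝ => Real.exp (-(D.a σ).re - r ^ 2)) atTop (𝓝 0) := by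
    refine Real.tendsto_exp_atBot.comp ?_
    exact tendsto_atBot_add_const_left _ _ (tendsto_neg_atTop_atBot.comp (tendsto_pow_atTop two_ne_zero))
  obtain ⟨R, hR⟩ := eventually_atTop.1 (h1.eventually_lt_const hε)
  refine ⟨R, fun s hs => ?_⟩
  have h2 := hR |s| hs
  rw [D.x_γ, Complex.norm_exp]
  rw [sq_abs] at h2
  have h3 : (-(D.a σ + (s : ℂ) ^ 2)).re = -(D.a σ).re - s ^ 2 := by
    rw [← Complex.ofReal_pow, Complex.neg_re, Complex.add_re, Complex.ofReal_re]
    ring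
  rwa [h3]

/-- A function on the curve which is bounded near the zeroes of `X` is bounded at the ends of the
steepest descent paths. -/
lemma exists_bound_γ (σ : ι) {ρ : C → ℂ}
    (h : ∀ q, S.X q = 0 → ∃ M, ∀ᶠ p in 𝓝[≠] q, ‖ρ p‖ ≤ M) :
    ∃ M R, ∀ s, R ≤ |s| → ‖ρ (D.γ σ s)‖ ≤ M := by
  -- If `X q ≠ 0`, the path is eventually outside a neighbourhood of `q`, because `X → 0` along it.
  -- A finite subcover then makes the bounds uniform.
  have hloc : ∀ q : C, ∃ M R, ∃ U ∈ 𝓝 q, ∀ s, R ≤ |s| → D.γ σ s ∈ U → ‖ρ (D.γ σ s)‖ ≤ M := by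
    intro q
    by_cases hq : S.X q = 0
    · obtain ⟨M, hM⟩ := h q hq
      refine ⟨M, 0, _, eventually_nhdsWithin_iff.1 hM, fun s _ hs => hs fun hcon => ?_⟩
      exact D.X_γ_ne_zero σ s (by rw [hcon, hq])
    · have hX := (S.meroX.isUnitAt_of_ne_zero hq).1.continuousAt
      have hnq : 0 < ‖S.X q‖ := norm_pos_iff.2 hq
      obtain ⟨R, hR⟩ := D.tendsto_X_γ σ (half_pos hnq)
      have h1 : ∀ᶠ p in 𝓝 q, ‖S.X q‖ / 2 < ‖S.X p‖ := by
        rw [eventually_nhds_chart (mem_chart_source ℂ q)]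
        refine hX.norm.eventually_const_lt ?_
        simp only [Function.comp_apply, (chartAt ℂ q).left_inv (mem_chart_source ℂ q)]
        linarith
      exact ⟨0, R, _, h1, fun s hs hs' => absurd (hR s hs) (not_lt.2 (le_of_lt hs'))⟩
  choose M R U hU hb using hloc
  obtain ⟨T, hT⟩ := CompactSpace.elim_nhds_subcover U hU
  refine ⟨∑ q ∈ T, |M q|, ∑ q ∈ T, |R q|, fun s hs => ?_⟩
  have hmem : D.γ σ s ∈ ⋃ q ∈ T, U q := by rw [hT]; trivial
  simp only [mem_iUnion] at hmem
  obtain ⟨q, hq, hqs⟩ := hmem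
  have h1 : |R q| ≤ ∑ q ∈ T, |R q| := Finset.single_le_sum (fun i _ => abs_nonneg (R i)) hq
  have h2 : |M q| ≤ ∑ q ∈ T, |M q| := Finset.single_le_sum (fun i _ => abs_nonneg (M i)) hq
  exact (hb q s ((le_abs_self _).trans (h1.trans hs)) hqs).trans ((le_abs_self _).trans h2)

lemma exists_notMem_range_of_le [Finite ι] (σ : ι) :
    ∃ R, ∀ s, R ≤ |s| → D.γ σ s ∉ range S.α := by
  obtain ⟨R, hR⟩ := (D.finite_γ_mem_range σ).isBounded.exists_norm_le
  refine ⟨R + 1, fun s hs hcon => ?_⟩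
  have := hR s hcon
  rw [Real.norm_eq_abs] at this
  linarith

lemma notMem_range_of_X_eq_zero (D : SteepestDescent S) {q : C} (hq : S.X q = 0) : q ∉ range S.α := by
  rintro ⟨σ, rfl⟩
  rw [← D.γ_zero σ] at hq
  exact D.X_γ_ne_zero σ 0 hq

/-- `dy/ds = 2s dy/dx`, and `dy/dx` is bounded at the ends of the path. -/
lemma exists_y_growth [Finite ι] (hpoles : ∀ p : C, ordDlog S.Y p < 0 → ordDlog S.X p < 0) (σ : ι) :
    ∃ K R, ∀ s, R ≤ |s| → ‖D.y σ s‖ ≤ K * (1 + s ^ 2) := by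
  obtain ⟨R₁, hR₁⟩ := D.exists_notMem_range_of_le σ
  obtain ⟨M, R₂, hM⟩ := D.exists_bound_γ σ (ρ := S.dydx) fun q hq => by
    obtain ⟨A, hA, hev⟩ := S.exists_dydx_extension hpoles σ (D.notMem_range_of_X_eq_zero hq)
    refine ⟨‖A (chartAt ℂ q q)‖ + 1, ?_⟩
    rw [eventually_nhdsNE_chart (mem_chart_source ℂ q)]
    filter_upwards [hev, (hA.continuousAt.norm.eventually_le_const
      (lt_add_one _)).filter_mono nhdsWithin_le_nhds] with z h1 h2
    rwa [h1]
  refine exists_growth_of_deriv (R := max R₁ R₂) (M := 2 * M)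
    fun s hs => ⟨D.hasDerivAt_y_of_notMem (hR₁ s ((le_max_left _ _).trans hs)), ?_⟩
  have h1 := hM s ((le_max_right _ _).trans hs)
  rw [norm_mul, norm_mul, Complex.norm_real, Real.norm_eq_abs, Complex.norm_two]
  nlinarith [abs_nonneg s]

/-- Where `X` takes the value `0`, `dX/X` has a pole and `dξ` is holomorphic, so `dξ/dx` is bounded;
hence `dξ/ds = O(s)`. -/
lemma exists_branch_growth [Finite ι] {σ σ' : ι} {ξ : ℝ → ℂ} (hξ : D.IsBranch σ σ' ξ) :
    ∃ K R, ∀ s, R ≤ |s| → ‖ξ s‖ ≤ K * (1 + s ^ 2) := by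
  obtain ⟨R₁, hR₁⟩ := D.exists_notMem_range_of_le σ
  obtain ⟨M, R₂, hM⟩ := D.exists_bound_γ σ
    (ρ := fun p => D.dξ σ' p (1 : ℂ) / dlog S.X p) fun q hq => by
    have hqα : q ≠ S.α σ' := fun h => D.notMem_range_of_X_eq_zero hq ⟨σ', h.symm⟩
    have hB := S.bergman.analyticAt_left hqα
    have hX : Tendsto (logDeriv (S.X ∘ (chartAt ℂ q).symm)) (𝓝[≠] (chartAt ℂ q q))
        (Bornology.cobounded ℂ) := by
      refine tendsto_cobounded_of_meromorphicOrderAt_neg ?_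
      change ordDlog S.X q < 0
      rw [ordDlog_eq_neg_one_of_eq_zero S.meroX (S.ordDlogX_ne_top σ q) hq]
      decide
    have hne : ∀ᶠ p in 𝓝[≠] q, p ≠ S.α σ' :=
      nhdsWithin_le_nhds (isOpen_ne.mem_nhds hqα)
    refine ⟨(‖formCoeff (fun r => S.B.val r (S.α σ')) (chartAt ℂ q) (chartAt ℂ q q)‖ + 1) *
      ‖(D.dζ σ')⁻¹‖, ?_⟩
    rw [eventually_nhdsNE_chart (mem_chart_source ℂ q)] at hne ⊢
    filter_upwards [hne, (hB.continuousAt.norm.eventually_le_const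
      (lt_add_one _)).filter_mono nhdsWithin_le_nhds,
      (tendsto_norm_cobounded_atTop.comp hX).eventually_ge_atTop 1,
      (eventuallyEq_logDeriv S.X q).filter_mono nhdsWithin_le_nhds,
      (eventually_chartJac_ne_zero q).filter_mono nhdsWithin_le_nhds] with z h1 h2 h3 h4 h5
    have h6 : D.dξ σ' ((chartAt ℂ q).symm z) (1 : ℂ) / dlog S.X ((chartAt ℂ q).symm z) =
        -(formCoeff (fun r => S.B.val r (S.α σ')) (chartAt ℂ q) z * (D.dζ σ')⁻¹ /
          logDeriv (S.X ∘ (chartAt ℂ q).symm) z) := by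
      rw [h4, D.dξ_one σ' h1, formCoeff, formCoeff]
      rw [mul_right_comm, mul_div_mul_right _ _ h5, neg_div, div_eq_mul_inv (S.B.val _ _)]
    rw [h6, norm_neg, norm_div, norm_mul]
    have h3' : 1 ≤ ‖logDeriv (S.X ∘ (chartAt ℂ q).symm) z‖ := h3
    refine (div_le_self (by positivity) h3').trans ?_
    gcongr
  refine exists_growth_of_deriv (R := max R₁ R₂) (M := 2 * M)
    fun s hs => ⟨D.hasDerivAt_branch hξ (hR₁ s ((le_max_left _ _).trans hs)), ?_⟩
  have h1 := hM s ((le_max_right _ _).trans hs)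
  rw [norm_mul, norm_neg, norm_mul, Complex.norm_real, Real.norm_eq_abs, Complex.norm_two]
  nlinarith [abs_nonneg s]

end SteepestDescent

end AlongPath

open MeasureTheory

/-! ### Gaussian integrals and Watson's lemma. -/

section GaussianIntegrals

lemma locallyIntegrable_of_rpow_bound {h : ℝ → ℂ} (hm : AEStronglyMeasurable h)
    (hb : ∀ s₀, ∃ M, ∀ᶠ s : ℝ in 𝓝[≠] s₀, ‖h s‖ ≤ M * |s - s₀| ^ (-(1 / 2) : ℝ)) :
    LocallyIntegrable h := by
  intro s₀
  obtain ⟨M, hM⟩ := hb s₀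
  obtain ⟨ε, hε, hball⟩ := Metric.eventually_nhds_iff_ball.1 (eventually_nhdsWithin_iff.1 hM)
  refine ⟨Metric.ball s₀ ε, Metric.ball_mem_nhds s₀ hε, ?_⟩
  have h1 : IntervalIntegrable (fun s : ℝ => |s| ^ (-(1 / 2) : ℝ)) volume (-ε) ε := by
    refine intervalIntegrable_of_even (fun x => by simp only [abs_neg]) fun x hx => ?_
    refine (intervalIntegral.intervalIntegrable_rpow' (r := -(1 / 2)) (by norm_num)).congr ?_
    intro y hy
    rw [uIoc_of_le hx.le] at hy
    simp only [abs_of_pos hy.1]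
  have h2 := h1.comp_sub_right s₀
  rw [intervalIntegrable_iff, uIoc_of_le (by linarith)] at h2
  have h3 : IntegrableOn (fun s : ℝ => M * |s - s₀| ^ (-(1 / 2) : ℝ)) (Metric.ball s₀ ε) := by
    refine IntegrableOn.mono_set (Integrable.const_mul h2 M) ?_
    rw [Real.ball_eq_Ioo]
    intro x hx
    exact ⟨by linarith [hx.1], by linarith [hx.2]⟩
  refine Integrable.mono' h3 hm.restrict ?_
  have h4 : ∀ᵐ s : ℝ, s ≠ s₀ := by simp [ae_iff]
  filter_upwards [ae_restrict_of_ae h4, ae_restrict_mem measurableSet_ball] with s hs hsb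
  exact hball s hsb hs

lemma integrable_pow_mul_exp_neg_mul_sq {c : ℝ} (hc : 0 < c) (n : ℕ) :
    Integrable fun s : ℝ => s ^ n * Real.exp (-c * s ^ 2) := by
  simpa only [Real.rpow_natCast] using
    integrable_rpow_mul_exp_neg_mul_sq hc (s := n) (by have := n.cast_nonneg (α := ℝ); linarith)

lemma integrable_sq_mul_exp_neg_mul_sq {c : ℝ} (hc : 0 < c) :
    Integrable fun s : ℝ => (1 + s ^ 2) ^ 2 * Real.exp (-c * s ^ 2) := by
  refine (((integrable_pow_mul_exp_neg_mul_sq hc 0).add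
    ((integrable_pow_mul_exp_neg_mul_sq hc 2).const_mul 2)).add
    (integrable_pow_mul_exp_neg_mul_sq hc 4)).congr (Eventually.of_forall fun s => ?_)
  simp only [Pi.add_apply]
  ring

lemma norm_exp_neg_mul_add_sq (u a : ℂ) (s : ℝ) :
    ‖Complex.exp (-u * (a + (s : ℂ) ^ 2))‖ = Real.exp (-(u * a).re) * Real.exp (-u.re * s ^ 2) := by
  rw [Complex.norm_exp, ← Real.exp_add, mul_add, neg_mul, ← Complex.ofReal_pow, Complex.add_re,
    Complex.re_mul_ofReal, Complex.neg_re, Complex.neg_re]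

/-- The exponent `2` leaves room for the factor `2s` of `dx` on top of quadratic growth. -/
lemma integrable_exp_mul_of_growth {h : ℝ → ℂ} (hloc : LocallyIntegrable h) {K R : ℝ}
    (hg : ∀ s, R ≤ |s| → ‖h s‖ ≤ K * (1 + s ^ 2) ^ 2) {u : ℂ} (hu : 0 < u.re) (a : ℂ) :
    Integrable fun s : ℝ => Complex.exp (-u * (a + (s : ℂ) ^ 2)) * h s := by
  have hloc' : LocallyIntegrable fun s : ℝ => Complex.exp (-u * (a + (s : ℂ) ^ 2)) * h s := by
    rw [← locallyIntegrableOn_univ] at hloc ⊢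
    exact hloc.continuousOn_mul (by fun_prop) isOpen_univ.isLocallyClosed
  have hO : ∀ s, R ≤ |s| → ‖Complex.exp (-u * (a + (s : ℂ) ^ 2)) * h s‖ ≤
      (Real.exp (-(u * a).re) * K) * ‖(1 + s ^ 2) ^ 2 * Real.exp (-u.re * s ^ 2)‖ := by
    intro s hs
    rw [norm_mul, norm_exp_neg_mul_add_sq, Real.norm_of_nonneg (by positivity)]
    calc _ ≤ Real.exp (-(u * a).re) * Real.exp (-u.re * s ^ 2) * (K * (1 + s ^ 2) ^ 2) := by
          gcongr; exact hg s hs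
      _ = _ := by ring
  have hint := integrable_sq_mul_exp_neg_mul_sq hu
  refine hloc'.integrable_of_isBigO_atBot_atTop
    (g := fun s : ℝ => (1 + s ^ 2) ^ 2 * Real.exp (-u.re * s ^ 2))
    (g' := fun s : ℝ => (1 + s ^ 2) ^ 2 * Real.exp (-u.re * s ^ 2)) ?_
    (hint.integrableAtFilter _) ?_ (hint.integrableAtFilter _)
  · exact .of_bound _ ((tendsto_abs_atBot_atTop.eventually_ge_atTop R).mono hO)
  · exact .of_bound _ ((tendsto_abs_atTop_atTop.eventually_ge_atTop R).mono hO)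

lemma tendsto_exp_mul_of_growth {h : ℝ → ℂ} {K R : ℝ}
    (hg : ∀ s, R ≤ |s| → ‖h s‖ ≤ K * (1 + s ^ 2)) {u : ℂ} (hu : 0 < u.re) (a : ℂ) {l : Filter ℝ}
    (hl : Tendsto (fun s : ℝ => |s|) l atTop) :
    Tendsto (fun s : ℝ => Complex.exp (-u * (a + (s : ℂ) ^ 2)) * h s) l (𝓝 0) := by
  have h1 : Tendsto (fun x : ℝ => Real.exp (-(u * a).re) * K *
      (x ^ 0 * Real.exp (-x) + u.re⁻¹ * (x ^ 1 * Real.exp (-x)))) atTop (𝓝 0) := by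
    have := ((Real.tendsto_pow_mul_exp_neg_atTop_nhds_zero 0).add
      ((Real.tendsto_pow_mul_exp_neg_atTop_nhds_zero 1).const_mul u.re⁻¹)).const_mul
        (Real.exp (-(u * a).re) * K)
    simpa only [mul_zero, add_zero] using this
  have h2 : Tendsto (fun s : ℝ => u.re * |s| ^ 2) l atTop :=
    ((tendsto_pow_atTop two_ne_zero).comp hl).const_mul_atTop hu
  refine squeeze_zero_norm' ?_ (h1.comp h2)
  filter_upwards [hl.eventually_ge_atTop R] with s hs
  rw [norm_mul, norm_exp_neg_mul_add_sq]
  simp only [Function.comp_apply, sq_abs]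
  calc _ ≤ Real.exp (-(u * a).re) * Real.exp (-u.re * s ^ 2) * (K * (1 + s ^ 2)) := by
          gcongr; exact hg s hs
    _ = _ := by
      rw [neg_mul]
      field_simp

lemma integral_sq_mul_exp_neg_sq :
    ∫ s : ℝ, s ^ 2 * Real.exp (-s ^ 2) = Real.sqrt Real.pi / 2 := by
  have h0 := integrable_pow_mul_exp_neg_mul_sq one_pos 0
  have h1 := integrable_pow_mul_exp_neg_mul_sq one_pos 1
  have h2 := integrable_pow_mul_exp_neg_mul_sq one_pos 2
  -- The derivative of `s e^{-s²}` is `e^{-s²} - 2 s² e^{-s²}`.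
  have key := integral_eq_zero_of_hasDerivAt_of_integrable
    (f := fun s : ℝ => s ^ 1 * Real.exp (-1 * s ^ 2))
    (f' := fun s : ℝ => s ^ 0 * Real.exp (-1 * s ^ 2) - 2 * (s ^ 2 * Real.exp (-1 * s ^ 2)))
    (fun s => by
      have e1 : HasDerivAt (fun s : ℝ => Real.exp (-1 * s ^ 2))
        (Real.exp (-1 * s ^ 2) * (-1 * (((2 : ℕ) : ℝ) * s ^ (2 - 1)))) s :=
        ((hasDerivAt_pow 2 s).const_mul (-1)).exp
      refine ((hasDerivAt_pow 1 s).fun_mul e1).congr_deriv ?_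
      norm_num
      ring) (h0.sub (h2.const_mul 2)) h1
  rw [integral_sub h0 (h2.const_mul 2), integral_const_mul] at key
  simp only [pow_zero, one_mul] at key
  rw [integral_gaussian, div_one] at key
  simp only [neg_mul, one_mul] at key
  linarith

/-- An even integrand computes the integral over the line. -/
lemma integral_eq_half_symm {F : ℝ → ℂ} (hF : Integrable F) :
    ∫ s, F s = 2⁻¹ * ∫ s, (F s + F (-s)) := by
  rw [integral_add hF hF.comp_neg, integral_neg_eq_self]
  ring

lemma integral_exp_mul_odd_eq_zero (u a : ℂ) :
    ∫ s : ℝ, Complex.exp (-u * (a + (s : ℂ) ^ 2)) * (2 * s) = 0 := by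
  have h1 := integral_neg_eq_self
    (fun s : ℝ => Complex.exp (-u * (a + (s : ℂ) ^ 2)) * (2 * (s : ℂ))) volume
  simp only [Complex.ofReal_neg, neg_sq, mul_neg, integral_neg] at h1
  exact self_eq_neg.1 h1.symm

/-- Watson's lemma at leading order. -/
lemma tendsto_integral_exp_neg_mul_sq {y : ℝ → ℂ} (hy : Continuous y) {K R : ℝ}
    (hg : ∀ s, R ≤ |s| → ‖y s‖ ≤ K * (1 + s ^ 2)) {T : ℂ}
    (hT : Tendsto (fun s : ℝ => (y s - y (-s)) / (s : ℂ)) (𝓝[≠] 0) (𝓝 T)) :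
    Tendsto (fun u : ℝ => (u : ℂ) ^ (3 / 2 : ℂ) *
      ∫ s : ℝ, Complex.exp (-u * (s : ℂ) ^ 2) * y s * (2 * s)) atTop
      (𝓝 (T * (Real.sqrt Real.pi / 2 : ℝ))) := by
  classical
  -- The weight `2s e^{-us²}` is odd, so `y` enters only through `y s - y (-s) = s h(s)`, with `h`
  -- continuous and `h 0 = T`.
  set h : ℝ → ℂ := Function.update (fun s : ℝ => (y s - y (-s)) / (s : ℂ)) 0 T with hh
  have h_ne : ∀ s, s ≠ 0 → h s = (y s - y (-s)) / (s : ℂ) :=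
    fun s hs => Function.update_of_ne hs _ _
  have h_mul : ∀ s : ℝ, h s * s = y s - y (-s) := by
    intro s
    rcases eq_or_ne s 0 with rfl | hs
    · simp
    · rw [h_ne s hs, div_mul_cancel₀ _ (by exact_mod_cast hs)]
  have hcont : Continuous h := by
    rw [continuous_iff_continuousAt]
    intro s
    rcases eq_or_ne s 0 with rfl | hs
    · exact continuousAt_update_same.2 hT
    · refine ContinuousAt.congr (f := fun s : ℝ => (y s - y (-s)) / (s : ℂ)) ?_ ?_
      · have : (s : ℂ) ≠ 0 := by exact_mod_cast hs
        exact ContinuousAt.div (by fun_prop) (by fun_prop) this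
      · filter_upwards [isOpen_ne.mem_nhds hs] with r hr using (h_ne r hr).symm
  obtain ⟨L, hL⟩ := (isCompact_Icc (a := -max R 1) (b := max R 1)).exists_bound_of_continuousOn
    hcont.continuousOn
  have hbound : ∀ s, ‖h s‖ ≤ (|L| + 2 * |K|) * (1 + s ^ 2) := by
    intro s
    rcases le_or_gt |s| (max R 1) with hs | hs
    · have := hL s (abs_le.1 hs)
      nlinarith [le_abs_self L, abs_nonneg K, abs_nonneg L, sq_nonneg s,
        mul_nonneg (abs_nonneg L) (sq_nonneg s), mul_nonneg (abs_nonneg K) (sq_nonneg s)]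
    · have hs1 : 1 ≤ |s| := (le_max_right _ _).trans hs.le
      have hsR : R ≤ |s| := (le_max_left _ _).trans hs.le
      have hs0 : s ≠ 0 := by rintro rfl; norm_num at hs1
      rw [h_ne s hs0, norm_div, Complex.norm_real, Real.norm_eq_abs]
      refine (div_le_self (norm_nonneg _) hs1).trans ((norm_sub_le _ _).trans ?_)
      have e1 := hg s hsR
      have e2 := hg (-s) (by rwa [abs_neg])
      rw [neg_sq] at e2
      nlinarith [le_abs_self K, abs_nonneg L, sq_nonneg s, mul_nonneg (abs_nonneg L) (sq_nonneg s),
        mul_nonneg (sub_nonneg.2 (le_abs_self K)) (sq_nonneg s)]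
  set A := |L| + 2 * |K|
  have hA : 0 ≤ A := by positivity
  -- This is the integral after the substitution `s = v / √u`, which produces the power `u^{-3/2}`;
  -- the domination uses `u ≥ 1`.
  have hlim : Tendsto (fun u : ℝ => ∫ v : ℝ, ((v ^ 2 * Real.exp (-v ^ 2) : ℝ) : ℂ) *
      h (v / Real.sqrt u)) atTop (𝓝 (∫ v : ℝ, ((v ^ 2 * Real.exp (-v ^ 2) : ℝ) : ℂ) * T)) := by
    refine tendsto_integral_filter_of_dominated_convergence
      (fun v => A * ((1 + v ^ 2) ^ 2 * Real.exp (-1 * v ^ 2))) ?_ ?_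
      ((integrable_sq_mul_exp_neg_mul_sq one_pos).const_mul A) ?_
    · filter_upwards with u
      have : Continuous fun v : ℝ => h (v / Real.sqrt u) := hcont.comp (by fun_prop)
      exact Continuous.aestronglyMeasurable (by fun_prop)
    · filter_upwards [eventually_ge_atTop 1] with u hu
      filter_upwards with v
      rw [norm_mul, Complex.norm_real, Real.norm_of_nonneg (by positivity)]
      have e1 : (v / Real.sqrt u) ^ 2 ≤ v ^ 2 := by
        rw [div_pow, Real.sq_sqrt (by linarith)]
        exact div_le_self (sq_nonneg _) hu
      have e2 : ‖h (v / Real.sqrt u)‖ ≤ A * (1 + v ^ 2) := (hbound _).trans (by gcongr)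
      calc _ ≤ (v ^ 2 * Real.exp (-v ^ 2)) * (A * (1 + v ^ 2)) := by gcongr
        _ ≤ ((1 + v ^ 2) * Real.exp (-v ^ 2)) * (A * (1 + v ^ 2)) := by gcongr; linarith
        _ = _ := by rw [neg_one_mul]; ring
    · filter_upwards with v
      refine tendsto_const_nhds.mul ?_
      have e1 : Tendsto (fun u : ℝ => v / Real.sqrt u) atTop (𝓝 0) :=
        tendsto_const_nhds.div_atTop Real.tendsto_sqrt_atTop
      have e2 := (hcont.tendsto 0).comp e1
      rwa [hh, Function.update_self, ← hh] at e2
  rw [integral_mul_const, integral_complex_ofReal, integral_sq_mul_exp_neg_sq, mul_comm] at hlim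
  refine hlim.congr' ?_
  filter_upwards [eventually_gt_atTop 0] with u hu
  have hu' : (u : ℂ) ≠ 0 := by exact_mod_cast hu.ne'
  have hsq : Real.sqrt u ≠ 0 := (Real.sqrt_pos.2 hu).ne'
  have hF : Integrable fun s : ℝ => Complex.exp (-u * (s : ℂ) ^ 2) * y s * (2 * s) := by
    have hc : Continuous fun s : ℝ => y s * (2 * (s : ℂ)) := by fun_prop
    have := integrable_exp_mul_of_growth hc.locallyIntegrable (K := |K|) (R := R) (fun s hs => by
      rw [norm_mul, norm_mul, Complex.norm_real, Complex.norm_two, Real.norm_eq_abs]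
      have e1 : 2 * |s| ≤ 1 + s ^ 2 := by nlinarith [sq_nonneg (|s| - 1), sq_abs s]
      calc ‖y s‖ * (2 * |s|) ≤ (|K| * (1 + s ^ 2)) * (1 + s ^ 2) := by
            gcongr
            exact (hg s hs).trans (by gcongr; exact le_abs_self K)
        _ = _ := by ring) (u := u) (by simpa using hu) 0
    simpa only [zero_add, mul_assoc] using this
  rw [integral_eq_half_symm hF]
  have e1 : ∀ s : ℝ, Complex.exp (-u * (s : ℂ) ^ 2) * y s * (2 * s) +
      Complex.exp (-u * ((-s : ℝ) : ℂ) ^ 2) * y (-s) * (2 * (-s : ℝ)) =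
      2 * (Complex.exp (-u * (s : ℂ) ^ 2) * (s : ℂ) ^ 2 * h s) := by
    intro s
    rw [Complex.ofReal_neg, neg_sq]
    linear_combination (-2 * Complex.exp (-u * (s : ℂ) ^ 2) * s) * h_mul s
  simp only [e1, integral_const_mul]
  have e2 := Measure.integral_comp_div
    (fun s : ℝ => Complex.exp (-u * (s : ℂ) ^ 2) * (s : ℂ) ^ 2 * h s) (Real.sqrt u)
  have e3 : ∀ v : ℝ, ((v / Real.sqrt u : ℝ) : ℂ) ^ 2 = (u : ℂ)⁻¹ * (v : ℂ) ^ 2 := by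
    intro v
    rw [← Complex.ofReal_pow, div_pow, Real.sq_sqrt hu.le]
    push_cast
    field_simp
  have e4 : (fun v : ℝ => Complex.exp (-u * ((v / Real.sqrt u : ℝ) : ℂ) ^ 2) *
      ((v / Real.sqrt u : ℝ) : ℂ) ^ 2 * h (v / Real.sqrt u)) = fun v : ℝ =>
      (u : ℂ)⁻¹ * (((v ^ 2 * Real.exp (-v ^ 2) : ℝ) : ℂ) * h (v / Real.sqrt u)) := by
    ext v
    rw [e3, ← mul_assoc (-(u : ℂ)), neg_mul, mul_inv_cancel₀ hu', neg_one_mul]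
    push_cast
    ring
  rw [e4, integral_const_mul, abs_of_nonneg (Real.sqrt_nonneg u), inv_mul_eq_iff_eq_mul₀ hu',
    Complex.real_smul] at e2
  rw [e2, show (3 / 2 : ℂ) = 1 + ((1 / 2 : ℝ) : ℂ) by push_cast; norm_num,
    Complex.cpow_add _ _ hu', Complex.cpow_one, ← Complex.ofReal_cpow hu.le,
    ← Real.sqrt_eq_rpow]
  ring

end GaussianIntegrals

/-! ### Laplace transforms along the steepest descent path. -/

section LaplaceTransforms

variable {C : Type*} [TopologicalSpace C] [ChartedSpace ℂ C] [T2Space C] [CompactSpace C]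
  {ι : Type*} {g : ℕ} [IsManifold 𝓘(ℂ, ℂ) ω C] [ConnectedSpace C] {S : SpectralCurve C ι g}
  (D : SteepestDescent S)

lemma mul_growth {h : ℝ → ℂ} {K R : ℝ} (hg : ∀ s, R ≤ |s| → ‖h s‖ ≤ K * (1 + s ^ 2)) (s : ℝ)
    (hs : R ≤ |s|) : ‖h s * (2 * s)‖ ≤ |K| * (1 + s ^ 2) ^ 2 := by
  rw [norm_mul, norm_mul, Complex.norm_real, Complex.norm_two, Real.norm_eq_abs]
  have e1 : 2 * |s| ≤ 1 + s ^ 2 := by nlinarith [sq_nonneg (|s| - 1), sq_abs s]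
  calc ‖h s‖ * (2 * |s|) ≤ (|K| * (1 + s ^ 2)) * (1 + s ^ 2) := by
        gcongr
        exact (hg s hs).trans (by gcongr; exact le_abs_self K)
    _ = _ := by ring

namespace SteepestDescent

lemma integrable_integrand_y [Finite ι]
    (hpoles : ∀ p : C, ordDlog S.Y p < 0 → ordDlog S.X p < 0) (σ : ι) {u : ℂ} (hu : 0 < u.re) :
    Integrable (D.integrand σ (D.y σ) u) := by
  obtain ⟨K, R, hK⟩ := D.exists_y_growth hpoles σ
  have hy := D.y_continuous σ
  have hc : Continuous fun s : ℝ => D.y σ s * (2 * (s : ℂ)) := by fun_prop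
  have h1 := integrable_exp_mul_of_growth hc.locallyIntegrable (mul_growth hK) hu (D.a σ)
  exact h1.congr (Eventually.of_forall fun s => (mul_assoc _ _ _).symm)

lemma integrable_integrand_branch [Finite ι] {σ σ' : ι} {ξ : ℝ → ℂ} (hξ : D.IsBranch σ σ' ξ)
    {u : ℂ} (hu : 0 < u.re) : Integrable (D.integrand σ ξ u) := by
  obtain ⟨K, R, hK⟩ := D.exists_branch_growth hξ
  have hm : AEStronglyMeasurable (fun s : ℝ => ξ s * (2 * (s : ℂ))) := by
    -- `ξ` is unconstrained where the path is at `α σ'`; by injectivity this is at most one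
    -- parameter, a null set.
    set N : Set ℝ := {s | D.γ σ s = S.α σ'} with hN
    have hNc : IsClosed N := isClosed_singleton.preimage (D.γ_continuous σ)
    have hNf : N.Subsingleton := fun s hs s' hs' => D.γ_injective σ (hs.trans hs'.symm)
    have h1 : ContinuousOn (fun s : ℝ => ξ s * (2 * (s : ℂ))) Nᶜ := fun s hs =>
      ((D.continuousAt_branch hξ hs).mul (by fun_prop)).continuousWithinAt
    have h2 := h1.aestronglyMeasurable (μ := volume) hNc.isOpen_compl.measurableSet
    rwa [Measure.restrict_eq_self_of_ae_mem] at h2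
    exact compl_mem_ae_iff.2 (hNf.countable.measure_zero _)
  have h1 := integrable_exp_mul_of_growth
    (locallyIntegrable_of_rpow_bound hm (D.exists_branch_bound hξ)) (mul_growth hK) hu (D.a σ)
  exact h1.congr (Eventually.of_forall fun s => (mul_assoc _ _ _).symm)

/-- Integration by parts, for the Laplace transform of `y dx`. -/
lemma mul_laplace_y [Finite ι]
    (hpoles : ∀ p : C, ordDlog S.Y p < 0 → ordDlog S.X p < 0) (σ : ι) {u : ℂ} (hu : 0 < u.re)
    (hint : Integrable (D.integrand σ (fun s => S.dydx (D.γ σ s)) u)) :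
    u * D.laplace σ (D.y σ) u = D.laplace σ (fun s => S.dydx (D.γ σ s)) u := by
  obtain ⟨K, R, hK⟩ := D.exists_y_growth hpoles σ
  have hy := D.y_continuous σ
  have hinty := D.integrable_integrand_y hpoles σ hu
  set G : ℝ → ℂ := fun s => Complex.exp (-u * (D.a σ + (s : ℂ) ^ 2)) * D.y σ s with hG
  set G' : ℝ → ℂ := fun s => D.integrand σ (fun s => S.dydx (D.γ σ s)) u s -
    u * D.integrand σ (D.y σ) u s with hG'
  have hGc : Continuous G := by fun_prop
  have hG'int : Integrable G' := hint.sub (hinty.const_mul u)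
  have hderiv : ∀ s, D.γ σ s ∉ range S.α → HasDerivAt G (G' s) s := by
    intro s hs
    have h1 : HasDerivAt (fun s : ℝ => (s : ℂ) ^ 2) (2 * s) s := by
      refine ((Complex.ofRealCLM.hasDerivAt (x := s)).fun_pow 2).congr_deriv ?_
      simp
    have h2 := ((h1.const_add (D.a σ)).const_mul (-u)).cexp.mul (D.hasDerivAt_y_of_notMem hs)
    refine h2.congr_deriv ?_
    simp only [hG', integrand]
    ring
  -- The derivative formula may fail at the finitely many parameters where the path meets a
  -- branchpoint; continuity of `G` there suffices.
  have hFTC : ∀ n : ℕ, ∫ s in (-(n : ℝ))..n, G' s = G n - G (-n) := fun n =>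
    MeasureTheory.integral_eq_of_hasDerivAt_off_countable G G'
      (D.finite_γ_mem_range σ).countable hGc.continuousOn (fun s hs => hderiv s hs.2)
      hG'int.intervalIntegrable
  have hn : Tendsto (fun n : ℕ => (n : ℝ)) atTop atTop := tendsto_natCast_atTop_atTop
  have hlim := intervalIntegral_tendsto_integral hG'int (tendsto_neg_atTop_atBot.comp hn) hn
  have hlim0 : Tendsto (fun n : ℕ => G n - G (-n)) atTop (𝓝 (0 - 0)) :=
    ((tendsto_exp_mul_of_growth hK hu (D.a σ) tendsto_abs_atTop_atTop).comp hn).sub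
      ((tendsto_exp_mul_of_growth hK hu (D.a σ) tendsto_abs_atBot_atTop).comp
        (tendsto_neg_atTop_atBot.comp hn))
  have hzero := tendsto_nhds_unique (hlim.congr hFTC) hlim0
  rw [sub_zero, hG', integral_sub hint (hinty.const_mul u), integral_const_mul, sub_eq_zero] at hzero
  exact hzero.symm

/-- Almost everywhere `dy/dx` is a combination of the `ξ σ'` and a constant. This yields the
integrability needed for the integration by parts as well as the value of the integral, to which the
constant contributes nothing by oddness. -/
lemma laplaceY_eq_sum [Fintype ι] {t : ι → ℂ} (ht : ∀ σ, D.IsTimeZero σ (t σ))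
    (hpoles : ∀ p : C, ordDlog S.Y p < 0 → ordDlog S.X p < 0) (σ : ι) {ξ : ι → ℝ → ℂ}
    (hξ : ∀ σ', D.IsBranch σ σ' (ξ σ')) {u : ℂ} (hu : 0 < u.re) :
    D.laplaceY σ u = ∑ σ', Complex.exp (-t σ') * D.f σ (ξ σ') u := by
  obtain ⟨c, hc⟩ := D.exists_sum_branch_eq ht hpoles σ hξ
  have hintξ := fun σ' => D.integrable_integrand_branch (hξ σ') hu
  have hint1 : Integrable fun s : ℝ =>
      Complex.exp (-u * (D.a σ + (s : ℂ) ^ 2)) * (2 * (s : ℂ)) := by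
    have h1 : Continuous fun s : ℝ => (2 * (s : ℂ)) := by fun_prop
    refine integrable_exp_mul_of_growth h1.locallyIntegrable (K := |1|) (R := 0) (fun s hs => ?_)
      hu (D.a σ)
    simpa using mul_growth (h := fun _ => 1) (K := 1) (R := 0)
      (fun s _ => by simpa using sq_nonneg s) s hs
  set Q : ℝ → ℂ := fun s => (1 / 4 : ℂ) * (∑ σ', Complex.exp (-t σ') * D.integrand σ (ξ σ') u s -
    c * (Complex.exp (-u * (D.a σ + (s : ℂ) ^ 2)) * (2 * (s : ℂ)))) with hQ
  have hQint : Integrable Q :=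
    ((integrable_finsetSum _ fun σ' _ => (hintξ σ').const_mul _).sub
      (hint1.const_mul c)).const_mul _
  have hae : Q =ᵐ[volume] D.integrand σ (fun s => S.dydx (D.γ σ s)) u := by
    filter_upwards [compl_mem_ae_iff.2 ((D.finite_γ_mem_range σ).measure_zero volume)] with s hs
    have h1 := hc s hs
    have h2 : ∑ σ', Complex.exp (-t σ') * D.integrand σ (ξ σ') u s =
        Complex.exp (-u * (D.a σ + (s : ℂ) ^ 2)) * (2 * s) *
          ∑ σ', Complex.exp (-t σ') * ξ σ' s := by
      rw [Finset.mul_sum]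
      refine Finset.sum_congr rfl fun σ' _ => ?_
      rw [integrand]; ring
    simp only [hQ]
    rw [h2, h1, integrand]
    ring
  have hparts := D.mul_laplace_y hpoles σ hu (hQint.congr hae)
  have hval : D.laplace σ (fun s => S.dydx (D.γ σ s)) u =
      (1 / 4) * ∑ σ', Complex.exp (-t σ') * D.laplace σ (ξ σ') u := by
    rw [laplace, ← integral_congr_ae hae, hQ, integral_const_mul,
      integral_sub (integrable_finsetSum _ fun σ' _ => (hintξ σ').const_mul _)
        (hint1.const_mul c), integral_const_mul, integral_exp_mul_odd_eq_zero, mul_zero, sub_zero,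
      integral_finsetSum _ fun σ' _ => (hintξ σ').const_mul _]
    simp only [integral_const_mul, laplace]
  rw [hval] at hparts
  have hu0 : u ≠ 0 := by rintro rfl; simp at hu
  -- One factor `u` of `u^{3/2}` is consumed by the integration by parts, and `2 · 1/4 = 1/2`
  -- matches the prefactor of `f`.
  rw [laplaceY, show (3 / 2 : ℂ) = 1 / 2 + 1 by norm_num, Complex.cpow_add _ _ hu0,
    Complex.cpow_one]
  have h3 : ∑ σ', Complex.exp (-t σ') * D.f σ (ξ σ') u =
      u ^ (1 / 2 : ℂ) / (2 * (Real.sqrt Real.pi : ℂ)) * Complex.exp (u * D.a σ) *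
        ∑ σ', Complex.exp (-t σ') * D.laplace σ (ξ σ') u := by
    rw [Finset.mul_sum]
    refine Finset.sum_congr rfl fun σ' _ => ?_
    rw [f]; ring
  rw [h3]
  linear_combination (2 * u ^ (1 / 2 : ℂ) * Complex.exp (u * D.a σ) /
    (Real.sqrt Real.pi : ℂ)) * hparts

lemma tendsto_laplaceY [Finite ι]
    (hpoles : ∀ p : C, ordDlog S.Y p < 0 → ordDlog S.X p < 0) (σ : ι) {t : ℂ}
    (ht : D.IsTimeZero σ t) :
    Tendsto (fun u : ℝ => D.laplaceY σ u) atTop (𝓝 (Complex.exp (-t))) := by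
  obtain ⟨K, R, hK⟩ := D.exists_y_growth hpoles σ
  have h1 := (tendsto_integral_exp_neg_mul_sq (D.y_continuous σ) hK ht).const_mul
    (2 / (Real.sqrt Real.pi : ℂ))
  have hπ : (Real.sqrt Real.pi : ℂ) ≠ 0 := by
    exact_mod_cast (Real.sqrt_pos.2 Real.pi_pos).ne'
  have h2 : 2 / (Real.sqrt Real.pi : ℂ) * (Complex.exp (-t) * (Real.sqrt Real.pi / 2 : ℝ)) =
      Complex.exp (-t) := by
    push_cast
    field_simp
  rw [h2] at h1
  refine h1.congr fun u => ?_
  have h3 : D.laplace σ (D.y σ) u = Complex.exp (-(u * D.a σ)) *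
      ∫ s : ℝ, Complex.exp (-u * (s : ℂ) ^ 2) * D.y σ s * (2 * s) := by
    rw [laplace, ← integral_const_mul]
    congr 1
    ext s
    rw [integrand, mul_add, Complex.exp_add, neg_mul]
    ring
  rw [laplaceY, h3, Complex.exp_neg]
  field_simp [Complex.exp_ne_zero]

end SteepestDescent

end LaplaceTransforms

end RSurf

end

theorem mainTheorem11 {C : Type*} [TopologicalSpace C] [T2Space C] [CompactSpace C]
    [ConnectedSpace C] [ChartedSpace ℂ C] [IsManifold 𝓘(ℂ, ℂ) ω C]
    {ι : Type*} [Fintype ι] {genus : ℕ}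
    (S : RSurf.SpectralCurve C ι genus)
    (hpoles : ∀ p : C, RSurf.ordDlog S.Y p < 0 → RSurf.ordDlog S.X p < 0)
    (D : RSurf.SteepestDescent S)
    (ξ : ι → ι → ℝ → ℂ) (hξ : ∀ σ σ', D.IsBranch σ σ' (ξ σ σ'))
    (t : ι → ℂ) (ht : ∀ σ, D.IsTimeZero σ (t σ)) (σ : ι) :
    (∀ u : ℂ, 0 < u.re →
      MeasureTheory.Integrable (D.integrand σ (D.y σ) u) ∧
      (∀ σ', MeasureTheory.Integrable (D.integrand σ (ξ σ σ') u)) ∧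
      Complex.exp (t σ) * D.laplaceY σ u =
        ∑ σ', Complex.exp (t σ - t σ') * D.f σ (ξ σ σ') u ∧
      ∀ g : ℂ, Complex.exp (-t σ) * Complex.exp (-g) = D.laplaceY σ u →
        Complex.exp (-g) = ∑ σ', Complex.exp (t σ - t σ') * D.f σ (ξ σ σ') u) ∧
    ∃ g : ℝ → ℂ, Tendsto g atTop (𝓝 0) ∧
      ∀ᶠ u : ℝ in atTop, Complex.exp (-t σ) * Complex.exp (-g u) = D.laplaceY σ u := by

  refine ⟨fun u hu => ?_, ?_⟩
  · have hsum : Complex.exp (t σ) * D.laplaceY σ u =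
        ∑ σ', Complex.exp (t σ - t σ') * D.f σ (ξ σ σ') u := by
      rw [D.laplaceY_eq_sum ht hpoles σ (hξ σ) hu, Finset.mul_sum]
      refine Finset.sum_congr rfl fun σ' _ => ?_
      rw [sub_eq_add_neg, Complex.exp_add, mul_assoc]
    refine ⟨D.integrable_integrand_y hpoles σ hu,
      fun σ' => D.integrable_integrand_branch (hξ σ σ') hu, hsum, fun g hg => ?_⟩
    rw [← hsum, ← hg, ← mul_assoc, ← Complex.exp_add, add_neg_cancel, Complex.exp_zero, one_mul]
  · have h1 : Tendsto (fun u : ℝ => Complex.exp (t σ) * D.laplaceY σ u) atTop (𝓝 1) := by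
      have := (D.tendsto_laplaceY hpoles σ (ht σ)).const_mul (Complex.exp (t σ))
      rwa [← Complex.exp_add, add_neg_cancel, Complex.exp_zero] at this
    -- The argument of the principal logarithm tends to `1`, where the logarithm is continuous with
    -- value `0`; it is therefore nonzero for large `u`, as the defining relation requires.
    refine ⟨fun u => -Complex.log (Complex.exp (t σ) * D.laplaceY σ u), ?_, ?_⟩
    · have h2 := (h1.clog Complex.one_mem_slitPlane).neg
      rwa [Complex.log_one, neg_zero] at h2
    · filter_upwards [h1.eventually_ne one_ne_zero] with u hu
      rw [neg_neg, Complex.exp_log hu, ← mul_assoc, ← Complex.exp_add, neg_add_cancel,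
        Complex.exp_zero, one_mul]
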